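/- **Setting.** Work in $\mathbb R^3$. Let $N=M_1=B(0,2)$, $M_2=B(0,1)$, $\Sigma=\partial B(0,1)$, and let $M=M_1\sqcup M_2$ carry the Euclidean metric $g$ on both (disjoint) pieces. Let $$F_1(x)=\Big(\frac{|x|}{2}+1\Big)\frac{x}{|x|},\quad 0<|x|\le 2,\qquad F_2=\mathrm{id}_{M_2},$$ so that $F=(F_1,F_2):(M_1\setminus\{0\})\sqcup M_2\to N\setminus\Sigma$ is a bijection. Let $\tilde g=F_*g$ on $N\setminus\Sigma$, i.e. $\tilde g_{jk}(y)=\sum_{p}\partial_j (F^{-1})^p(y)\,\partial_k(F^{-1})^p(y)$, with $|\tilde g|=\det(\tilde g_{jk})$ and $(\tilde g^{jk})=(\tilde g_{jk})^{-1}$. Let $k\in\mathbb R$. *Finite energy solutions.* A measurable $\tilde u$ on $N$ is a finite energy solution of $$(\Delta_{\tilde g}+k^2)\tilde u=\tilde f\ \text{ on }N,\qquad \tilde u|_{\partial N}=\tilde h \tag{1}$$ if $\tilde u\in L^2(N,|\tilde g|^{1/2}dx)$; $\tilde u\in H^1_{loc}(N\setminus\Sigma,dx)$; $\int_{N\setminus\Sigma}|\tilde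 g|^{1/2}\tilde g^{ij}\partial_i\tilde u\,\partial_j\tilde u\,dx<\infty$; $\tilde u|_{\partial N}=\tilde h$ in the sense of ($L^2$-valued) traces; and $D^j\tilde u:=|\tilde g|^{1/2}\tilde g^{ij}\partial_i\tilde u$, defined almost everywhere, is an integrable density on $N$ such that, for all $\tilde\psi\in C^\infty(\overline N)$ with $\tilde\psi|_{\partial N}=0$, $$\int_N\big[-(D^j\tilde u)\,\partial_j\tilde\psi+k^2\,\tilde u\,\tilde\psi\,|\tilde g|^{1/2}\big]dx=\int_N\tilde f\,\tilde\psi\,|\tilde g|^{1/2}dx .$$ **Theorem.** Let $u=(u_1,u_2):(M_1\setminus\{0\})\sqcup M_2\to\mathbb R$ and $\tilde u:N\setminus\Sigma\to\mathbb R$ be measurable with $u=\tilde u\circ F$. Let $f=(f_1,f_2):(M_1\setminus\{0\})\sqcup M_2\to\mathbb R$ and $\tilde f:N\setminus\Sigma\to\mathbb R$ be $L^2$ functions, supported away from $0\in M_1$ and from $\Sigma$ respectively, with $f=\tilde f\circ F$. Let $\tilde h:\partial N\to\mathbb R$ and $h:\partial M_1\to\mathbb R$ satisfy $h=\tilde h\circ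 F_1$. Then the following are equivalent. 1. $\tilde u$ is a finite energy solution of (1) with source $\tilde f$ and Dirichlet data $\tilde h$. 2. $u_1$ agrees almost everywhere on $M_1\setminus\{0\}$ with a continuous function on $M_1$, again denoted $u_1$, that belongs to $H^1(M_1)$ and satisfies $$(\Delta+k^2)u_1=f_1\ \text{ on }M_1\text{ (in the sense of distributions)},\qquad u_1|_{\partial M_1}=h \text{ (trace)}; \tag{2}$$ and $u_2\in H^1(M_2)$ satisfies $$(\Delta+k^2)u_2=f_2\ \text{ on }M_2,\qquad \partial_\nu u_2|_{\partial M_2}=b \tag{3}$$ with $b=0$. Here, for $u_2\in H^1(M_2)$ solving the equation in the sense of distributions, the Neumann datum $b=\partial_\nu u_2|_{\partial M_2}$ ($\nu$ the outer unit normal) is the linear functional on $C^\infty(\partial M_2)$ given by Green's formula: for all $\varphi\in C^\infty(\overline{M_2})$, $$\int_{M_2}\big[\nabla u_2\cdot\nabla\varphi+(f_2-k^2u_2)\varphi\big]dx=b(\varphi|_{\partial M_2}).$$ A function $\beta$ on $\partial M_2$ is identified with $\psi\mapsto\int_{\partial M_2}\beta\psi\,dS$. Moreover, if $u$ satisfies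 (2) and (3) with some $b\neq0$, then $\tilde u=u\circ F^{-1}$ is not a finite energy solution of (1). -/

import Mathlib

open MeasureTheory Filter Topology
open scoped ContDiff ENNReal Matrix

noncomputable section

namespace Cloak

/-- Euclidean three-space. -/
abbrev E : Type := EuclideanSpace ℝ (Fin 3)

/-! ### The geometry of the single-coating cloak -/

/-- The ball `M₁ = B(0,2)`. -/
def M₁ : Set E := Metric.ball 0 2

/-- The ball `M₂ = B(0,1)`. It is a separate copy: functions on the disjoint union
`M = M₁ ⊔ M₂` are pairs of functions. -/
def M₂ : Set E := Metric.ball 0 1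

/-- The cloaking device `N = B(0,2)`. -/
def N : Set E := Metric.ball 0 2

/-- The cloaking surface `Σ = ∂B(0,1)`. -/
def surf : Set E := Metric.sphere 0 1

/-- The outer boundary `∂N = ∂M₁ = ∂B(0,2)`. -/
def outerBdry : Set E := Metric.sphere 0 2

/-- The singular transformation `F₁(x) = (|x|/2 + 1) x/|x|` from `M₁ \ {0}` to
`N₁ = B(0,2) \ closed B(0,1)`. -/
def F₁ (x : E) : E := (‖x‖ / 2 + 1) • (‖x‖⁻¹ • x)

/-- The regular transformation `F₂ : M₂ → N₂ = B(0,1)`, the identity. -/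
def F₂ (x : E) : E := x

/-- The inverse of `F = (F₁, F₂)` on `N \ Σ`, as a map to points of `ℝ³`: a point of `N₁` is sent
to its preimage under `F₁`, a point of `N₂` to its preimage under `F₂`. -/
def Finv (y : E) : E := if 1 < ‖y‖ then (2 * (‖y‖ - 1)) • (‖y‖⁻¹ • y) else y

theorem norm_F₁ {x : E} (hx : x ≠ 0) : ‖F₁ x‖ = ‖x‖ / 2 + 1 := by
  have h : 0 < ‖x‖ := norm_pos_iff.mpr hx
  rw [F₁, norm_smul, norm_smul, norm_inv, norm_norm, inv_mul_cancel₀ h.ne', mul_one,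
    Real.norm_of_nonneg (by positivity)]

theorem Finv_F₁ {x : E} (hx : x ≠ 0) : Finv (F₁ x) = x := by
  have h : 0 < ‖x‖ := norm_pos_iff.mpr hx
  have h1 : 1 < ‖F₁ x‖ := by rw [norm_F₁ hx]; linarith
  rw [Finv, if_pos h1, norm_F₁ hx, F₁, smul_smul, smul_smul, smul_smul]
  have : 2 * (‖x‖ / 2 + 1 - 1) * (‖x‖ / 2 + 1)⁻¹ * (‖x‖ / 2 + 1) * ‖x‖⁻¹ = 1 := by
    have h2 : (‖x‖ / 2 + 1) ≠ 0 := by positivity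
    field_simp
    ring
  rw [this, one_smul]

theorem F₁_Finv {y : E} (hy : 1 < ‖y‖) : F₁ (Finv y) = y := by
  have h : 0 < ‖y‖ := by linarith
  have hn : ‖Finv y‖ = 2 * (‖y‖ - 1) := by
    rw [Finv, if_pos hy, norm_smul, norm_smul, norm_inv, norm_norm, inv_mul_cancel₀ h.ne', mul_one,
      Real.norm_of_nonneg (by linarith)]
  rw [F₁, hn, Finv, if_pos hy, smul_smul, smul_smul, smul_smul]
  have : (2 * (‖y‖ - 1) / 2 + 1) * (2 * (‖y‖ - 1))⁻¹ * (2 * (‖y‖ - 1)) * ‖y‖⁻¹ = 1 := by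
    have h2 : (‖y‖ - 1) ≠ 0 := by linarith
    field_simp
    ring
  rw [this, one_smul]

theorem Finv_F₂ {x : E} (hx : x ∈ M₂) : Finv (F₂ x) = x := by
  have h : ‖x‖ < 1 := by simpa [M₂] using hx
  rw [F₂, Finv, if_neg (by linarith)]

/-- The Jacobian matrix `∂(F⁻¹)^p / ∂y^j` at a point `y` of `N \ Σ`. -/
def jacFinv (y : E) : Matrix (Fin 3) (Fin 3) ℝ :=
  Matrix.of fun p j => fderiv ℝ Finv y (EuclideanSpace.single j 1) p

/-- The push-forward `g̃ = F_* g` of the Euclidean metric `g_{pq} = δ_{pq}`: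
`g̃_{jk}(y) = ∑_{p,q} ∂_j (F⁻¹)^p ∂_k (F⁻¹)^q g_{pq}`. -/
def gt (y : E) : Matrix (Fin 3) (Fin 3) ℝ :=
  Matrix.of fun j k => ∑ p, ∑ q,
    jacFinv y p j * jacFinv y q k * (1 : Matrix (Fin 3) (Fin 3) ℝ) p q

/-- The density `|g̃|^{1/2}`. -/
def sqrtDet (y : E) : ℝ := Real.sqrt (gt y).det

/-- The field with components `D^j = |g̃|^{1/2} ∑_i g̃^{ij} G_i`. -/
def flux (G : E → E) (y : E) : E :=
  WithLp.toLp 2 fun j => sqrtDet y * ∑ i, (gt y)⁻¹ i j * G y i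

/-- The energy density `|g̃|^{1/2} ∑_{i,j} g̃^{ij} G_i G_j`. -/
def energyDensity (G : E → E) (y : E) : ℝ :=
  sqrtDet y * ∑ i, ∑ j, (gt y)⁻¹ i j * G y i * G y j

/-! ### Weak derivatives, Sobolev functions, traces -/

/-- `G` is the weak (distributional) gradient of `u` on the open set `Ω`. -/
def HasWeakGradient (Ω : Set E) (u : E → ℝ) (G : E → E) : Prop :=
  LocallyIntegrableOn u Ω ∧ LocallyIntegrableOn G Ω ∧
    ∀ φ : E → ℝ, ContDiff ℝ ∞ φ → HasCompactSupport φ → tsupport φ ⊆ Ω →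
      ∫ x in Ω, u x • gradient φ x = -∫ x in Ω, φ x • G x

/-- `u ∈ H¹_loc(Ω)` with weak gradient `G`. -/
def IsH1Loc (Ω : Set E) (u : E → ℝ) (G : E → E) : Prop :=
  HasWeakGradient Ω u G ∧ ∀ K : Set E, IsCompact K → K ⊆ Ω →
    MemLp u 2 (volume.restrict K) ∧ MemLp G 2 (volume.restrict K)

/-- `u ∈ H¹(Ω)` with weak gradient `G`. -/
def IsH1 (Ω : Set E) (u : E → ℝ) (G : E → E) : Prop :=
  HasWeakGradient Ω u G ∧ MemLp u 2 (volume.restrict Ω) ∧ MemLp G 2 (volume.restrict Ω)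

/-- The Euclidean surface measure on `∂B(0,2)` (up to a constant factor). -/
def outerMeasure : Measure E := (Measure.hausdorffMeasure 2).restrict outerBdry

/-- `u|_{∂B(0,2)} = h` in the sense of traces of `H¹` functions: in some collar
`2 - δ < |x| < 2` the function `u` is an `H¹` limit of functions smooth up to the boundary whose
restrictions to the boundary converge to `h` in `L²`. -/
def HasTrace (u h : E → ℝ) : Prop :=
  MemLp h 2 outerMeasure ∧
  ∃ δ : ℝ, 0 < δ ∧ δ < 1 ∧ ∃ G : E → E, ∃ v : ℕ → E → ℝ,
    IsH1 {x | 2 - δ < ‖x‖ ∧ ‖x‖ < 2} u G ∧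
    (∀ n, ContDiff ℝ ∞ (v n)) ∧
    Tendsto (fun n => eLpNorm (fun x => v n x - u x) 2
      (volume.restrict {x | 2 - δ < ‖x‖ ∧ ‖x‖ < 2})) atTop (𝓝 0) ∧
    Tendsto (fun n => eLpNorm (fun x => gradient (v n) x - G x) 2
      (volume.restrict {x | 2 - δ < ‖x‖ ∧ ‖x‖ < 2})) atTop (𝓝 0) ∧
    Tendsto (fun n => eLpNorm (fun x => v n x - h x) 2 outerMeasure) atTop (𝓝 0)

/-- The essential support of `f`, as a function on `Ω`, does not meet `K`. -/
def SupportedAwayFrom (Ω K : Set E) (f : E → ℝ) : Prop :=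
  ∃ V : Set E, IsOpen V ∧ K ⊆ V ∧ ∀ᵐ x ∂volume.restrict (Ω ∩ V), f x = 0

/-! ### The problem on the cloaking device `N` -/

/-- `u` is a finite energy solution of `(Δ_g̃ + k²) u = f` on `N`, `u|_{∂N} = h`. The measure
`D^j_g̃ u` on `N` is the one with density `flux G`, defined almost everywhere on `N`. -/
def IsFiniteEnergySolution (k : ℝ) (f h u : E → ℝ) : Prop :=
  MemLp u 2 ((volume.restrict N).withDensity fun x => ENNReal.ofReal (sqrtDet x)) ∧
  HasTrace u h ∧
  ∃ G : E → E,
    IsH1Loc (N \ surf) u G ∧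
    IntegrableOn (energyDensity G) (N \ surf) ∧
    IntegrableOn (flux G) N ∧
    ∀ ψ : E → ℝ, ContDiff ℝ ∞ ψ → (∀ x ∈ outerBdry, ψ x = 0) →
      ∫ x in N, (-inner ℝ (flux G x) (gradient ψ x) + k ^ 2 * u x * ψ x * sqrtDet x) =
        ∫ x in N, f x * ψ x * sqrtDet x

/-! ### The problem on `M₁` and `M₂` -/

/-- `u ∈ H¹(Ω)` solves `(Δ + k²) u = f` on `Ω` in the sense of distributions, for the Euclidean
Laplacian; `G` is the weak gradient of `u`. -/
def IsHelmholtzSolution (Ω : Set E) (k : ℝ) (f u : E → ℝ) (G : E → E) : Prop :=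
  IsH1 Ω u G ∧
  ∀ φ : E → ℝ, ContDiff ℝ ∞ φ → HasCompactSupport φ → tsupport φ ⊆ Ω →
    ∫ x in Ω, (-inner ℝ (G x) (gradient φ x) + k ^ 2 * u x * φ x) = ∫ x in Ω, f x * φ x

/-- `u₁`, given on `M₁ \ {0}` up to null sets, extends continuously to `M₁`, and the extension
solves `(Δ + k²) u₁ = f₁` on `M₁`, `u₁|_{∂M₁} = h`. -/
def SolvesOnM₁ (k : ℝ) (f₁ h u₁ : E → ℝ) : Prop :=
  ∃ U : E → ℝ, ContinuousOn U M₁ ∧ (∀ᵐ x ∂volume.restrict (M₁ \ {0}), U x = u₁ x) ∧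
    (∃ G : E → E, IsHelmholtzSolution M₁ k f₁ U G) ∧ HasTrace U h

/-- The space `C^∞(∂M₂)`, as the space of restrictions to the unit sphere of smooth functions. -/
def smoothBdry : Submodule ℝ (Metric.sphere (0 : E) 1 → ℝ) where
  carrier := {ψ | ∃ φ : E → ℝ, ContDiff ℝ ∞ φ ∧ ∀ x, ψ x = φ x}
  add_mem' := by
    rintro a b ⟨φ, hφ, ha⟩ ⟨χ, hχ, hb⟩
    exact ⟨fun x => φ x + χ x, hφ.add hχ, fun x => by simp [ha, hb]⟩
  zero_mem' := ⟨fun _ => 0, contDiff_const, fun _ => rfl⟩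
  smul_mem' := by
    rintro c a ⟨φ, hφ, ha⟩
    exact ⟨fun x => c * φ x, contDiff_const.mul hφ, fun x => by simp [ha]⟩

/-- The restriction of a smooth function to `∂M₂`. -/
def bdryRestrict (φ : E → ℝ) (hφ : ContDiff ℝ ∞ φ) : smoothBdry :=
  ⟨fun x => φ x, φ, hφ, fun _ => rfl⟩

/-- `u₂ ∈ H¹(M₂)` solves `(Δ + k²) u₂ = f₂` on `M₂` with Neumann datum `∂_ν u₂|_{∂M₂} = b`.
Here `ν` is the outer normal and the datum is a functional on `C^∞(∂M₂)`; a function `β` on `∂M₂`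
stands for `ψ ↦ ∫ β ψ dS`. The normal derivative is defined by Green's formula
`∫_{M₂} (∇u₂ · ∇φ + (Δu₂) φ) dx = ∫_{∂M₂} (∂_ν u₂) φ dS` with `Δu₂ = f₂ - k² u₂`. -/
def SolvesOnM₂ (k : ℝ) (f₂ : E → ℝ) (b : smoothBdry →ₗ[ℝ] ℝ) (u₂ : E → ℝ) : Prop :=
  ∃ G : E → E, IsHelmholtzSolution M₂ k f₂ u₂ G ∧
    ∀ (φ : E → ℝ) (hφ : ContDiff ℝ ∞ φ),
      ∫ x in M₂, (inner ℝ (G x) (gradient φ x) + (f₂ x - k ^ 2 * u₂ x) * φ x) =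
        b (bdryRestrict φ hφ)

end Cloak

end

/-!
The transformation `F₁` opens the origin of `M₁` to the surface `Σ`. On `N₁ = B(0,2) \ closed B(0,1)`
the metric `g̃` is by construction the one for which `F₁ : M₁ \ {0} → N₁` is an isometry, and on `M₂`
it is Euclidean. Hence weighted `L²` norms, energies and, by the chain rule for weak gradients
(`Diffeo.hasWeakGradient_comp`), the finite energy condition on `N₁` are those of the pull-back
`u₁ = ũ ∘ F₁` on the punctured ball (`memLp_N_iff`, `integrableOn_energyDensity_iff`), and the weak
equation tested with `ψ` becomes the Euclidean equation for `u₁` tested with `ψ ∘ F₁`, plus the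
Euclidean equation for `u₂` tested with `ψ` on `M₂` (`weakEquation_iff`).

The function `ψ ∘ F₁` is in general discontinuous at the origin, but its gradient is `O(1/|x|)`. As
`1/|x|` is square integrable in dimension three, cut-offs at scale `1/n` around the origin cost
nothing in the limit: an equation `div B = a` with `B, a ∈ L²` that holds on `M₁ \ {0}` can be tested
with all such functions (`WeakDiv.integral_singularTest`). Two things follow. The origin is removable,
so that `u₁` solves the Helmholtz equation on all of `M₁`. And the outer part of the weak equation
vanishes for every `ψ`, whatever its values on `Σ`; what is left is the equation on `M₂` tested with
arbitrary smooth functions, which is the Neumann problem with datum zero (`forall_weakEquation_iff`).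
The bound `‖DF₁(x)‖ = O(1/|x|)` also makes the flux integrable up to `Σ` in the converse direction.

The remaining ingredients are the continuity of `u₁`, which after localization is the embedding
`H² ⊂ C` on `ℝ³` (`exists_continuousOn_of_weakDiv`); the invariance of traces on the outer boundary,
where `F₁` is smooth and restricts to the identity (`HasTraceOn.comp`); and the uniqueness of weak
gradients, by which the Neumann datum is determined by `u₂` (`SolvesOnM₂.unique`). The last of these
excludes a finite energy solution when the datum is not zero.
-/

namespace Cloak

/-! ### Test functions and weak divergences -/

/-- `φ` is a test function on `Ω`: smooth, with compact support contained in `Ω`. -/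
structure IsTest (Ω : Set E) (φ : E → ℝ) : Prop where
  smooth : ContDiff ℝ ∞ φ
  compact : HasCompactSupport φ
  subset : tsupport φ ⊆ Ω

/-- The equation `div B = a` on `Ω` in the sense of distributions. -/
def WeakDiv (Ω : Set E) (B : E → E) (a : E → ℝ) : Prop :=
  ∀ φ : E → ℝ, IsTest Ω φ → ∫ x in Ω, (inner ℝ (B x) (gradient φ x) + a x * φ x) = 0

/-- The classical divergence of a differentiable vector field. -/
noncomputable def dvg (V : E → E) (x : E) : ℝ := ∑ i, fderiv ℝ V x (EuclideanSpace.single i 1) i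

theorem gradient_eq_toDual_symm (φ : E → ℝ) (x : E) :
    gradient φ x = (InnerProductSpace.toDual ℝ E).symm (fderiv ℝ φ x) := rfl

theorem inner_gradient (φ : E → ℝ) (x v : E) : inner ℝ v (gradient φ x) = fderiv ℝ φ x v := by
  rw [real_inner_comm, gradient_eq_toDual_symm, InnerProductSpace.toDual_symm_apply]

theorem contDiff_gradient {φ : E → ℝ} (hφ : ContDiff ℝ ∞ φ) : ContDiff ℝ ∞ (gradient φ) := by
  have : ContDiff ℝ ∞ (fderiv ℝ φ) := hφ.fderiv_right (by simp)
  exact (InnerProductSpace.toDual ℝ E).symm.toContinuousLinearEquiv.contDiff.comp this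

theorem norm_gradient (φ : E → ℝ) (x : E) : ‖gradient φ x‖ = ‖fderiv ℝ φ x‖ := by
  rw [gradient_eq_toDual_symm, LinearIsometryEquiv.norm_map]

theorem gradient_eq_zero_of_notMem_tsupport {φ : E → ℝ} {x : E} (hx : x ∉ tsupport φ) :
    gradient φ x = 0 := by
  have : fderiv ℝ φ x = 0 := by
    have := (tsupport_fderiv_subset ℝ (f := φ)).trans subset_rfl
    exact image_eq_zero_of_notMem_tsupport fun h => hx (this h)
  rw [gradient_eq_toDual_symm, this, map_zero]

theorem tsupport_gradient_subset {φ : E → ℝ} : tsupport (gradient φ) ⊆ tsupport φ := by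
  refine closure_minimal (fun x hx => ?_) (isClosed_tsupport φ)
  by_contra hx'
  exact hx (gradient_eq_zero_of_notMem_tsupport hx')

theorem gradient_congr_of_isOpen {Ω : Set E} (hΩ : IsOpen Ω) {φ ψ : E → ℝ}
    (h : ∀ x ∈ Ω, ψ x = φ x) {x : E} (hx : x ∈ Ω) : gradient ψ x = gradient φ x := by
  refine Filter.EventuallyEq.gradient_eq ?_
  filter_upwards [hΩ.mem_nhds hx] with z hz
  exact h z hz

/-- A locally integrable field paired with a continuous one of compact support is integrable. -/
theorem integrable_inner_of_tsupport_subset {F : Type*} [NormedAddCommGroup F]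
    [InnerProductSpace ℝ F] {Ω : Set E} {B V : E → F}
    (hB : LocallyIntegrableOn B Ω) (hV : Continuous V) (hc : HasCompactSupport V)
    (hs : tsupport V ⊆ Ω) : Integrable (fun x => inner ℝ (B x) (V x)) := by
  have hBK : IntegrableOn B (tsupport V) := hB.integrableOn_compact_subset hs hc
  obtain ⟨C, hC⟩ := hV.bounded_above_of_compact_support hc
  have hK : IntegrableOn (fun x => inner ℝ (B x) (V x)) (tsupport V) := by
    refine Integrable.mono' (hBK.norm.mul_const C)
      (hBK.aestronglyMeasurable.inner hV.aestronglyMeasurable) (ae_of_all _ fun x => ?_)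
    exact (norm_inner_le_norm _ _).trans (by gcongr; exact hC x)
  refine hK.integrable_of_forall_notMem_eq_zero fun x hx => ?_
  rw [image_eq_zero_of_notMem_tsupport hx, inner_zero_right]

theorem integrable_mul_of_tsupport_subset {Ω : Set E} {b φ : E → ℝ}
    (hb : LocallyIntegrableOn b Ω) (hφ : Continuous φ) (hc : HasCompactSupport φ)
    (hs : tsupport φ ⊆ Ω) : Integrable (fun x => b x * φ x) := by
  simpa [mul_comm] using integrable_inner_of_tsupport_subset hb hφ hc hs

namespace IsTest

variable {Ω : Set E} {φ : E → ℝ}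

theorem mono {Ω' : Set E} (h : IsTest Ω φ) (hΩ : Ω ⊆ Ω') : IsTest Ω' φ :=
  ⟨h.smooth, h.compact, h.subset.trans hΩ⟩

theorem eq_zero (h : IsTest Ω φ) {x : E} (hx : x ∉ Ω) : φ x = 0 :=
  image_eq_zero_of_notMem_tsupport fun h' => hx (h.subset h')

theorem gradient_eq_zero (h : IsTest Ω φ) {x : E} (hx : x ∉ Ω) : gradient φ x = 0 :=
  gradient_eq_zero_of_notMem_tsupport fun h' => hx (h.subset h')

theorem differentiable (h : IsTest Ω φ) : Differentiable ℝ φ :=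
  h.smooth.differentiable (by simp)

theorem compact_gradient (h : IsTest Ω φ) : HasCompactSupport (gradient φ) :=
  h.compact.of_isClosed_subset (isClosed_tsupport _) tsupport_gradient_subset

theorem integrable_inner_gradient (h : IsTest Ω φ) {B : E → E} (hB : LocallyIntegrableOn B Ω) :
    Integrable (fun x => inner ℝ (B x) (gradient φ x)) :=
  integrable_inner_of_tsupport_subset hB (contDiff_gradient h.smooth).continuous
    h.compact_gradient (tsupport_gradient_subset.trans h.subset)

theorem integrable_mul (h : IsTest Ω φ) {b : E → ℝ} (hb : LocallyIntegrableOn b Ω) :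
    Integrable (fun x => b x * φ x) :=
  integrable_mul_of_tsupport_subset hb h.smooth.continuous h.compact h.subset

end IsTest

theorem WeakDiv.mono {Ω Ω' : Set E} {B : E → E} {a : E → ℝ} (h : WeakDiv Ω' B a)
    (hΩ : Ω ⊆ Ω') : WeakDiv Ω B a := by
  intro φ hφ
  have key : ∀ s : Set E, Ω ⊆ s →
      ∫ x in s, (inner ℝ (B x) (gradient φ x) + a x * φ x) =
        ∫ x, (inner ℝ (B x) (gradient φ x) + a x * φ x) := fun s hs =>
    setIntegral_eq_integral_of_forall_compl_eq_zero fun x hx => by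
      rw [hφ.eq_zero fun h => hx (hs h), hφ.gradient_eq_zero fun h => hx (hs h)]; simp
  rw [key Ω subset_rfl, ← key Ω' hΩ]
  exact h φ (hφ.mono hΩ)

theorem WeakDiv.congr_ae {Ω : Set E} {B B' : E → E} {a a' : E → ℝ} (h : WeakDiv Ω B a)
    (hB : ∀ᵐ x ∂volume.restrict Ω, B x = B' x) (ha : ∀ᵐ x ∂volume.restrict Ω, a x = a' x) :
    WeakDiv Ω B' a' := by
  intro φ hφ
  rw [← h φ hφ]
  apply integral_congr_ae
  filter_upwards [hB, ha] with x h1 h2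
  rw [h1, h2]

/-- The weak divergence of a field is unique up to null sets. -/
theorem WeakDiv.ae_eq {Ω : Set E} (hΩ : IsOpen Ω) {B : E → E} {a a' : E → ℝ}
    (hB : LocallyIntegrableOn B Ω) (ha : LocallyIntegrableOn a Ω) (ha' : LocallyIntegrableOn a' Ω)
    (h : WeakDiv Ω B a) (h' : WeakDiv Ω B a') : ∀ᵐ x ∂volume.restrict Ω, a x = a' x := by
  rw [ae_restrict_iff' hΩ.measurableSet]
  have key := hΩ.ae_eq_zero_of_integral_contDiff_smul_eq_zero (ha.sub ha') (μ := volume)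
    (fun φ h1 h2 h3 => by
      have hφ : IsTest Ω φ := ⟨h1, h2, h3⟩
      have e1 := h φ hφ
      have e2 := h' φ hφ
      rw [integral_add (hφ.integrable_inner_gradient hB).integrableOn
        (hφ.integrable_mul ha).integrableOn] at e1
      rw [integral_add (hφ.integrable_inner_gradient hB).integrableOn
        (hφ.integrable_mul ha').integrableOn] at e2
      have e3 : ∫ x in Ω, (a x * φ x - a' x * φ x) = 0 := by
        rw [integral_sub (hφ.integrable_mul ha).integrableOn (hφ.integrable_mul ha').integrableOn]
        linarith
      rw [setIntegral_eq_integral_of_forall_compl_eq_zero] at e3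
      · rw [← e3]
        congr 1; ext x
        simp only [Pi.sub_apply, smul_eq_mul]; ring
      · intro x hx
        rw [hφ.eq_zero hx]; simp)
  filter_upwards [key] with x hx hxΩ
  exact sub_eq_zero.mp (hx hxΩ)

theorem locallyIntegrableOn_inner_const {Ω : Set E} {G : E → E} (hG : LocallyIntegrableOn G Ω)
    (e : E) : LocallyIntegrableOn (fun x => inner ℝ (G x) e) Ω := by
  intro x hx
  obtain ⟨U, hU, hi⟩ := hG x hx
  exact ⟨U, hU, hi.inner_const e⟩

theorem locallyIntegrableOn_smul_const {Ω : Set E} {u : E → ℝ} (hu : LocallyIntegrableOn u Ω)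
    (e : E) : LocallyIntegrableOn (fun x => u x • e) Ω := by
  intro x hx
  obtain ⟨U, hU, hi⟩ := hu x hx
  exact ⟨U, hU, hi.smul_const e⟩

/-- `∇u = G` in the sense of distributions means `div (u e) = ⟪G, e⟫` for every vector `e`. -/
theorem hasWeakGradient_iff {Ω : Set E} {u : E → ℝ} {G : E → E}
    (hu : LocallyIntegrableOn u Ω) (hG : LocallyIntegrableOn G Ω) :
    HasWeakGradient Ω u G ↔
      ∀ e : E, WeakDiv Ω (fun x => u x • e) (fun x => inner ℝ (G x) e) := by
  have key : ∀ φ, IsTest Ω φ → ∀ e : E,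
      ∫ x in Ω, (inner ℝ (u x • e) (gradient φ x) + inner ℝ (G x) e * φ x) =
        inner ℝ e (∫ x in Ω, u x • gradient φ x) + inner ℝ e (∫ x in Ω, φ x • G x) := by
    intro φ hφ e
    have i1 : Integrable (fun x => u x • gradient φ x) (volume.restrict Ω) := by
      have hc := hφ.compact_gradient
      have hs := tsupport_gradient_subset.trans hφ.subset
      have hK : IntegrableOn u (tsupport (gradient φ)) := hu.integrableOn_compact_subset hs hc
      obtain ⟨C, hC⟩ := (contDiff_gradient hφ.smooth).continuous.bounded_above_of_compact_support hc
      refine Integrable.integrableOn (IntegrableOn.integrable_of_forall_notMem_eq_zero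
        (s := tsupport (gradient φ)) ?_ fun x hx => ?_)
      · refine Integrable.mono' (hK.norm.mul_const C)
          (hK.aestronglyMeasurable.smul (contDiff_gradient hφ.smooth).continuous.aestronglyMeasurable)
          (ae_of_all _ fun x => ?_)
        rw [norm_smul]
        gcongr
        exact hC x
      · rw [image_eq_zero_of_notMem_tsupport hx, smul_zero]
    have i2 : Integrable (fun x => φ x • G x) (volume.restrict Ω) := by
      have hc := hφ.compact
      have hK : IntegrableOn G (tsupport φ) := hG.integrableOn_compact_subset hφ.subset hc
      obtain ⟨C, hC⟩ := hφ.smooth.continuous.bounded_above_of_compact_support hc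
      refine Integrable.integrableOn (IntegrableOn.integrable_of_forall_notMem_eq_zero
        (s := tsupport φ) ?_ fun x hx => ?_)
      · refine Integrable.mono' (hK.norm.const_mul C)
          (hφ.smooth.continuous.aestronglyMeasurable.smul hK.aestronglyMeasurable)
          (ae_of_all _ fun x => ?_)
        rw [norm_smul]
        gcongr
        exact hC x
      · rw [image_eq_zero_of_notMem_tsupport hx, zero_smul]
    rw [← integral_inner i1, ← integral_inner i2, ← integral_add (i1.const_inner e)
      (i2.const_inner e)]
    congr 1; ext x
    rw [real_inner_smul_left, real_inner_smul_right, real_inner_smul_right,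
      real_inner_comm e (G x)]
    ring
  constructor
  · intro h e φ hφ
    rw [key φ hφ e, h.2.2 φ hφ.smooth hφ.compact hφ.subset, inner_neg_right, neg_add_cancel]
  · intro h
    refine ⟨hu, hG, fun φ h1 h2 h3 => ?_⟩
    have hφ : IsTest Ω φ := ⟨h1, h2, h3⟩
    refine ext_inner_left ℝ fun e => ?_
    have := h e φ hφ
    rw [key φ hφ e] at this
    rw [inner_neg_right]; linarith

theorem HasWeakGradient.weakDiv {Ω : Set E} {u : E → ℝ} {G : E → E} (h : HasWeakGradient Ω u G)
    (e : E) : WeakDiv Ω (fun x => u x • e) (fun x => inner ℝ (G x) e) :=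
  (hasWeakGradient_iff h.1 h.2.1).1 h e

theorem HasWeakGradient.mono {Ω Ω' : Set E} {u : E → ℝ} {G : E → E}
    (h : HasWeakGradient Ω' u G) (hΩ : Ω ⊆ Ω') : HasWeakGradient Ω u G :=
  (hasWeakGradient_iff (h.1.mono_set hΩ) (h.2.1.mono_set hΩ)).2
    fun e => (h.weakDiv e).mono hΩ

/-- The weak gradient is unique up to null sets. -/
theorem HasWeakGradient.ae_eq {Ω : Set E} (hΩ : IsOpen Ω) {u : E → ℝ} {G G' : E → E}
    (h : HasWeakGradient Ω u G) (h' : HasWeakGradient Ω u G') :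
    ∀ᵐ x ∂volume.restrict Ω, G x = G' x := by
  have key : ∀ i : Fin 3, ∀ᵐ x ∂volume.restrict Ω, G x i = G' x i := by
    intro i
    have := WeakDiv.ae_eq hΩ (locallyIntegrableOn_smul_const h.1 _)
      (locallyIntegrableOn_inner_const h.2.1 _) (locallyIntegrableOn_inner_const h'.2.1 _)
      (h.weakDiv (EuclideanSpace.single i 1)) (h'.weakDiv (EuclideanSpace.single i 1))
    filter_upwards [this] with x hx
    simpa [EuclideanSpace.inner_single_right] using hx
  filter_upwards [ae_all_iff.2 key] with x hx
  ext i
  exact hx i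

/-- The defining identity of the weak gradient, tested against a vector field. -/
theorem HasWeakGradient.integral_mul_dvg {Ω : Set E} {u : E → ℝ} {G : E → E}
    (h : HasWeakGradient Ω u G) {V : E → E} (hV : ContDiff ℝ ∞ V) (hc : HasCompactSupport V)
    (hs : tsupport V ⊆ Ω) :
    ∫ x in Ω, u x * dvg V x = -∫ x in Ω, inner ℝ (G x) (V x) := by
  have hVi : ∀ i : Fin 3, IsTest Ω (fun x => V x i) := by
    intro i
    have hsub : tsupport (fun x => V x i) ⊆ tsupport V := by
      refine closure_mono fun x hx => ?_
      simp only [Function.mem_support] at hx ⊢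
      intro h0; rw [h0] at hx; simp at hx
    exact ⟨(EuclideanSpace.proj (𝕜 := ℝ) i).contDiff.comp hV,
      hc.of_isClosed_subset (isClosed_tsupport _) hsub, hsub.trans hs⟩
  have hd : ∀ x, DifferentiableAt ℝ V x := fun x => hV.differentiable (by simp) x
  have e1 : ∀ i x, inner ℝ (EuclideanSpace.single i (1 : ℝ)) (gradient (fun x => V x i) x) =
      fderiv ℝ V x (EuclideanSpace.single i 1) i := by
    intro i x
    rw [inner_gradient]
    have := ((EuclideanSpace.proj (𝕜 := ℝ) i).hasFDerivAt.comp x (hd x).hasFDerivAt).fderiv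
    have h2 : ((EuclideanSpace.proj (𝕜 := ℝ) i : E → ℝ) ∘ V) = fun x => V x i := rfl
    rw [← h2, this]; rfl
  have hsum : ∀ x, u x * dvg V x + inner ℝ (G x) (V x) =
      ∑ i, (inner ℝ (u x • EuclideanSpace.single i (1 : ℝ)) (gradient (fun x => V x i) x) +
        inner ℝ (G x) (EuclideanSpace.single i (1 : ℝ)) * V x i) := by
    intro x
    rw [Finset.sum_add_distrib, dvg, Finset.mul_sum]
    congr 1
    · refine Finset.sum_congr rfl fun i _ => ?_
      rw [real_inner_smul_left, e1]
    · rw [PiLp.inner_apply]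
      refine Finset.sum_congr rfl fun i _ => ?_
      simp [EuclideanSpace.inner_single_right, mul_comm]
  have i0 : ∀ i : Fin 3, IntegrableOn (fun x => inner ℝ (u x • EuclideanSpace.single i (1 : ℝ))
      (gradient (fun x => V x i) x)) Ω := fun i =>
    ((hVi i).integrable_inner_gradient (locallyIntegrableOn_smul_const h.1 _)).integrableOn
  have i1 : ∀ i ∈ (Finset.univ : Finset (Fin 3)), IntegrableOn
      (fun x => inner ℝ (u x • EuclideanSpace.single i (1 : ℝ)) (gradient (fun x => V x i) x) +
        inner ℝ (G x) (EuclideanSpace.single i (1 : ℝ)) * V x i) Ω := fun i _ =>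
    (i0 i).add ((hVi i).integrable_mul (locallyIntegrableOn_inner_const h.2.1 _)).integrableOn
  have key : ∫ x in Ω, (u x * dvg V x + inner ℝ (G x) (V x)) = 0 := by
    simp_rw [hsum]
    rw [integral_finsetSum _ i1]
    exact Finset.sum_eq_zero fun i _ => h.weakDiv _ _ (hVi i)
  have i2 : IntegrableOn (fun x => u x * dvg V x) Ω := by
    have : (fun x => u x * dvg V x) = fun x => ∑ i, inner ℝ (u x • EuclideanSpace.single i (1 : ℝ))
      (gradient (fun x => V x i) x) := by
      ext x
      rw [dvg, Finset.mul_sum]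
      refine Finset.sum_congr rfl fun i _ => ?_
      rw [real_inner_smul_left, e1]
    rw [this]
    exact integrable_finsetSum _ fun i _ => i0 i
  rw [integral_add i2 (integrable_inner_of_tsupport_subset h.2.1 hV.continuous hc hs).integrableOn]
    at key
  linarith

/-- A smooth function has its gradient as weak gradient. -/
theorem hasWeakGradient_of_contDiff {Ω : Set E} {ζ : E → ℝ} (hζ : ContDiff ℝ ∞ ζ) :
    HasWeakGradient Ω ζ (gradient ζ) := by
  have h1 : LocallyIntegrable ζ := hζ.continuous.locallyIntegrable
  have h2 : LocallyIntegrable (gradient ζ) := (contDiff_gradient hζ).continuous.locallyIntegrable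
  refine HasWeakGradient.mono (Ω' := Set.univ) ?_ (Set.subset_univ _)
  rw [hasWeakGradient_iff (h1.locallyIntegrableOn _) (h2.locallyIntegrableOn _)]
  intro e φ hφ
  have i1 := hφ.integrable_mul (h1.locallyIntegrableOn _)
  have i2 := hφ.integrable_mul (locallyIntegrableOn_inner_const (h2.locallyIntegrableOn _) e)
  have i3 := hφ.integrable_inner_gradient
    (locallyIntegrableOn_smul_const (h1.locallyIntegrableOn Set.univ) e)
  have e1 : ∀ x, inner ℝ (ζ x • e) (gradient φ x) = ζ x * fderiv ℝ φ x e := fun x => by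
    rw [real_inner_smul_left, inner_gradient]
  have e2 : ∀ x, inner ℝ (gradient ζ x) e = fderiv ℝ ζ x e := fun x => by
    rw [real_inner_comm, inner_gradient]
  have := integral_mul_fderiv_eq_neg_fderiv_mul_of_integrable (μ := volume) (f := ζ) (g := φ)
    (v := e) (by simpa only [e2] using i2) (by simpa only [e1] using i3) i1
    (fun x _ => hζ.differentiable (by simp) x) (fun x _ => hφ.differentiable x)
  rw [setIntegral_univ, integral_add i3 i2]
  simp only [e1, e2]
  linarith

theorem continuous_dvg {V : E → E} (hV : ContDiff ℝ ∞ V) : Continuous (dvg V) := by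
  have : Continuous (fderiv ℝ V) := hV.continuous_fderiv (by simp)
  unfold dvg
  fun_prop

/-- A smooth compactly supported field has its divergence as weak divergence. -/
theorem weakDiv_dvg {Ω : Set E} {V : E → E} (hV : ContDiff ℝ ∞ V) (hc : HasCompactSupport V)
    (hs : tsupport V ⊆ Ω) : WeakDiv Ω V (dvg V) := by
  intro ζ hζ
  have hw := hasWeakGradient_of_contDiff (Ω := Ω) hζ.smooth
  have key := hw.integral_mul_dvg hV hc hs
  have hVl : LocallyIntegrableOn V Ω := hV.continuous.locallyIntegrable.locallyIntegrableOn _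
  rw [integral_add (hζ.integrable_inner_gradient hVl).integrableOn
    (hζ.integrable_mul ((continuous_dvg hV).locallyIntegrable.locallyIntegrableOn _)).integrableOn]
  simp only [mul_comm (dvg V _), real_inner_comm _ (V _)] at *
  rw [key]; ring

/-! ### Change of variables -/

/-- `Φ : Ω → Ω'` is a smooth diffeomorphism of open sets with inverse `Ψ`. -/
structure Diffeo (Φ Ψ : E → E) (Ω Ω' : Set E) : Prop where
  isOpen : IsOpen Ω
  isOpen_target : IsOpen Ω'
  smooth : ContDiffOn ℝ ∞ Φ Ω
  smooth_symm : ContDiffOn ℝ ∞ Ψ Ω'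
  mapsTo : Set.MapsTo Φ Ω Ω'
  mapsTo_symm : Set.MapsTo Ψ Ω' Ω
  left_inv : Set.LeftInvOn Ψ Φ Ω
  right_inv : Set.LeftInvOn Φ Ψ Ω'

theorem contDiffAt_clm_det {A : E → E →L[ℝ] E} {x : E} (hA : ContDiffAt ℝ ∞ A x) :
    ContDiffAt ℝ ∞ (fun y => (A y).det) x := by
  let b := (EuclideanSpace.basisFun (Fin 3) ℝ).toBasis
  have h : ∀ L : E →L[ℝ] E, L.det = ∑ σ : Equiv.Perm (Fin 3),
      (Equiv.Perm.sign σ : ℝ) * ∏ i, L (EuclideanSpace.single i 1) (σ i) := by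
    intro L
    have : L.det = (LinearMap.toMatrix b b (L : E →ₗ[ℝ] E)).det := by
      rw [LinearMap.det_toMatrix]
    rw [this, Matrix.det_apply']
    refine Finset.sum_congr rfl fun σ _ => ?_
    simp [b, LinearMap.toMatrix_apply]
  simp_rw [h]
  refine ContDiffAt.sum fun σ _ => contDiffAt_const.mul (contDiffAt_prod fun i _ => ?_)
  exact (EuclideanSpace.proj (𝕜 := ℝ) (σ i)).contDiff.contDiffAt.comp x
    (hA.clm_apply contDiffAt_const)

theorem locallyIntegrableOn_clm_apply {Ω : Set E} (hΩ : IsOpen Ω) {A : E → E →L[ℝ] E} {G : E → E}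
    (hA : ContinuousOn A Ω) (hG : LocallyIntegrableOn G Ω) :
    LocallyIntegrableOn (fun x => A x (G x)) Ω := by
  rw [locallyIntegrableOn_iff hΩ.isLocallyClosed] at hG ⊢
  intro K hK hc
  obtain ⟨C, hC⟩ := hc.exists_bound_of_continuousOn (hA.mono hK)
  have hGK := hG K hK hc
  refine Integrable.mono' (hGK.norm.const_mul C) ?_ ?_
  · exact (ContinuousLinearMap.apply ℝ E).aestronglyMeasurable_comp₂ hGK.aestronglyMeasurable
      ((hA.mono hK).aestronglyMeasurable hc.measurableSet)
  · filter_upwards [ae_restrict_mem hc.measurableSet] with x hx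
    exact ((A x).le_opNorm _).trans (by gcongr; exact hC x hx)

namespace Diffeo

variable {Φ Ψ : E → E} {Ω Ω' : Set E}

theorem symm (D : Diffeo Φ Ψ Ω Ω') : Diffeo Ψ Φ Ω' Ω :=
  ⟨D.isOpen_target, D.isOpen, D.smooth_symm, D.smooth, D.mapsTo_symm, D.mapsTo, D.right_inv,
    D.left_inv⟩

theorem contDiffAt (D : Diffeo Φ Ψ Ω Ω') {x : E} (hx : x ∈ Ω) : ContDiffAt ℝ ∞ Φ x :=
  D.smooth.contDiffAt (D.isOpen.mem_nhds hx)

theorem hasFDerivAt (D : Diffeo Φ Ψ Ω Ω') {x : E} (hx : x ∈ Ω) :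
    HasFDerivAt Φ (fderiv ℝ Φ x) x :=
  ((D.contDiffAt hx).differentiableAt (by simp)).hasFDerivAt

theorem continuousOn_fderiv (D : Diffeo Φ Ψ Ω Ω') : ContinuousOn (fderiv ℝ Φ) Ω :=
  D.smooth.continuousOn_fderiv_of_isOpen D.isOpen (by simp)

theorem injOn (D : Diffeo Φ Ψ Ω Ω') : Set.InjOn Φ Ω := D.left_inv.injOn

theorem image_eq (D : Diffeo Φ Ψ Ω Ω') : Φ '' Ω = Ω' := by
  refine Set.Subset.antisymm D.mapsTo.image_subset fun y hy => ?_
  exact ⟨Ψ y, D.mapsTo_symm hy, D.right_inv hy⟩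

theorem fderiv_comp (D : Diffeo Φ Ψ Ω Ω') {x : E} (hx : x ∈ Ω) :
    (fderiv ℝ Ψ (Φ x)).comp (fderiv ℝ Φ x) = ContinuousLinearMap.id ℝ E := by
  have h1 := (D.symm.hasFDerivAt (D.mapsTo hx)).comp x (D.hasFDerivAt hx)
  have h2 : HasFDerivAt (Ψ ∘ Φ) (ContinuousLinearMap.id ℝ E) x := by
    refine (hasFDerivAt_id x).congr_of_eventuallyEq ?_
    filter_upwards [D.isOpen.mem_nhds hx] with z hz
    exact D.left_inv hz
  exact h1.unique h2

theorem det_mul_det (D : Diffeo Φ Ψ Ω Ω') {x : E} (hx : x ∈ Ω) :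
    |(fderiv ℝ Ψ (Φ x)).det| * |(fderiv ℝ Φ x).det| = 1 := by
  rw [← abs_mul]
  have := congrArg ContinuousLinearMap.det (D.fderiv_comp hx)
  have h2 : ((fderiv ℝ Ψ (Φ x)).comp (fderiv ℝ Φ x)).det =
      (fderiv ℝ Ψ (Φ x)).det * (fderiv ℝ Φ x).det := by
    exact LinearMap.det_comp _ _
  have h3 : (ContinuousLinearMap.id ℝ E).det = 1 := by
    simp [ContinuousLinearMap.det]
  rw [← h2, this, h3, abs_one]

theorem det_ne_zero (D : Diffeo Φ Ψ Ω Ω') {x : E} (hx : x ∈ Ω) : (fderiv ℝ Φ x).det ≠ 0 := by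
  intro h
  have := D.det_mul_det hx
  rw [h] at this
  simp at this

theorem contDiffAt_abs_det (D : Diffeo Φ Ψ Ω Ω') {x : E} (hx : x ∈ Ω) :
    ContDiffAt ℝ ∞ (fun y => |(fderiv ℝ Φ y).det|) x :=
  (contDiffAt_clm_det ((D.contDiffAt hx).fderiv_right (by simp))).abs (D.det_ne_zero hx)

theorem integral_target {F : Type*} [NormedAddCommGroup F] [NormedSpace ℝ F]
    (D : Diffeo Φ Ψ Ω Ω') (g : E → F) :
    ∫ y in Ω', g y = ∫ x in Ω, |(fderiv ℝ Φ x).det| • g (Φ x) := by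
  rw [← D.image_eq]
  exact integral_image_eq_integral_abs_det_fderiv_smul volume D.isOpen.measurableSet
    (fun x hx => (D.hasFDerivAt hx).hasFDerivWithinAt) D.injOn g

theorem integrableOn_target_iff {F : Type*} [NormedAddCommGroup F] [NormedSpace ℝ F]
    (D : Diffeo Φ Ψ Ω Ω') (g : E → F) :
    IntegrableOn g Ω' ↔ IntegrableOn (fun x => |(fderiv ℝ Φ x).det| • g (Φ x)) Ω := by
  rw [← D.image_eq]
  exact integrableOn_image_iff_integrableOn_abs_det_fderiv_smul volume D.isOpen.measurableSet
    (fun x hx => (D.hasFDerivAt hx).hasFDerivWithinAt) D.injOn g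

theorem aemeasurable (D : Diffeo Φ Ψ Ω Ω') : AEMeasurable Φ (volume.restrict Ω) :=
  D.smooth.continuousOn.aemeasurable D.isOpen.measurableSet

/-- The image of Lebesgue measure on a part of `Ω` where the inverse has bounded Jacobian. -/
theorem map_restrict_le (D : Diffeo Φ Ψ Ω Ω') {A : Set E} (hA : MeasurableSet A) (hAΩ : A ⊆ Ω)
    {C : ℝ} (hC : ∀ x ∈ A, |(fderiv ℝ Ψ (Φ x)).det| ≤ C) :
    Measure.map Φ (volume.restrict A) ≤ ENNReal.ofReal C • volume.restrict (Φ '' A) := by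
  have hΦA : MeasurableSet (Φ '' A) := measurable_image_of_fderivWithin hA
    (fun x hx => (D.hasFDerivAt (hAΩ hx)).hasFDerivWithinAt) (D.injOn.mono hAΩ)
  refine Measure.le_iff.2 fun s hs => ?_
  have hm : AEMeasurable Φ (volume.restrict A) := D.aemeasurable.mono_measure
    (Measure.restrict_mono hAΩ le_rfl)
  rw [Measure.map_apply_of_aemeasurable hm hs, Measure.smul_apply, Measure.restrict_apply hs]
  have hsub : s ∩ Φ '' A ⊆ Ω' := by
    rintro _ ⟨_, x, hx, rfl⟩
    exact D.mapsTo (hAΩ hx)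
  have himg : Φ ⁻¹' s ∩ A = Ψ '' (s ∩ Φ '' A) := by
    ext x
    constructor
    · rintro ⟨h1, h2⟩
      exact ⟨Φ x, ⟨h1, x, h2, rfl⟩, D.left_inv (hAΩ h2)⟩
    · rintro ⟨_, ⟨h1, z, hz, rfl⟩, rfl⟩
      rw [D.left_inv (hAΩ hz)]
      exact ⟨h1, hz⟩
  rw [Measure.restrict_apply' hA, himg, ← lintegral_abs_det_fderiv_eq_addHaar_image volume
    (hs.inter hΦA) (fun y hy => (D.symm.hasFDerivAt (hsub hy)).hasFDerivWithinAt)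
    (D.symm.injOn.mono hsub)]
  refine (setLIntegral_mono measurable_const fun y hy => ?_).trans_eq
    (setLIntegral_const (s ∩ Φ '' A) (ENNReal.ofReal C))
  obtain ⟨_, x, hx, rfl⟩ := hy
  exact ENNReal.ofReal_le_ofReal (hC x hx)

theorem map_absolutelyContinuous (D : Diffeo Φ Ψ Ω Ω') :
    Measure.map Φ (volume.restrict Ω) ≪ volume.restrict Ω' := by
  refine Measure.AbsolutelyContinuous.mk fun s hs h0 => ?_
  rw [Measure.map_apply_of_aemeasurable D.aemeasurable hs,
    Measure.restrict_apply' D.isOpen.measurableSet]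
  rw [Measure.restrict_apply hs] at h0
  have himg : Φ ⁻¹' s ∩ Ω ⊆ Ψ '' (s ∩ Ω') := fun x hx =>
    ⟨Φ x, ⟨hx.1, D.mapsTo hx.2⟩, D.left_inv hx.2⟩
  refine measure_mono_null himg
    (addHaar_image_eq_zero_of_differentiableOn_of_addHaar_eq_zero volume (fun y hy => ?_) h0)
  exact (D.symm.hasFDerivAt hy.2).differentiableAt.differentiableWithinAt

theorem ae_comp (D : Diffeo Φ Ψ Ω Ω') {p : E → Prop} (h : ∀ᵐ y ∂volume.restrict Ω', p y) :
    ∀ᵐ x ∂volume.restrict Ω, p (Φ x) :=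
  ae_of_ae_map D.aemeasurable (D.map_absolutelyContinuous.ae_le h)

theorem aestronglyMeasurable_comp {F : Type*} [TopologicalSpace F] (D : Diffeo Φ Ψ Ω Ω')
    {g : E → F} (hg : AEStronglyMeasurable g (volume.restrict Ω')) :
    AEStronglyMeasurable (fun x => g (Φ x)) (volume.restrict Ω) :=
  (hg.mono_ac D.map_absolutelyContinuous).comp_aemeasurable D.aemeasurable

theorem memLp_comp {F : Type*} [NormedAddCommGroup F] (D : Diffeo Φ Ψ Ω Ω') {A : Set E}
    (hA : MeasurableSet A) (hAΩ : A ⊆ Ω) {C : ℝ} (hC : ∀ x ∈ A, |(fderiv ℝ Ψ (Φ x)).det| ≤ C)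
    {g : E → F} {p : ℝ≥0∞} (hg : MemLp g p (volume.restrict (Φ '' A))) :
    MemLp (fun x => g (Φ x)) p (volume.restrict A) :=
  (hg.of_measure_le_smul ENNReal.ofReal_ne_top (D.map_restrict_le hA hAΩ hC)).comp_of_map
    (D.aemeasurable.mono_measure (Measure.restrict_mono hAΩ le_rfl))

theorem eLpNorm_comp_le {F : Type*} [NormedAddCommGroup F] (D : Diffeo Φ Ψ Ω Ω') {A : Set E}
    (hA : MeasurableSet A) (hAΩ : A ⊆ Ω) {C : ℝ} (hC : ∀ x ∈ A, |(fderiv ℝ Ψ (Φ x)).det| ≤ C)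
    {g : E → F} (hg : AEStronglyMeasurable g (volume.restrict (Φ '' A))) :
    eLpNorm (fun x => g (Φ x)) 2 (volume.restrict A) ≤
      ENNReal.ofReal C ^ (1 / 2 : ℝ) * eLpNorm g 2 (volume.restrict (Φ '' A)) := by
  have hle := D.map_restrict_le hA hAΩ hC
  have hm := D.aemeasurable.mono_measure (Measure.restrict_mono hAΩ (le_refl (volume : Measure E)))
  have h1 := eLpNorm_map_measure (p := 2)
    (hg.mono_ac (Measure.absolutelyContinuous_of_le_smul hle)) hm
  have h2 : eLpNorm (fun x => g (Φ x)) 2 (volume.restrict A) =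
    eLpNorm g 2 (Measure.map Φ (volume.restrict A)) := h1.symm
  rw [h2]
  refine (eLpNorm_mono_measure g hle).trans ?_
  rw [eLpNorm_smul_measure_of_ne_top (by norm_num), smul_eq_mul]
  simp

theorem locallyIntegrableOn_comp {F : Type*} [NormedAddCommGroup F] (D : Diffeo Φ Ψ Ω Ω')
    {g : E → F} (hg : LocallyIntegrableOn g Ω') :
    LocallyIntegrableOn (fun x => g (Φ x)) Ω := by
  rw [locallyIntegrableOn_iff D.isOpen.isLocallyClosed]
  intro K hK hc
  have hcont : ContinuousOn (fun x => |(fderiv ℝ Ψ (Φ x)).det|) K := by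
    have h1 : ContinuousOn (fun y => |(fderiv ℝ Ψ y).det|) Ω' := fun y hy =>
      (D.symm.contDiffAt_abs_det hy).continuousAt.continuousWithinAt
    exact h1.comp (D.smooth.continuousOn.mono hK) fun x hx => D.mapsTo (hK hx)
  obtain ⟨C, hC⟩ := hc.exists_bound_of_continuousOn hcont
  have h2 := hg.integrableOn_compact_subset (D.mapsTo.mono_left hK).image_subset
    (hc.image_of_continuousOn (D.smooth.continuousOn.mono hK))
  exact memLp_one_iff_integrable.1 (D.memLp_comp hc.measurableSet hK
    (fun x hx => by simpa using hC x hx) (memLp_one_iff_integrable.2 h2))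

theorem memLp_two_comp_of_isCompact {F : Type*} [NormedAddCommGroup F] (D : Diffeo Φ Ψ Ω Ω')
    {g : E → F} {K : Set E} (hK : K ⊆ Ω) (hc : IsCompact K)
    (hg : MemLp g 2 (volume.restrict Ω')) :
    MemLp (fun x => g (Φ x)) 2 (volume.restrict K) := by
  have hcont : ContinuousOn (fun x => |(fderiv ℝ Ψ (Φ x)).det|) K := by
    have h1 : ContinuousOn (fun y => |(fderiv ℝ Ψ y).det|) Ω' := fun y hy =>
      (D.symm.contDiffAt_abs_det hy).continuousAt.continuousWithinAt
    exact h1.comp (D.smooth.continuousOn.mono hK) fun x hx => D.mapsTo (hK hx)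
  obtain ⟨C, hC⟩ := hc.exists_bound_of_continuousOn hcont
  exact D.memLp_comp hc.measurableSet hK (fun x hx => by simpa using hC x hx)
    (hg.mono_measure (Measure.restrict_mono (D.mapsTo.mono_left hK).image_subset le_rfl))

theorem fderiv_comp_apply (D : Diffeo Φ Ψ Ω Ω') {ψ : E → ℝ} {x : E} (hx : x ∈ Ω)
    (hψ : DifferentiableAt ℝ ψ (Φ x)) (v : E) :
    fderiv ℝ (fun z => ψ (Φ z)) x v = fderiv ℝ ψ (Φ x) (fderiv ℝ Φ x v) := by
  have := (hψ.hasFDerivAt.comp x (D.hasFDerivAt hx)).fderiv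
  change fderiv ℝ (ψ ∘ Φ) x v = _
  rw [this]; rfl

/-- The chain rule for gradients. -/
theorem gradient_comp (D : Diffeo Φ Ψ Ω Ω') {ψ : E → ℝ} {x : E} (hx : x ∈ Ω)
    (hψ : DifferentiableAt ℝ ψ (Φ x)) :
    gradient (fun z => ψ (Φ z)) x = (fderiv ℝ Φ x).adjoint (gradient ψ (Φ x)) := by
  refine ext_inner_left ℝ fun v => ?_
  rw [inner_gradient, D.fderiv_comp_apply hx hψ, ContinuousLinearMap.adjoint_inner_right,
    inner_gradient]

end Diffeo

/-- A function smooth on an open set and vanishing off a closed subset of it is smooth. -/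
theorem contDiff_of_contDiffOn_of_eq_zero {F : Type*} [NormedAddCommGroup F] [NormedSpace ℝ F]
    {Ω K : Set E} (hΩ : IsOpen Ω) (hK : IsClosed K) (hKΩ : K ⊆ Ω) {f : E → F}
    (hf : ContDiffOn ℝ ∞ f Ω) (h0 : ∀ x ∉ K, f x = 0) : ContDiff ℝ ∞ f := by
  rw [contDiff_iff_contDiffAt]
  intro x
  by_cases hx : x ∈ K
  · exact hf.contDiffAt (hΩ.mem_nhds (hKΩ hx))
  · refine (contDiffAt_const (c := (0 : F))).congr_of_eventuallyEq ?_
    filter_upwards [hK.isOpen_compl.mem_nhds hx] with z hz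
    exact h0 z hz

namespace Diffeo

variable {Φ Ψ : E → E} {Ω Ω' : Set E}

/-- The pull-back of a test function, extended by zero. -/
theorem isTest_indicator_comp (D : Diffeo Φ Ψ Ω Ω') {φ : E → ℝ} (hφ : IsTest Ω' φ) :
    IsTest Ω (Ω.indicator fun x => φ (Φ x)) := by
  set K := Ψ '' tsupport φ
  have hKc : IsCompact K := hφ.compact.isCompact.image_of_continuousOn
    (D.smooth_symm.continuousOn.mono hφ.subset)
  have hKΩ : K ⊆ Ω := (D.mapsTo_symm.mono_left hφ.subset).image_subset
  have h0 : ∀ x ∉ K, Ω.indicator (fun x => φ (Φ x)) x = 0 := by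
    intro x hx
    by_cases hxΩ : x ∈ Ω
    · rw [Set.indicator_of_mem hxΩ]
      refine image_eq_zero_of_notMem_tsupport fun h => hx ⟨Φ x, h, D.left_inv hxΩ⟩
    · exact Set.indicator_of_notMem hxΩ _
  have hts : tsupport (Ω.indicator fun x => φ (Φ x)) ⊆ K :=
    closure_minimal (fun x hx => by_contra fun h => hx (h0 x h)) hKc.isClosed
  refine ⟨contDiff_of_contDiffOn_of_eq_zero D.isOpen hKc.isClosed hKΩ ?_ h0,
    hKc.of_isClosed_subset (isClosed_tsupport _) hts, hts.trans hKΩ⟩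
  exact (hφ.smooth.comp_contDiffOn D.smooth).congr fun x hx => Set.indicator_of_mem hx _

/-- Weak divergences push forward as densities: no regularity is needed, the chain rule is applied
to the test function only. -/
theorem weakDiv_pushforward (D : Diffeo Φ Ψ Ω Ω') {B : E → E} {a : E → ℝ} (h : WeakDiv Ω B a) :
    WeakDiv Ω' (fun y => |(fderiv ℝ Ψ y).det| • fderiv ℝ Φ (Ψ y) (B (Ψ y)))
      (fun y => |(fderiv ℝ Ψ y).det| * a (Ψ y)) := by
  intro φ hφ
  rw [← h _ (D.isTest_indicator_comp hφ), D.symm.integral_target]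
  refine setIntegral_congr_fun D.isOpen_target.measurableSet fun y hy => ?_
  have hx := D.mapsTo_symm hy
  have e : gradient (Ω.indicator fun x => φ (Φ x)) (Ψ y) = gradient (fun x => φ (Φ x)) (Ψ y) :=
    gradient_congr_of_isOpen D.isOpen (fun z hz => Set.indicator_of_mem hz _) hx
  simp only [smul_eq_mul]
  rw [e, inner_gradient, inner_gradient, D.fderiv_comp_apply hx (hφ.differentiable _),
    Set.indicator_of_mem hx, D.right_inv hy]
  simp only [map_smul, smul_eq_mul]
  ring

/-- The Piola identity: the push-forward as a density of a smooth test field, extended by zero, is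
a smooth test field, and its divergence is the push-forward of the divergence. -/
theorem exists_piola (D : Diffeo Φ Ψ Ω Ω') {V : E → E} (hV : ContDiff ℝ ∞ V)
    (hc : HasCompactSupport V) (hs : tsupport V ⊆ Ω) :
    ∃ V' : E → E, ContDiff ℝ ∞ V' ∧ HasCompactSupport V' ∧ tsupport V' ⊆ Ω' ∧
      (∀ y ∈ Ω', V' y = |(fderiv ℝ Ψ y).det| • fderiv ℝ Φ (Ψ y) (V (Ψ y))) ∧
      ∀ᵐ y ∂volume.restrict Ω', dvg V' y = |(fderiv ℝ Ψ y).det| * dvg V (Ψ y) := by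
  -- the classical divergence of the push-forward and the push-forward of the divergence are both weak
  -- divergences of the same field, so no derivative of a determinant has to be computed
  set W : E → E := fun y => |(fderiv ℝ Ψ y).det| • fderiv ℝ Φ (Ψ y) (V (Ψ y)) with hW
  set K := Φ '' tsupport V
  have hKc : IsCompact K := hc.isCompact.image_of_continuousOn (D.smooth.continuousOn.mono hs)
  have hKΩ : K ⊆ Ω' := (D.mapsTo.mono_left hs).image_subset
  have h0 : ∀ y ∉ K, Ω'.indicator W y = 0 := by
    intro y hy
    by_cases hyΩ : y ∈ Ω'
    · have : V (Ψ y) = 0 :=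
        image_eq_zero_of_notMem_tsupport fun h => hy ⟨Ψ y, h, D.right_inv hyΩ⟩
      rw [Set.indicator_of_mem hyΩ, hW]
      simp [this]
    · exact Set.indicator_of_notMem hyΩ _
  have hts : tsupport (Ω'.indicator W) ⊆ K :=
    closure_minimal (fun x hx => by_contra fun h => hx (h0 x h)) hKc.isClosed
  have hWs : ContDiffOn ℝ ∞ W Ω' := by
    intro y hy
    have h1 := D.symm.contDiffAt_abs_det hy
    have h2 : ContDiffAt ℝ ∞ (fun y => fderiv ℝ Φ (Ψ y)) y := by
      have : ContDiffAt ℝ ∞ (fderiv ℝ Φ) (Ψ y) :=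
        (D.contDiffAt (D.mapsTo_symm hy)).fderiv_right (by simp)
      exact this.comp y (D.symm.contDiffAt hy)
    have h3 : ContDiffAt ℝ ∞ (fun y => V (Ψ y)) y :=
      hV.contDiffAt.comp y (D.symm.contDiffAt hy)
    exact (h1.smul (h2.clm_apply h3)).contDiffWithinAt
  have hsm : ContDiff ℝ ∞ (Ω'.indicator W) :=
    contDiff_of_contDiffOn_of_eq_zero D.isOpen_target hKc.isClosed hKΩ
      (hWs.congr fun x hx => Set.indicator_of_mem hx _) h0
  have hcs : HasCompactSupport (Ω'.indicator W) :=
    hKc.of_isClosed_subset (isClosed_tsupport _) hts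
  refine ⟨Ω'.indicator W, hsm, hcs, hts.trans hKΩ, fun y hy => Set.indicator_of_mem hy _, ?_⟩
  have d1 := weakDiv_dvg hsm hcs (hts.trans hKΩ)
  have d2 : WeakDiv Ω' (Ω'.indicator W) (fun y => |(fderiv ℝ Ψ y).det| * dvg V (Ψ y)) := by
    refine (D.weakDiv_pushforward (weakDiv_dvg hV hc hs)).congr_ae ?_ (ae_of_all _ fun _ => rfl)
    filter_upwards [ae_restrict_mem D.isOpen_target.measurableSet] with y hy
    rw [Set.indicator_of_mem hy]
  refine WeakDiv.ae_eq D.isOpen_target (hsm.continuous.locallyIntegrable.locallyIntegrableOn _)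
    ((continuous_dvg hsm).locallyIntegrable.locallyIntegrableOn _) ?_ d1 d2
  refine ContinuousOn.locallyIntegrableOn (fun y hy => ?_) D.isOpen_target.measurableSet
  exact ((D.symm.contDiffAt_abs_det hy).continuousAt.mul ((continuous_dvg hV).continuousAt.comp
    (D.symm.contDiffAt hy).continuousAt)).continuousWithinAt

/-- The chain rule for weak gradients. -/
theorem hasWeakGradient_comp (D : Diffeo Φ Ψ Ω Ω') {u : E → ℝ} {G : E → E}
    (h : HasWeakGradient Ω' u G) :
    HasWeakGradient Ω (fun x => u (Φ x)) (fun x => (fderiv ℝ Φ x).adjoint (G (Φ x))) := by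
  have hu := D.locallyIntegrableOn_comp h.1
  have hG := locallyIntegrableOn_clm_apply D.isOpen (A := fun x => (fderiv ℝ Φ x).adjoint)
    (ContinuousLinearMap.adjoint.continuous.comp_continuousOn D.continuousOn_fderiv)
    (D.locallyIntegrableOn_comp h.2.1)
  rw [hasWeakGradient_iff hu hG]
  intro e φ hφ
  -- test the weak gradient of `u` with the Piola transform of the field `φ e`
  set V : E → E := fun x => φ x • e with hV
  have hVs : ContDiff ℝ ∞ V := hφ.smooth.smul contDiff_const
  have hsub : tsupport V ⊆ tsupport φ := by
    refine closure_mono fun x hx hx0 => hx ?_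
    simp [hV, hx0]
  have hVc : HasCompactSupport V := hφ.compact.of_isClosed_subset (isClosed_tsupport _) hsub
  have hdV : ∀ x, dvg V x = fderiv ℝ φ x e := by
    intro x
    have h1 : fderiv ℝ V x = (fderiv ℝ φ x).smulRight e :=
      ((hφ.differentiable x).hasFDerivAt.smul_const e).fderiv
    have h2 : e = ∑ i, e i • EuclideanSpace.single i (1 : ℝ) := by
      ext j; simp [Finset.sum_apply, Pi.single_apply]
    conv_rhs => rw [h2, map_sum]
    simp [dvg, h1, mul_comm]
  obtain ⟨V', hV's, hV'c, hV'sub, hV', hdV'⟩ := D.exists_piola hVs hVc (hsub.trans hφ.subset)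
  have key := h.integral_mul_dvg hV's hV'c hV'sub
  have e1 : ∫ y in Ω', u y * dvg V' y = ∫ x in Ω, inner ℝ (u (Φ x) • e) (gradient φ x) := by
    rw [D.symm.integral_target]
    apply integral_congr_ae
    filter_upwards [hdV', ae_restrict_mem D.isOpen_target.measurableSet] with y hy hyΩ
    rw [hy, D.right_inv hyΩ, hdV, real_inner_smul_left, inner_gradient, smul_eq_mul]
    ring
  have e2 : ∫ y in Ω', inner ℝ (G y) (V' y) =
      ∫ x in Ω, inner ℝ ((fderiv ℝ Φ x).adjoint (G (Φ x))) e * φ x := by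
    rw [D.symm.integral_target]
    refine setIntegral_congr_fun D.isOpen_target.measurableSet fun y hyΩ => ?_
    simp only [hV' y hyΩ, D.right_inv hyΩ, hV, smul_eq_mul, map_smul, real_inner_smul_right,
      ContinuousLinearMap.adjoint_inner_left]
    ring
  rw [integral_add (hφ.integrable_inner_gradient (locallyIntegrableOn_smul_const hu e)).integrableOn
    (hφ.integrable_mul (locallyIntegrableOn_inner_const hG e)).integrableOn, ← e1, ← e2, key]
  ring

end Diffeo

/-! ### Removing the origin and the boundary -/

theorem volume_restrict_punctured : volume.restrict (M₁ \ {0}) = volume.restrict M₁ :=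
  Measure.restrict_congr_set (sdiff_null_ae_eq_self (measure_singleton _))

theorem isOpen_punctured : IsOpen (M₁ \ {0}) := Metric.isOpen_ball.sdiff isClosed_singleton

theorem mem_punctured {x : E} : x ∈ M₁ \ {0} ↔ ‖x‖ < 2 ∧ 0 < ‖x‖ := by
  simp [M₁]

/-- This is where the dimension enters: in polar coordinates the square of `1/|x|` is `r⁻²` against
`r² dr`. -/
theorem memLp_inv_norm : MemLp (fun x : E => ‖x‖⁻¹) 2 (volume.restrict M₁) := by
  rw [memLp_two_iff_integrable_sq (by fun_prop)]
  refine (integrableOn_fun_norm_addHaar (F := ℝ) volume (f := fun r : ℝ => (r⁻¹) ^ 2)).2 ?_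
  have h : IntegrableOn (fun _ : ℝ => (1 : ℝ)) (Set.Ioo 0 2) := by
    rw [integrableOn_const_iff]; right; simp
  refine h.congr_fun (fun y hy => ?_) measurableSet_Ioo
  have : y ≠ 0 := hy.1.ne'
  simp
  field_simp

/-- The derivative of the smooth step is supported in `[0, 1]`, so it may be multiplied by any linear
function; the weight `t + 1` is the one that occurs for `shellCutoff`. -/
theorem exists_bound_deriv_smoothTransition :
    ∃ S : ℝ, 0 ≤ S ∧ ∀ t, |deriv Real.smoothTransition t| * |t + 1| ≤ S := by
  have hc : Continuous (deriv Real.smoothTransition) :=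
    (Real.smoothTransition.contDiff (n := 1)).continuous_deriv (by simp)
  obtain ⟨S, hS⟩ := isCompact_Icc.exists_bound_of_continuousOn (s := Set.Icc (0 : ℝ) 1)
    (f := fun t => |deriv Real.smoothTransition t| * |t + 1|) (by fun_prop)
  have h0 : 0 ≤ S := (norm_nonneg _).trans (hS 0 (by simp))
  refine ⟨S, h0, fun t => ?_⟩
  by_cases ht : t ∈ Set.Icc (0 : ℝ) 1
  · exact (le_abs_self _).trans (hS t ht)
  · have : deriv Real.smoothTransition t = 0 := by
      rw [Set.mem_Icc, not_and_or, not_le, not_le] at ht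
      rcases ht with ht | ht
      · have : Real.smoothTransition =ᶠ[𝓝 t] fun _ => 0 := by
          filter_upwards [Iio_mem_nhds ht] with z hz
          exact Real.smoothTransition.zero_of_nonpos (le_of_lt hz)
        rw [this.deriv_eq, deriv_const]
      · have : Real.smoothTransition =ᶠ[𝓝 t] fun _ => 1 := by
          filter_upwards [Ioi_mem_nhds ht] with z hz
          exact Real.smoothTransition.one_of_one_le (le_of_lt hz)
        rw [this.deriv_eq, deriv_const]
    rw [this, abs_zero, zero_mul]
    exact h0

/-- A smooth step in the variable `α ‖x‖² + β`. -/
noncomputable def radialStep (α β : ℝ) (x : E) : ℝ := Real.smoothTransition (α * ‖x‖ ^ 2 + β)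

theorem contDiff_radialStep (α β : ℝ) : ContDiff ℝ ∞ (radialStep α β) :=
  Real.smoothTransition.contDiff.comp ((contDiff_const.mul (contDiff_norm_sq ℝ)).add contDiff_const)

theorem abs_radialStep_le (α β : ℝ) (x : E) : |radialStep α β x| ≤ 1 := by
  rw [radialStep, abs_of_nonneg (Real.smoothTransition.nonneg _)]
  exact Real.smoothTransition.le_one _

theorem norm_fderiv_radialStep_le (α β : ℝ) (x : E) :
    ‖fderiv ℝ (radialStep α β) x‖ ≤
      |deriv Real.smoothTransition (α * ‖x‖ ^ 2 + β)| * (2 * |α| * ‖x‖) := by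
  have h1 : HasFDerivAt (fun x : E => α * ‖x‖ ^ 2 + β) (α • ((2 : ℝ) • innerSL ℝ x)) x :=
    by
    simpa [ofNat_smul_eq_nsmul] using
      (((hasStrictFDerivAt_norm_sq x).hasFDerivAt).const_mul α).add_const β
  have hd : DifferentiableAt ℝ Real.smoothTransition (α * ‖x‖ ^ 2 + β) :=
    (Real.smoothTransition.contDiff (n := 1)).differentiable (by simp) _
  have h2 := (hd.hasDerivAt.comp_hasFDerivAt x h1).fderiv
  have h3 : Real.smoothTransition ∘ (fun x : E => α * ‖x‖ ^ 2 + β) = radialStep α β := rfl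
  rw [← h3, h2, norm_smul, norm_smul, norm_smul, innerSL_apply_norm, Real.norm_eq_abs,
    Real.norm_eq_abs, Real.norm_ofNat]
  exact le_of_eq (by ring)

/-- The cut-off equal to `0` near the origin and near `∂B(0,2)`, and tending to `1` pointwise. -/
noncomputable def shellCutoff (n : ℕ) (x : E) : ℝ :=
  radialStep ((n : ℝ) ^ 2) (-1) x * radialStep (-(n : ℝ)) (4 * n - 1) x

theorem contDiff_shellCutoff (n : ℕ) : ContDiff ℝ ∞ (shellCutoff n) :=
  (contDiff_radialStep _ _).mul (contDiff_radialStep _ _)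

theorem abs_shellCutoff_le (n : ℕ) (x : E) : |shellCutoff n x| ≤ 1 := by
  rw [shellCutoff, abs_mul]
  exact mul_le_one₀ (abs_radialStep_le _ _ _) (abs_nonneg _) (abs_radialStep_le _ _ _)

theorem shellCutoff_eq_zero {n : ℕ} {x : E}
    (h : (n : ℝ) ^ 2 * ‖x‖ ^ 2 ≤ 1 ∨ n * (4 - ‖x‖ ^ 2) ≤ 1) : shellCutoff n x = 0 := by
  rcases h with h | h
  · rw [shellCutoff, radialStep, Real.smoothTransition.zero_of_nonpos (by linarith), zero_mul]
  · rw [shellCutoff, mul_comm, radialStep, Real.smoothTransition.zero_of_nonpos (by linarith),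
      zero_mul]

theorem eventually_shellCutoff_eventuallyEq_one {x : E} (hx : x ∈ M₁ \ {0}) :
    ∀ᶠ n : ℕ in atTop, shellCutoff n =ᶠ[𝓝 x] fun _ => 1 := by
  rw [mem_punctured] at hx
  have h1 : 0 < ‖x‖ ^ 2 := by have := hx.2; positivity
  have h2 : 0 < 4 - ‖x‖ ^ 2 := by nlinarith
  have t1 : Tendsto (fun n : ℕ => (n : ℝ)) atTop atTop := tendsto_natCast_atTop_atTop
  filter_upwards [t1.eventually_ge_atTop 1, (t1.atTop_mul_const h1).eventually_gt_atTop 2,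
    (t1.atTop_mul_const h2).eventually_gt_atTop 2] with n hn e1 e2
  have c1 : ∀ᶠ z : E in 𝓝 x, 2 < (n : ℝ) * ‖z‖ ^ 2 :=
    (continuous_const.mul (continuous_norm.pow 2)).continuousAt.eventually_const_lt e1
  have c2 : ∀ᶠ z : E in 𝓝 x, 2 < (n : ℝ) * (4 - ‖z‖ ^ 2) :=
    (continuous_const.mul (continuous_const.sub (continuous_norm.pow 2))).continuousAt.eventually_const_lt
      e2
  filter_upwards [c1, c2] with z z1 z2
  rw [shellCutoff, radialStep, radialStep, Real.smoothTransition.one_of_one_le,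
    Real.smoothTransition.one_of_one_le, mul_one]
  · linarith
  · nlinarith

/-- The scaling that makes the cut-offs work, with a constant independent of `n`: the gradient is
`O(1/|x|)` near the origin, and `O(1/(2 - |x|))` near `∂B(0,2)`, where the factor `2 - |x|` is provided
by the vanishing of the test function. -/
theorem norm_fderiv_shellCutoff_le {S : ℝ}
    (hS : ∀ t, |deriv Real.smoothTransition t| * |t + 1| ≤ S) (n : ℕ) {x : E}
    (hx : x ∈ M₁ \ {0}) : (2 - ‖x‖) * ‖fderiv ℝ (shellCutoff n) x‖ ≤ 8 * S * ‖x‖⁻¹ := by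
  rw [mem_punctured] at hx
  obtain ⟨hx2, hx0⟩ := hx
  set r := ‖x‖ with hr
  set p := radialStep ((n : ℝ) ^ 2) (-1)
  set q := radialStep (-(n : ℝ)) (4 * n - 1)
  have hS0 : 0 ≤ S := le_trans (by positivity) (hS 0)
  have hp := norm_fderiv_radialStep_le ((n : ℝ) ^ 2) (-1) x
  have hq := norm_fderiv_radialStep_le (-(n : ℝ)) (4 * n - 1) x
  rw [← hr] at hp hq
  have e1 := hS ((n : ℝ) ^ 2 * r ^ 2 + -1)
  have e2 := hS (-(n : ℝ) * r ^ 2 + (4 * n - 1))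
  set d1 := |deriv Real.smoothTransition ((n : ℝ) ^ 2 * r ^ 2 + -1)|
  set d2 := |deriv Real.smoothTransition (-(n : ℝ) * r ^ 2 + (4 * n - 1))|
  have hd2 : 0 ≤ d2 := abs_nonneg _
  have h4 : 0 ≤ 4 - r ^ 2 := by nlinarith
  -- with `t` the argument of either step, `t + 1` is the factor that the chain rule produces
  rw [show (n : ℝ) ^ 2 * r ^ 2 + -1 + 1 = (n : ℝ) ^ 2 * r ^ 2 by ring,
    abs_of_nonneg (by positivity)] at e1
  rw [show -(n : ℝ) * r ^ 2 + (4 * n - 1) + 1 = n * (4 - r ^ 2) by ring,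
    abs_of_nonneg (by positivity)] at e2
  rw [abs_of_nonneg (by positivity)] at hp
  rw [abs_neg, abs_of_nonneg (by positivity)] at hq
  have hprod : ‖fderiv ℝ (shellCutoff n) x‖ ≤ ‖fderiv ℝ p x‖ + ‖fderiv ℝ q x‖ := by
    have dp : DifferentiableAt ℝ p x := (contDiff_radialStep _ _).differentiable (by simp) x
    have dq : DifferentiableAt ℝ q x := (contDiff_radialStep _ _).differentiable (by simp) x
    have : fderiv ℝ (shellCutoff n) x = p x • fderiv ℝ q x + q x • fderiv ℝ p x :=
      (dp.hasFDerivAt.mul dq.hasFDerivAt).fderiv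
    rw [this]
    refine (norm_add_le _ _).trans ?_
    rw [norm_smul, norm_smul, Real.norm_eq_abs, Real.norm_eq_abs, add_comm]
    have b1 := abs_radialStep_le ((n : ℝ) ^ 2) (-1) x
    have b2 := abs_radialStep_le (-(n : ℝ)) (4 * n - 1) x
    exact add_le_add (mul_le_of_le_one_left (norm_nonneg _) b2)
      (mul_le_of_le_one_left (norm_nonneg _) b1)
  have k1 : (2 - r) * ‖fderiv ℝ p x‖ ≤ 4 * S * r⁻¹ := by
    rw [← div_eq_mul_inv, le_div_iff₀ hx0]
    calc (2 - r) * ‖fderiv ℝ p x‖ * r ≤ 2 * ‖fderiv ℝ p x‖ * r := by gcongr; linarith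
      _ ≤ 2 * (d1 * (2 * (n : ℝ) ^ 2 * r)) * r := by gcongr
      _ = 4 * (d1 * ((n : ℝ) ^ 2 * r ^ 2)) := by ring
      _ ≤ 4 * S := by gcongr
  have k2 : (2 - r) * ‖fderiv ℝ q x‖ ≤ 4 * S * r⁻¹ := by
    rw [← div_eq_mul_inv, le_div_iff₀ hx0]
    calc (2 - r) * ‖fderiv ℝ q x‖ * r ≤ (2 - r) * (d2 * (2 * n * r)) * r := by
          gcongr
      _ = (2 * (2 - r)) * (d2 * n * r ^ 2) := by ring
      _ ≤ (4 - r ^ 2) * (d2 * n * r ^ 2) := by gcongr; nlinarith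
      _ = d2 * (n * (4 - r ^ 2)) * r ^ 2 := by ring
      _ ≤ S * 2 ^ 2 := by gcongr
      _ = 4 * S := by ring
  calc (2 - r) * ‖fderiv ℝ (shellCutoff n) x‖
      ≤ (2 - r) * (‖fderiv ℝ p x‖ + ‖fderiv ℝ q x‖) := by gcongr
    _ ≤ 8 * S * r⁻¹ := by rw [mul_add]; linarith

/-- The functions against which a weak divergence with square integrable data on `M₁ \ {0}` may be
tested: smooth off the origin, with gradient `O(1/|x|)`, and vanishing at `∂M₁`. -/
structure IsSingularTest (C : ℝ) (φ : E → ℝ) : Prop where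
  smooth : ContDiffOn ℝ ∞ φ (M₁ \ {0})
  bound : ∀ x ∈ M₁ \ {0}, |φ x| ≤ C * (2 - ‖x‖)
  bound_fderiv : ∀ x ∈ M₁ \ {0}, ‖fderiv ℝ φ x‖ ≤ C * ‖x‖⁻¹

theorem integrable_mul_norm_inv {F : Type*} [NormedAddCommGroup F] {B : E → F}
    (hB : MemLp B 2 (volume.restrict M₁)) :
    Integrable (fun x => ‖B x‖ * ‖x‖⁻¹) (volume.restrict M₁) :=
  hB.norm.integrable_mul memLp_inv_norm

theorem continuousOn_gradient_punctured {φ : E → ℝ} (hφ : ContDiffOn ℝ ∞ φ (M₁ \ {0})) :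
    ContinuousOn (gradient φ) (M₁ \ {0}) :=
  (InnerProductSpace.toDual ℝ E).symm.continuous.comp_continuousOn
    (hφ.continuousOn_fderiv_of_isOpen isOpen_punctured (by simp))

theorem aestronglyMeasurable_gradient {φ : E → ℝ} (hφ : ContDiffOn ℝ ∞ φ (M₁ \ {0})) :
    AEStronglyMeasurable (gradient φ) (volume.restrict M₁) := by
  rw [← volume_restrict_punctured]
  exact (continuousOn_gradient_punctured hφ).aestronglyMeasurable isOpen_punctured.measurableSet

theorem ae_mem_punctured : ∀ᵐ x ∂volume.restrict M₁, x ∈ M₁ \ {0} := by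
  rw [← volume_restrict_punctured]
  exact ae_restrict_mem isOpen_punctured.measurableSet

theorem IsSingularTest.integrable_inner {C : ℝ} {φ : E → ℝ} (hφ : IsSingularTest C φ) {B : E → E}
    (hB : MemLp B 2 (volume.restrict M₁)) :
    Integrable (fun x => inner ℝ (B x) (gradient φ x)) (volume.restrict M₁) := by
  refine ((integrable_mul_norm_inv hB).const_mul C).mono'
    (hB.1.inner (aestronglyMeasurable_gradient hφ.smooth)) ?_
  filter_upwards [ae_mem_punctured] with x hx
  refine (norm_inner_le_norm _ _).trans ?_
  rw [norm_gradient]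
  calc ‖B x‖ * ‖fderiv ℝ φ x‖ ≤ ‖B x‖ * (C * ‖x‖⁻¹) := by gcongr; exact hφ.bound_fderiv x hx
    _ = C * (‖B x‖ * ‖x‖⁻¹) := by ring

theorem IsSingularTest.nonneg {C : ℝ} {φ : E → ℝ} (hφ : IsSingularTest C φ) : 0 ≤ C := by
  have hx : EuclideanSpace.single 0 (1 : ℝ) ∈ M₁ \ {0} := by
    rw [mem_punctured]; simp
  have := (norm_nonneg _).trans (hφ.bound_fderiv _ hx)
  simpa using this

theorem integrable_of_memLp_two {a : E → ℝ} (ha : MemLp a 2 (volume.restrict M₁)) :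
    Integrable a (volume.restrict M₁) := by
  have : IsFiniteMeasure (volume.restrict M₁) := ⟨by
    rw [Measure.restrict_apply_univ]; exact measure_ball_lt_top⟩
  exact ha.integrable one_le_two

theorem IsSingularTest.integrable_mul {C : ℝ} {φ : E → ℝ} (hφ : IsSingularTest C φ) {a : E → ℝ}
    (ha : MemLp a 2 (volume.restrict M₁)) :
    Integrable (fun x => a x * φ x) (volume.restrict M₁) := by
  have hm : AEStronglyMeasurable φ (volume.restrict M₁) := by
    rw [← volume_restrict_punctured]
    exact hφ.smooth.continuousOn.aestronglyMeasurable isOpen_punctured.measurableSet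
  refine ((integrable_of_memLp_two ha).norm.mul_const (2 * C)).mono' (ha.1.mul hm) ?_
  filter_upwards [ae_mem_punctured] with x hx
  rw [norm_mul]
  gcongr
  refine (hφ.bound x hx).trans ?_
  have := norm_nonneg x
  nlinarith [hφ.nonneg]

theorem isTest_shellCutoff_mul {φ : E → ℝ} (hφ : ContDiffOn ℝ ∞ φ (M₁ \ {0})) {n : ℕ}
    (hn : 1 ≤ n) : IsTest (M₁ \ {0}) (fun x => shellCutoff n x * φ x) := by
  have hn' : (1 : ℝ) ≤ n := by exact_mod_cast hn
  set K : Set E := {x | 1 ≤ (n : ℝ) ^ 2 * ‖x‖ ^ 2} ∩ {x | 1 ≤ n * (4 - ‖x‖ ^ 2)} with hK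
  have hKcl : IsClosed K := (isClosed_le continuous_const (by fun_prop)).inter
    (isClosed_le continuous_const (by fun_prop))
  have hKs : K ⊆ M₁ \ {0} := by
    rintro x ⟨h1, h2⟩
    simp only [Set.mem_ofPred_eq] at h1 h2
    rw [mem_punctured]
    have h0 := norm_nonneg x
    constructor
    · by_contra! h
      have h4 : 4 - ‖x‖ ^ 2 ≤ 0 := by nlinarith
      have := mul_nonpos_of_nonneg_of_nonpos (Nat.cast_nonneg n) h4
      linarith
    · refine lt_of_le_of_ne h0 fun h => ?_
      rw [← h] at h1; norm_num at h1
  have h0 : ∀ x ∉ K, shellCutoff n x * φ x = 0 := by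
    intro x hx
    rw [shellCutoff_eq_zero, zero_mul]
    rw [hK, Set.mem_inter_iff, not_and_or] at hx
    simp only [Set.mem_ofPred_eq, not_le] at hx
    exact hx.imp le_of_lt le_of_lt
  have hKc : IsCompact K := by
    exact Metric.isCompact_of_isClosed_isBounded hKcl
      ((Metric.isBounded_ball (x := (0 : E)) (r := 2)).subset (hKs.trans Set.sdiff_subset))
  have hts : tsupport (fun x => shellCutoff n x * φ x) ⊆ K :=
    closure_minimal (fun x hx => by_contra fun h => hx (h0 x h)) hKcl
  exact ⟨contDiff_of_contDiffOn_of_eq_zero isOpen_punctured hKcl hKs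
    ((contDiff_shellCutoff n).contDiffOn.mul hφ) h0,
    hKc.of_isClosed_subset (isClosed_tsupport _) hts, hts.trans hKs⟩

/-- A point is removable for weak divergence equations with square integrable data, even for test
functions with a gradient of size `1/|x|`: the cut-offs at scale `1/n` have gradient of the same
size, and `1/|x|` is square integrable in dimension three. -/
theorem WeakDiv.integral_singularTest {B : E → E} {a : E → ℝ} (h : WeakDiv (M₁ \ {0}) B a)
    (hB : MemLp B 2 (volume.restrict M₁)) (ha : MemLp a 2 (volume.restrict M₁)) {C : ℝ}
    {φ : E → ℝ} (hφ : IsSingularTest C φ) :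
    ∫ x in M₁, (inner ℝ (B x) (gradient φ x) + a x * φ x) = 0 := by
  obtain ⟨S, hS0, hS⟩ := exists_bound_deriv_smoothTransition
  have hC := hφ.nonneg
  set ψ : ℕ → E → ℝ := fun n x => shellCutoff n x * φ x with hψ
  have hψfd : ∀ n, ∀ x ∈ M₁ \ {0}, ‖fderiv ℝ (ψ n) x‖ ≤ (C + 8 * C * S) * ‖x‖⁻¹ := by
    intro n x hx
    have d1 : DifferentiableAt ℝ (shellCutoff n) x :=
      (contDiff_shellCutoff n).differentiable (by simp) x
    have d2 : DifferentiableAt ℝ φ x :=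
      (hφ.smooth.contDiffAt (isOpen_punctured.mem_nhds hx)).differentiableAt (by simp)
    have e : fderiv ℝ (ψ n) x = shellCutoff n x • fderiv ℝ φ x + φ x • fderiv ℝ (shellCutoff n) x :=
      (d1.hasFDerivAt.mul d2.hasFDerivAt).fderiv
    rw [e]
    refine (norm_add_le _ _).trans ?_
    rw [norm_smul, norm_smul, Real.norm_eq_abs, Real.norm_eq_abs]
    have b1 : |shellCutoff n x| * ‖fderiv ℝ φ x‖ ≤ C * ‖x‖⁻¹ :=
      (mul_le_of_le_one_left (norm_nonneg _) (abs_shellCutoff_le n x)).trans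
        (hφ.bound_fderiv x hx)
    have b2 : |φ x| * ‖fderiv ℝ (shellCutoff n) x‖ ≤ C * (8 * S * ‖x‖⁻¹) :=
      calc |φ x| * ‖fderiv ℝ (shellCutoff n) x‖
          ≤ C * (2 - ‖x‖) * ‖fderiv ℝ (shellCutoff n) x‖ := by gcongr; exact hφ.bound x hx
        _ = C * ((2 - ‖x‖) * ‖fderiv ℝ (shellCutoff n) x‖) := by ring
        _ ≤ C * (8 * S * ‖x‖⁻¹) :=
          mul_le_mul_of_nonneg_left (norm_fderiv_shellCutoff_le hS n hx) hC
    linarith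
  have hψb : ∀ n, ∀ x ∈ M₁ \ {0}, |ψ n x| ≤ 2 * C := by
    intro n x hx
    rw [hψ, abs_mul]
    refine (mul_le_of_le_one_left (abs_nonneg _) (abs_shellCutoff_le n x)).trans
      ((hφ.bound x hx).trans ?_)
    have := norm_nonneg x
    nlinarith
  -- the equation tested with `shellCutoff n * φ`, an admissible test function for `n ≥ 1`, passes to
  -- the limit by dominated convergence, the majorant being `|B| / |x|` up to bounded terms
  have hlim := tendsto_integral_filter_of_dominated_convergence (μ := volume.restrict M₁)
    (l := atTop) (F := fun (n : ℕ) x => inner ℝ (B x) (gradient (ψ n) x) + a x * ψ n x)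
    (f := fun x => inner ℝ (B x) (gradient φ x) + a x * φ x)
    (fun x => (C + 8 * C * S) * (‖B x‖ * ‖x‖⁻¹) + ‖a x‖ * (2 * C)) ?_ ?_ ?_ ?_
  · refine tendsto_nhds_unique hlim ?_
    refine tendsto_const_nhds.congr' ?_
    filter_upwards [eventually_ge_atTop 1] with n hn
    rw [← volume_restrict_punctured]
    exact (h _ (isTest_shellCutoff_mul hφ.smooth hn)).symm
  · filter_upwards [eventually_ge_atTop 1] with n hn
    have ht := isTest_shellCutoff_mul hφ.smooth hn
    exact (hB.1.inner (contDiff_gradient ht.smooth).continuous.aestronglyMeasurable).add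
      (ha.1.mul ht.smooth.continuous.aestronglyMeasurable)
  · refine Eventually.of_forall fun n => ?_
    filter_upwards [ae_mem_punctured] with x hx
    refine (norm_add_le _ _).trans (add_le_add ?_ ?_)
    · refine (norm_inner_le_norm _ _).trans ?_
      rw [norm_gradient]
      calc ‖B x‖ * ‖fderiv ℝ (ψ n) x‖ ≤ ‖B x‖ * ((C + 8 * C * S) * ‖x‖⁻¹) := by
            gcongr; exact hψfd n x hx
        _ = (C + 8 * C * S) * (‖B x‖ * ‖x‖⁻¹) := by ring
    · rw [norm_mul]
      gcongr
      exact hψb n x hx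
  · exact ((integrable_mul_norm_inv hB).const_mul _).add
      ((integrable_of_memLp_two ha).norm.mul_const _)
  · filter_upwards [ae_mem_punctured] with x hx
    refine tendsto_const_nhds.congr' ?_
    filter_upwards [eventually_shellCutoff_eventuallyEq_one hx] with n hn
    have e1 : ψ n =ᶠ[𝓝 x] φ := by
      filter_upwards [hn] with z hz
      rw [hψ]; simp [hz]
    rw [e1.gradient_eq, e1.eq_of_nhds]

/-- A smooth function vanishing on `∂M₁` is an admissible test function. -/
theorem exists_isSingularTest {φ : E → ℝ} (hφ : ContDiff ℝ ∞ φ)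
    (h0 : ∀ x ∈ outerBdry, φ x = 0) : ∃ C, IsSingularTest C φ := by
  obtain ⟨L, hL⟩ := (isCompact_closedBall (0 : E) 2).exists_bound_of_continuousOn
    (hφ.continuous_fderiv (by simp)).continuousOn
  have hL0 : 0 ≤ L := (norm_nonneg _).trans (hL 0 (by simp))
  have hlip : ∀ x ∈ Metric.closedBall (0 : E) 2, ∀ y ∈ Metric.closedBall (0 : E) 2,
      ‖φ y - φ x‖ ≤ L * ‖y - x‖ := fun x hx y hy =>
    (convex_closedBall (0 : E) 2).norm_image_sub_le_of_norm_fderiv_le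
      (fun z _ => hφ.differentiable (by simp) z) hL hx hy
  refine ⟨2 * L, hφ.contDiffOn, fun x hx => ?_, fun x hx => ?_⟩
  -- compare with the value `0` at the radial projection of `x` to the boundary
  · rw [mem_punctured] at hx
    have hz : (2 * ‖x‖⁻¹) • x ∈ outerBdry := by
      simp only [outerBdry, mem_sphere_zero_iff_norm, norm_smul, norm_mul, norm_inv, norm_norm]
      have := hx.2.ne'
      field_simp; norm_num
    have e := hlip _ (by simpa using Metric.sphere_subset_closedBall hz) x (by simpa using hx.1.le)
    rw [h0 _ hz, sub_zero] at e
    have e2 : ‖x - (2 * ‖x‖⁻¹) • x‖ = 2 - ‖x‖ := by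
      have : x - (2 * ‖x‖⁻¹) • x = (1 - 2 * ‖x‖⁻¹) • x := by rw [sub_smul, one_smul]
      rw [this, norm_smul, Real.norm_eq_abs, abs_of_nonpos]
      · have := hx.2.ne'
        field_simp; ring
      · have : 1 ≤ 2 * ‖x‖⁻¹ := by
          rw [← div_eq_mul_inv, le_div_iff₀ hx.2]; linarith
        linarith
    rw [e2] at e
    refine e.trans ?_
    have : 0 ≤ L * (2 - ‖x‖) := mul_nonneg hL0 (by linarith)
    linarith
  · rw [mem_punctured] at hx
    have e := hL x (by simpa using hx.1.le)
    refine e.trans ?_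
    rw [← div_eq_mul_inv, le_div_iff₀ hx.2]
    nlinarith

/-- The origin is removable for weak divergence equations with square integrable data. -/
theorem WeakDiv.of_punctured {B : E → E} {a : E → ℝ} (h : WeakDiv (M₁ \ {0}) B a)
    (hB : MemLp B 2 (volume.restrict M₁)) (ha : MemLp a 2 (volume.restrict M₁)) :
    WeakDiv M₁ B a := by
  intro φ hφ
  obtain ⟨C, hC⟩ := exists_isSingularTest hφ.smooth fun x hx => hφ.eq_zero fun h => by
    simp only [M₁, outerBdry, mem_ball_zero_iff, mem_sphere_zero_iff_norm] at h hx
    linarith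
  exact h.integral_singularTest hB ha hC

theorem locallyIntegrableOn_of_memLp_two {F : Type*} [NormedAddCommGroup F] {Ω : Set E}
    {a : E → F} (ha : MemLp a 2 (volume.restrict Ω)) : LocallyIntegrableOn a Ω := by
  intro x _
  refine ⟨Ω ∩ Metric.ball x 1, inter_mem_nhdsWithin Ω (Metric.ball_mem_nhds x one_pos), ?_⟩
  have : IsFiniteMeasure (volume.restrict (Ω ∩ Metric.ball x 1)) := ⟨by
    rw [Measure.restrict_apply_univ]
    exact (measure_mono Set.inter_subset_right).trans_lt measure_ball_lt_top⟩
  exact (ha.mono_measure (Measure.restrict_mono Set.inter_subset_left le_rfl)).integrable one_le_two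

/-- The origin is removable for `H¹` functions. -/
theorem HasWeakGradient.of_punctured {u : E → ℝ} {G : E → E} (h : HasWeakGradient (M₁ \ {0}) u G)
    (hu : MemLp u 2 (volume.restrict M₁)) (hG : MemLp G 2 (volume.restrict M₁)) :
    HasWeakGradient M₁ u G := by
  rw [hasWeakGradient_iff (locallyIntegrableOn_of_memLp_two hu)
    (locallyIntegrableOn_of_memLp_two hG)]
  intro e
  refine (h.weakDiv e).of_punctured ?_ (hG.inner_const e)
  refine (hu.norm.mul_const ‖e‖).of_le (hu.1.smul_const e) (ae_of_all _ fun x => ?_)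
  simp [norm_smul]

/-! ### The cloaking transformation -/

theorem Diffeo.restrict {Φ Ψ : E → E} {Ω Ω' U U' : Set E} (D : Diffeo Φ Ψ Ω Ω') (hU : IsOpen U)
    (hU' : IsOpen U') (hUΩ : U ⊆ Ω) (hUΩ' : U' ⊆ Ω') (h : Set.MapsTo Φ U U')
    (h' : Set.MapsTo Ψ U' U) : Diffeo Φ Ψ U U' :=
  ⟨hU, hU', D.smooth.mono hUΩ, D.smooth_symm.mono hUΩ', h, h',
    fun _ hx => D.left_inv (hUΩ hx), fun _ hx => D.right_inv (hUΩ' hx)⟩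

/-- The image `N₁ = B(0,2) \ closed B(0,1)` of the singular transformation. -/
def N₁ : Set E := {y | 1 < ‖y‖ ∧ ‖y‖ < 2}

theorem isOpen_N₁ : IsOpen N₁ :=
  (isOpen_lt continuous_const continuous_norm).inter (isOpen_lt continuous_norm continuous_const)

theorem norm_Finv {y : E} (hy : 1 < ‖y‖) : ‖Finv y‖ = 2 * (‖y‖ - 1) := by
  have h : 0 < ‖y‖ := by linarith
  rw [Finv, if_pos hy, norm_smul, norm_smul, norm_inv, norm_norm, inv_mul_cancel₀ h.ne', mul_one,
    Real.norm_of_nonneg (by linarith)]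

theorem diffeo_F₁ : Diffeo F₁ Finv {x | 0 < ‖x‖} {y | 1 < ‖y‖} where
  isOpen := isOpen_lt continuous_const continuous_norm
  isOpen_target := isOpen_lt continuous_const continuous_norm
  smooth := by
    intro x hx
    have hx0 : ‖x‖ ≠ 0 := ne_of_gt hx
    have hn : ContDiffAt ℝ ∞ (fun x : E => ‖x‖) x := contDiffAt_norm ℝ (norm_ne_zero_iff.1 hx0)
    exact (((hn.div_const 2).add contDiffAt_const).smul
      ((hn.inv hx0).smul contDiffAt_id)).contDiffWithinAt
  smooth_symm := by
    intro y hy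
    have hy1 : 1 < ‖y‖ := hy
    have hy0 : ‖y‖ ≠ 0 := by linarith
    have hn : ContDiffAt ℝ ∞ (fun x : E => ‖x‖) y := contDiffAt_norm ℝ (norm_ne_zero_iff.1 hy0)
    have h : ContDiffAt ℝ ∞ (fun y : E => (2 * (‖y‖ - 1)) • (‖y‖⁻¹ • y)) y :=
      (contDiffAt_const.mul (hn.sub contDiffAt_const)).smul ((hn.inv hy0).smul contDiffAt_id)
    refine (h.congr_of_eventuallyEq ?_).contDiffWithinAt
    filter_upwards [(isOpen_lt continuous_const continuous_norm).mem_nhds hy1] with z hz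
    exact if_pos hz
  mapsTo := by
    intro x hx
    have hx' : 0 < ‖x‖ := hx
    change 1 < ‖F₁ x‖
    rw [norm_F₁ (norm_pos_iff.1 hx')]
    linarith
  mapsTo_symm := by
    intro y hy
    have hy' : 1 < ‖y‖ := hy
    change 0 < ‖Finv y‖
    rw [norm_Finv hy']
    linarith
  left_inv := fun _ hx => Finv_F₁ (norm_pos_iff.1 hx)
  right_inv := fun _ hy => F₁_Finv hy

/-- The restriction of the transformation to the shells `2r < |x| < 2` and `r + 1 < |y| < 2`. -/
theorem diffeo_shell {r : ℝ} (hr : 0 ≤ r) :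
    Diffeo F₁ Finv {x | 2 * r < ‖x‖ ∧ ‖x‖ < 2} {y | r + 1 < ‖y‖ ∧ ‖y‖ < 2} := by
  refine diffeo_F₁.restrict
    ((isOpen_lt continuous_const continuous_norm).inter (isOpen_lt continuous_norm continuous_const))
    ((isOpen_lt continuous_const continuous_norm).inter (isOpen_lt continuous_norm continuous_const))
    (fun x hx => ?_) (fun y hy => ?_) (fun x hx => ?_) (fun y hy => ?_)
  · have := hx.1; change 0 < ‖x‖; linarith
  · have := hy.1; change 1 < ‖y‖; linarith
  · have h0 : 0 < ‖x‖ := by have := hx.1; linarith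
    have := norm_F₁ (norm_pos_iff.1 h0)
    exact ⟨by linarith [hx.1], by linarith [hx.2]⟩
  · have := norm_Finv (y := y) (by linarith [hy.1])
    exact ⟨by linarith [hy.1], by linarith [hy.2]⟩

theorem diffeo_N₁ : Diffeo F₁ Finv (M₁ \ {0}) N₁ := by
  have h := diffeo_shell (le_refl 0)
  have e1 : {x : E | 2 * 0 < ‖x‖ ∧ ‖x‖ < 2} = M₁ \ {0} := by
    ext x; rw [mem_punctured]; simp only [Set.mem_ofPred_eq, mul_zero]; exact and_comm
  have e2 : {y : E | 0 + 1 < ‖y‖ ∧ ‖y‖ < 2} = N₁ := by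
    simp [N₁]
  rwa [e1, e2] at h

theorem F₁_of_mem_outerBdry {x : E} (hx : x ∈ outerBdry) : F₁ x = x := by
  have : ‖x‖ = 2 := by simpa [outerBdry] using hx
  rw [F₁, this, smul_smul]; norm_num

theorem Finv_of_mem_outerBdry {x : E} (hx : x ∈ outerBdry) : Finv x = x := by
  have : ‖x‖ = 2 := by simpa [outerBdry] using hx
  rw [Finv, this, smul_smul]; norm_num

/-- `F₁(x) = x/2 + x/|x|`, and each of the three terms of the derivative has norm at most `1/|x|` on
`M₁`. -/
theorem norm_fderiv_F₁_le {x : E} (hx : x ∈ M₁ \ {0}) : ‖fderiv ℝ F₁ x‖ ≤ 3 * ‖x‖⁻¹ := by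
  rw [mem_punctured] at hx
  obtain ⟨hx2, hx0⟩ := hx
  have hd : DifferentiableAt ℝ (fun z : E => ‖z‖) x :=
    (contDiffAt_norm (n := 1) ℝ (norm_pos_iff.1 hx0)).differentiableAt (by simp)
  set ν := fderiv ℝ (fun z : E => ‖z‖) x with hν
  have hν1 : ‖ν‖ ≤ 1 := by
    simpa using norm_fderiv_le_of_lipschitz ℝ (x₀ := x) (lipschitzWith_one_norm (E := E))
  have h1 : HasFDerivAt (fun z : E => ‖z‖⁻¹) (-(‖x‖ ^ 2)⁻¹ • ν) x :=
    (hasDerivAt_inv hx0.ne').comp_hasFDerivAt x hd.hasFDerivAt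
  have h2 : HasFDerivAt (fun z : E => (1 / 2 : ℝ) • z + ‖z‖⁻¹ • z)
      ((1 / 2 : ℝ) • ContinuousLinearMap.id ℝ E + (‖x‖⁻¹ • ContinuousLinearMap.id ℝ E +
        (-(‖x‖ ^ 2)⁻¹ • ν).smulRight x)) x :=
    ((hasFDerivAt_id x).const_smul (1 / 2 : ℝ)).add (h1.smul (hasFDerivAt_id x))
  have h3 : HasFDerivAt F₁ _ x := h2.congr_of_eventuallyEq (by
    filter_upwards [(isOpen_lt continuous_const continuous_norm).mem_nhds hx0] with z hz
    have hz0 : ‖z‖ ≠ 0 := ne_of_gt hz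
    rw [F₁, smul_smul, ← add_smul]
    congr 1
    field_simp)
  rw [h3.fderiv]
  have a1 : ‖(1 / 2 : ℝ) • ContinuousLinearMap.id ℝ E‖ ≤ ‖x‖⁻¹ := by
    rw [norm_smul]
    refine (mul_le_of_le_one_right (norm_nonneg _) ContinuousLinearMap.norm_id_le).trans ?_
    rw [Real.norm_of_nonneg (by norm_num), ← one_div]
    exact one_div_le_one_div_of_le hx0 hx2.le
  have a2 : ‖‖x‖⁻¹ • ContinuousLinearMap.id ℝ E‖ ≤ ‖x‖⁻¹ := by
    rw [norm_smul]
    refine (mul_le_of_le_one_right (norm_nonneg _) ContinuousLinearMap.norm_id_le).trans ?_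
    rw [Real.norm_of_nonneg (by positivity)]
  have a3 : ‖(-(‖x‖ ^ 2)⁻¹ • ν).smulRight x‖ ≤ ‖x‖⁻¹ := by
    rw [ContinuousLinearMap.norm_smulRight_apply, norm_smul, norm_neg,
      Real.norm_of_nonneg (by positivity)]
    calc (‖x‖ ^ 2)⁻¹ * ‖ν‖ * ‖x‖ ≤ (‖x‖ ^ 2)⁻¹ * 1 * ‖x‖ := by gcongr
      _ = ‖x‖⁻¹ := by field_simp
  calc _ ≤ ‖x‖⁻¹ + (‖x‖⁻¹ + ‖x‖⁻¹) :=
        (norm_add_le _ _).trans (add_le_add a1 ((norm_add_le _ _).trans (add_le_add a2 a3)))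
    _ = 3 * ‖x‖⁻¹ := by ring

/-- Test functions on `N` pull back to admissible singular test functions on `M₁`. -/
theorem exists_isSingularTest_comp_F₁ {ψ : E → ℝ} (hψ : ContDiff ℝ ∞ ψ)
    (h0 : ∀ x ∈ outerBdry, ψ x = 0) : ∃ C, IsSingularTest C (fun x => ψ (F₁ x)) := by
  obtain ⟨C, hC⟩ := exists_isSingularTest hψ h0
  have hC0 := hC.nonneg
  have hF : ∀ x ∈ M₁ \ {0}, F₁ x ∈ M₁ \ {0} ∧ ‖F₁ x‖ = ‖x‖ / 2 + 1 := by
    intro x hx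
    rw [mem_punctured] at hx
    have := norm_F₁ (norm_pos_iff.1 hx.2)
    rw [mem_punctured, this]
    refine ⟨⟨?_, ?_⟩, rfl⟩ <;> linarith [hx.1, hx.2]
  refine ⟨3 * C, hψ.comp_contDiffOn diffeo_N₁.smooth, fun x hx => ?_, fun x hx => ?_⟩
  · refine (hC.bound _ (hF x hx).1).trans ?_
    rw [(hF x hx).2]
    rw [mem_punctured] at hx
    nlinarith
  · have e : fderiv ℝ (fun z => ψ (F₁ z)) x = (fderiv ℝ ψ (F₁ x)).comp (fderiv ℝ F₁ x) :=
      ((hψ.differentiable (by simp) _).hasFDerivAt.comp x (diffeo_N₁.hasFDerivAt hx)).fderiv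
    rw [e]
    refine (ContinuousLinearMap.opNorm_comp_le _ _).trans ?_
    have b1 : ‖fderiv ℝ ψ (F₁ x)‖ ≤ C := by
      refine (hC.bound_fderiv _ (hF x hx).1).trans ?_
      rw [(hF x hx).2]
      exact mul_le_of_le_one_right hC0 (inv_le_one_of_one_le₀ (by linarith [norm_nonneg x]))
    calc ‖fderiv ℝ ψ (F₁ x)‖ * ‖fderiv ℝ F₁ x‖ ≤ C * (3 * ‖x‖⁻¹) := by
          gcongr; exact norm_fderiv_F₁_le hx
      _ = 3 * C * ‖x‖⁻¹ := by ring

/-! ### The push-forward metric -/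

theorem jacFinv_eq (y : E) : jacFinv y = LinearMap.toMatrix
    (EuclideanSpace.basisFun (Fin 3) ℝ).toBasis (EuclideanSpace.basisFun (Fin 3) ℝ).toBasis
    (fderiv ℝ Finv y : E →ₗ[ℝ] E) := by
  ext i j
  simp [jacFinv, LinearMap.toMatrix_apply]

theorem gt_eq (y : E) : gt y = (jacFinv y)ᵀ * jacFinv y := by
  ext j l
  simp [gt, Matrix.mul_apply, Matrix.one_apply]

/-- `g̃ = JᵀJ` with `J` the Jacobian matrix of `F⁻¹`, so `|g̃|^{1/2} = |det J|`. -/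
theorem sqrtDet_eq (y : E) : sqrtDet y = |(fderiv ℝ Finv y).det| := by
  have : (jacFinv y).det = (fderiv ℝ Finv y).det := by
    rw [jacFinv_eq, LinearMap.det_toMatrix]
  rw [sqrtDet, gt_eq, Matrix.det_mul, Matrix.det_transpose, this, Real.sqrt_mul_self_eq_abs]

/-- The flux in terms of an inverse `P` of `DF⁻¹`, for which `g̃⁻¹ = P Pᵀ`. -/
theorem flux_eq {y : E} {P : E →L[ℝ] E} (h : P.comp (fderiv ℝ Finv y) = .id ℝ E)
    (h' : (fderiv ℝ Finv y).comp P = .id ℝ E) (G : E → E) :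
    flux G y = |(fderiv ℝ Finv y).det| • P (P.adjoint (G y)) := by
  set b := (EuclideanSpace.basisFun (Fin 3) ℝ).toBasis with hb
  set Q := LinearMap.toMatrix b b (P : E →ₗ[ℝ] E) with hQ
  have e1 : Q * jacFinv y = 1 := by
    rw [jacFinv_eq, ← hb, hQ, ← LinearMap.toMatrix_comp]
    have : (P : E →ₗ[ℝ] E) ∘ₗ (fderiv ℝ Finv y : E →ₗ[ℝ] E) = LinearMap.id := by
      ext1 v; exact DFunLike.congr_fun h v
    rw [this, LinearMap.toMatrix_id]
  have e2 : jacFinv y * Q = 1 := by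
    rw [jacFinv_eq, ← hb, hQ, ← LinearMap.toMatrix_comp]
    have : (fderiv ℝ Finv y : E →ₗ[ℝ] E) ∘ₗ (P : E →ₗ[ℝ] E) = LinearMap.id := by
      ext1 v; exact DFunLike.congr_fun h' v
    rw [this, LinearMap.toMatrix_id]
  have hinv : (gt y)⁻¹ = Q * Qᵀ := by
    refine Matrix.inv_eq_right_inv ?_
    rw [gt_eq, Matrix.mul_assoc, ← Matrix.mul_assoc (jacFinv y), e2, Matrix.one_mul,
      ← Matrix.transpose_mul, e1, Matrix.transpose_one]
  have hQP : ∀ i l, Q i l = P (EuclideanSpace.single l 1) i := by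
    intro i l
    simp [hQ, hb, LinearMap.toMatrix_apply]
  have hadj : ∀ l, P.adjoint (G y) l = ∑ i, Q i l * G y i := by
    intro l
    have : P.adjoint (G y) l = inner ℝ (EuclideanSpace.single l (1 : ℝ)) (P.adjoint (G y)) := by
      simp [EuclideanSpace.inner_single_left]
    rw [this, ContinuousLinearMap.adjoint_inner_right, PiLp.inner_apply]
    refine Finset.sum_congr rfl fun i _ => ?_
    simp [hQP, mul_comm]
  have hP : ∀ (v : E) j, P v j = ∑ l, Q j l * v l := by
    intro v j
    have hv : v = ∑ i, v i • EuclideanSpace.single i (1 : ℝ) := by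
      ext j; simp [Finset.sum_apply, Pi.single_apply]
    conv_lhs => rw [hv, map_sum]
    simp [hQP, mul_comm]
  ext j
  rw [PiLp.smul_apply, hP]
  simp only [flux, hadj, hinv, Matrix.mul_apply, Matrix.transpose_apply, sqrtDet_eq, smul_eq_mul]
  congr 1
  simp only [Finset.sum_mul, Finset.mul_sum]
  rw [Finset.sum_comm]
  refine Finset.sum_congr rfl fun l _ => Finset.sum_congr rfl fun i _ => ?_
  ring

/-- The energy density in terms of an inverse `P` of `DF⁻¹`: it is the pairing of flux and gradient. -/
theorem energyDensity_eq {y : E} {P : E →L[ℝ] E} (h : P.comp (fderiv ℝ Finv y) = .id ℝ E)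
    (h' : (fderiv ℝ Finv y).comp P = .id ℝ E) (G : E → E) :
    energyDensity G y = |(fderiv ℝ Finv y).det| * ‖P.adjoint (G y)‖ ^ 2 := by
  have e : energyDensity G y = inner ℝ (flux G y) (G y) := by
    rw [PiLp.inner_apply, energyDensity, Finset.sum_comm, Finset.mul_sum]
    refine Finset.sum_congr rfl fun j _ => ?_
    simp only [flux, RCLike.inner_apply, conj_trivial, Finset.mul_sum]
    refine Finset.sum_congr rfl fun i _ => ?_
    ring
  rw [e, flux_eq h h', real_inner_smul_left, ← ContinuousLinearMap.adjoint_inner_right,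
    real_inner_self_eq_norm_sq]

theorem flux_of_mem_N₁ {y : E} (hy : y ∈ N₁) (G : E → E) :
    flux G y = |(fderiv ℝ Finv y).det| •
      fderiv ℝ F₁ (Finv y) ((fderiv ℝ F₁ (Finv y)).adjoint (G y)) := by
  refine flux_eq (diffeo_N₁.symm.fderiv_comp hy) ?_ G
  have := diffeo_N₁.fderiv_comp (diffeo_N₁.mapsTo_symm hy)
  rwa [diffeo_N₁.right_inv hy] at this

theorem energyDensity_of_mem_N₁ {y : E} (hy : y ∈ N₁) (G : E → E) :
    energyDensity G y = |(fderiv ℝ Finv y).det| *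
      ‖(fderiv ℝ F₁ (Finv y)).adjoint (G y)‖ ^ 2 := by
  refine energyDensity_eq (diffeo_N₁.symm.fderiv_comp hy) ?_ G
  have := diffeo_N₁.fderiv_comp (diffeo_N₁.mapsTo_symm hy)
  rwa [diffeo_N₁.right_inv hy] at this

theorem fderiv_Finv_of_mem_M₂ {y : E} (hy : y ∈ M₂) : fderiv ℝ Finv y = .id ℝ E := by
  have : Finv =ᶠ[𝓝 y] id := by
    filter_upwards [Metric.isOpen_ball.mem_nhds hy] with z hz
    have : ‖z‖ < 1 := by simpa using hz
    rw [Finv, if_neg (by linarith)]; rfl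
  rw [this.fderiv_eq, fderiv_id]

theorem sqrtDet_of_mem_M₂ {y : E} (hy : y ∈ M₂) : sqrtDet y = 1 := by
  rw [sqrtDet_eq, fderiv_Finv_of_mem_M₂ hy]
  simp [ContinuousLinearMap.det]

theorem flux_of_mem_M₂ {y : E} (hy : y ∈ M₂) (G : E → E) : flux G y = G y := by
  rw [flux_eq (P := .id ℝ E) (by rw [fderiv_Finv_of_mem_M₂ hy]; rfl)
    (by rw [fderiv_Finv_of_mem_M₂ hy]; rfl), ← sqrtDet_eq, sqrtDet_of_mem_M₂ hy]
  simp [ContinuousLinearMap.adjoint_id]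

theorem energyDensity_of_mem_M₂ {y : E} (hy : y ∈ M₂) (G : E → E) :
    energyDensity G y = ‖G y‖ ^ 2 := by
  rw [energyDensity_eq (P := .id ℝ E) (by rw [fderiv_Finv_of_mem_M₂ hy]; rfl)
    (by rw [fderiv_Finv_of_mem_M₂ hy]; rfl), ← sqrtDet_eq, sqrtDet_of_mem_M₂ hy]
  simp [ContinuousLinearMap.adjoint_id]

theorem N_diff_surf : N \ surf = N₁ ∪ M₂ := by
  ext y
  simp only [N, surf, M₂, N₁, Set.mem_sdiff, mem_ball_zero_iff, mem_sphere_zero_iff_norm,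
    Set.mem_union, Set.mem_ofPred_eq]
  constructor
  · rintro ⟨h1, h2⟩
    rcases lt_or_gt_of_ne h2 with h | h
    · exact Or.inr h
    · exact Or.inl ⟨h, h1⟩
  · rintro (⟨h1, h2⟩ | h)
    · exact ⟨h2, h1.ne'⟩
    · exact ⟨by linarith, h.ne⟩

theorem disjoint_N₁_M₂ : Disjoint N₁ M₂ := by
  rw [Set.disjoint_left]
  intro y h1 h2
  have h3 : ‖y‖ < 1 := by simpa [M₂] using h2
  linarith [h1.1]

theorem volume_restrict_N : volume.restrict N = volume.restrict (N₁ ∪ M₂) := by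
  rw [← N_diff_surf]
  exact (Measure.restrict_congr_set
    (sdiff_null_ae_eq_self (Measure.addHaar_sphere volume (0 : E) 1))).symm

/-! ### Traces -/

theorem tendsto_zero_of_le_mul {f g : ℕ → ℝ≥0∞} {c : ℝ≥0∞} (hc : c ≠ ⊤)
    (hf : Tendsto f atTop (𝓝 0)) (h : ∀ n, g n ≤ c * f n) : Tendsto g atTop (𝓝 0) := by
  have h0 : Tendsto (fun n => c * f n) atTop (𝓝 0) := by
    simpa using ENNReal.Tendsto.const_mul hf (Or.inr hc)
  exact tendsto_of_tendsto_of_tendsto_of_le_of_le tendsto_const_nhds h0 (fun _ => zero_le) h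

theorem norm_adjoint_apply_le (A : E →L[ℝ] E) (w : E) : ‖A.adjoint w‖ ≤ ‖A‖ * ‖w‖ := by
  have h := A.adjoint.le_opNorm w
  rwa [LinearIsometryEquiv.norm_map] at h

theorem aestronglyMeasurable_clm_apply {μ : Measure E} {A : E → E →L[ℝ] E} {G : E → E}
    (hA : AEStronglyMeasurable A μ) (hG : AEStronglyMeasurable G μ) :
    AEStronglyMeasurable (fun x => A x (G x)) μ :=
  (ContinuousLinearMap.apply ℝ E).aestronglyMeasurable_comp₂ hG hA

theorem Diffeo.aestronglyMeasurable_adjoint_comp {Φ Ψ : E → E} {Ω Ω' : Set E}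
    (D : Diffeo Φ Ψ Ω Ω') {G : E → E} (hG : AEStronglyMeasurable G (volume.restrict Ω')) :
    AEStronglyMeasurable (fun x => (fderiv ℝ Φ x).adjoint (G (Φ x))) (volume.restrict Ω) := by
  have hA : ContinuousOn (fun x => (fderiv ℝ Φ x).adjoint) Ω :=
    ContinuousLinearMap.adjoint.continuous.comp_continuousOn D.continuousOn_fderiv
  exact aestronglyMeasurable_clm_apply (hA.aestronglyMeasurable D.isOpen.measurableSet)
    (D.aestronglyMeasurable_comp hG)

theorem locallyIntegrableOn_congr_ae {F : Type*} [NormedAddCommGroup F] {Ω : Set E}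
    {a b : E → F} (ha : LocallyIntegrableOn a Ω)
    (h : ∀ᵐ x ∂volume.restrict Ω, a x = b x) : LocallyIntegrableOn b Ω := by
  intro x hx
  obtain ⟨s, hs, hi⟩ := ha x hx
  refine ⟨s ∩ Ω, inter_mem hs self_mem_nhdsWithin, ?_⟩
  refine (hi.mono_set Set.inter_subset_left).congr ?_
  exact ae_restrict_of_ae_restrict_of_subset Set.inter_subset_right h

theorem HasWeakGradient.congr_ae {Ω : Set E} {u v : E → ℝ} {G G' : E → E}
    (h : HasWeakGradient Ω u G) (huv : ∀ᵐ x ∂volume.restrict Ω, u x = v x)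
    (hG : ∀ᵐ x ∂volume.restrict Ω, G x = G' x) : HasWeakGradient Ω v G' := by
  rw [hasWeakGradient_iff (locallyIntegrableOn_congr_ae h.1 huv)
    (locallyIntegrableOn_congr_ae h.2.1 hG)]
  intro e
  refine (h.weakDiv e).congr_ae ?_ ?_
  · filter_upwards [huv] with x hx
    rw [hx]
  · filter_upwards [hG] with x hx
    rw [hx]

theorem IsH1.mono {Ω Ω' : Set E} {u : E → ℝ} {G : E → E} (h : IsH1 Ω' u G) (hΩ : Ω ⊆ Ω') :
    IsH1 Ω u G :=
  ⟨h.1.mono hΩ, h.2.1.mono_measure (Measure.restrict_mono hΩ le_rfl),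
    h.2.2.mono_measure (Measure.restrict_mono hΩ le_rfl)⟩

theorem IsH1.congr_ae {Ω : Set E} {u v : E → ℝ} {G G' : E → E}
    (h : IsH1 Ω u G) (huv : ∀ᵐ x ∂volume.restrict Ω, u x = v x)
    (hG : ∀ᵐ x ∂volume.restrict Ω, G x = G' x) : IsH1 Ω v G' :=
  ⟨h.1.congr_ae huv hG, h.2.1.ae_eq huv, h.2.2.ae_eq hG⟩

/-- The collar `2 - δ < |x| < 2` of the outer boundary. -/
def collar (δ : ℝ) : Set E := {x | 2 - δ < ‖x‖ ∧ ‖x‖ < 2}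

theorem isOpen_collar (δ : ℝ) : IsOpen (collar δ) :=
  (isOpen_lt continuous_const continuous_norm).inter (isOpen_lt continuous_norm continuous_const)

theorem collar_mono {δ δ' : ℝ} (h : δ ≤ δ') : collar δ ⊆ collar δ' := by
  intro x hx
  exact ⟨by linarith [hx.1], hx.2⟩

/-- `u|_{∂B(0,2)} = h`, with the trace taken from the collar of width `δ`. -/
def HasTraceOn (δ : ℝ) (u h : E → ℝ) : Prop :=
  MemLp h 2 outerMeasure ∧ ∃ G : E → E, ∃ v : ℕ → E → ℝ,
    IsH1 (collar δ) u G ∧ (∀ n, ContDiff ℝ ∞ (v n)) ∧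
    Tendsto (fun n => eLpNorm (fun x => v n x - u x) 2 (volume.restrict (collar δ))) atTop (𝓝 0) ∧
    Tendsto (fun n => eLpNorm (fun x => gradient (v n) x - G x) 2
      (volume.restrict (collar δ))) atTop (𝓝 0) ∧
    Tendsto (fun n => eLpNorm (fun x => v n x - h x) 2 outerMeasure) atTop (𝓝 0)

theorem hasTrace_iff {u h : E → ℝ} :
    HasTrace u h ↔ ∃ δ, 0 < δ ∧ δ < 1 ∧ HasTraceOn δ u h := by
  constructor
  · rintro ⟨h1, δ, h2, h3, h4⟩
    exact ⟨δ, h2, h3, h1, h4⟩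
  · rintro ⟨δ, h2, h3, h1, h4⟩
    exact ⟨h1, δ, h2, h3, h4⟩

theorem HasTraceOn.mono {δ δ' : ℝ} {u h : E → ℝ} (H : HasTraceOn δ' u h) (hδ : δ ≤ δ') :
    HasTraceOn δ u h := by
  obtain ⟨h1, G, v, h2, h3, h4, h5, h6⟩ := H
  have hm := Measure.restrict_mono (collar_mono hδ) (le_refl (volume : Measure E))
  refine ⟨h1, G, v, h2.mono (collar_mono hδ), h3, ?_, ?_, h6⟩
  · exact tendsto_of_tendsto_of_tendsto_of_le_of_le tendsto_const_nhds h4 (fun _ => zero_le)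
      fun n => eLpNorm_mono_measure _ hm
  · exact tendsto_of_tendsto_of_tendsto_of_le_of_le tendsto_const_nhds h5 (fun _ => zero_le)
      fun n => eLpNorm_mono_measure _ hm

theorem ae_mem_outerBdry : ∀ᵐ x ∂outerMeasure, x ∈ outerBdry :=
  ae_restrict_mem Metric.isClosed_sphere.measurableSet

/-- Traces are preserved by a diffeomorphism, smooth up to the boundary, which is the identity on
the boundary. The cut-off `χ` makes the pulled back approximations globally smooth. -/
theorem HasTraceOn.comp {Φ Ψ : E → E} {Ω Ω' : Set E} (D : Diffeo Φ Ψ Ω Ω') {δ δ' : ℝ}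
    (D₀ : Diffeo Φ Ψ (collar δ) (collar δ')) {χ : E → ℝ} (hχ : ContDiff ℝ ∞ χ)
    (hχΩ : tsupport χ ⊆ Ω) (hχ1 : ∀ x, 2 - δ ≤ ‖x‖ → ‖x‖ ≤ 2 → χ x = 1) (hδ : 0 ≤ δ)
    (hid : ∀ x ∈ outerBdry, Φ x = x) {u u' h h' : E → ℝ} (H : HasTraceOn δ' u' h')
    (hu : ∀ᵐ x ∂volume.restrict (collar δ), u' (Φ x) = u x) (hh : ∀ x ∈ outerBdry, h' x = h x) :
    HasTraceOn δ u h := by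
  obtain ⟨h1, G', v', h2, h3, h4, h5, h6⟩ := H
  set K : Set E := {x | 2 - δ ≤ ‖x‖} ∩ Metric.closedBall 0 2 with hKdef
  have hKc : IsCompact K := (isCompact_closedBall (0 : E) 2).inter_left
    (isClosed_le continuous_const continuous_norm)
  have hKχ : ∀ x ∈ K, χ x = 1 := fun x hx => hχ1 x hx.1 (by simpa using hx.2)
  have hKΩ : K ⊆ Ω := fun x hx => hχΩ (subset_tsupport _ (by simp [hKχ x hx]))
  have hAK : collar δ ⊆ K := fun x hx => ⟨hx.1.le, by simpa using hx.2.le⟩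
  have hAΩ := hAK.trans hKΩ
  have hAm := (isOpen_collar δ).measurableSet
  have hbK : ∀ x ∈ outerBdry, x ∈ K := fun x hx => by
    have : ‖x‖ = 2 := by simpa [outerBdry] using hx
    exact ⟨by change 2 - δ ≤ ‖x‖; linarith, by simp [this]⟩
  have hc1 : ContinuousOn (fun x => |(fderiv ℝ Ψ (Φ x)).det|) K := by
    have h1 : ContinuousOn (fun y => |(fderiv ℝ Ψ y).det|) Ω' := fun y hy =>
      (D.symm.contDiffAt_abs_det hy).continuousAt.continuousWithinAt
    exact h1.comp (D.smooth.continuousOn.mono hKΩ) fun x hx => D.mapsTo (hKΩ hx)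
  obtain ⟨C, hC⟩ := hKc.exists_bound_of_continuousOn hc1
  obtain ⟨C', hC'⟩ := hKc.exists_bound_of_continuousOn (D.continuousOn_fderiv.mono hKΩ)
  have hCA : ∀ x ∈ collar δ, |(fderiv ℝ Ψ (Φ x)).det| ≤ C := fun x hx => by
    simpa using hC x (hAK hx)
  have himg := D₀.image_eq
  set G : E → E := fun x => (fderiv ℝ Φ x).adjoint (G' (Φ x)) with hG
  set v : ℕ → E → ℝ := fun n x => χ x * v' n (Φ x) with hv
  have hvs : ∀ n, ContDiff ℝ ∞ (v n) := fun n =>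
    contDiff_of_contDiffOn_of_eq_zero D.isOpen (isClosed_tsupport χ) hχΩ
      (hχ.contDiffOn.mul ((h3 n).comp_contDiffOn D.smooth)) fun x hx => by
        simp only [hv, image_eq_zero_of_notMem_tsupport hx, zero_mul]
  have hG'm : AEStronglyMeasurable (fun x => G' (Φ x)) (volume.restrict (collar δ)) :=
    D₀.aestronglyMeasurable_comp h2.2.2.1
  have hGm : AEStronglyMeasurable G (volume.restrict (collar δ)) :=
    D₀.aestronglyMeasurable_adjoint_comp h2.2.2.1
  have hGle : ∀ x ∈ collar δ, ∀ w : E, ‖(fderiv ℝ Φ x).adjoint w‖ ≤ C' * ‖w‖ := by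
    intro x hx w
    exact (norm_adjoint_apply_le _ w).trans
      (mul_le_mul_of_nonneg_right (hC' x (hAK hx)) (norm_nonneg w))
  have hum : MemLp (fun x => u' (Φ x)) 2 (volume.restrict (collar δ)) :=
    D.memLp_comp hAm hAΩ hCA (by rw [himg]; exact h2.2.1)
  have hG'p : MemLp (fun x => G' (Φ x)) 2 (volume.restrict (collar δ)) :=
    D.memLp_comp hAm hAΩ hCA (by rw [himg]; exact h2.2.2)
  have hGp : MemLp G 2 (volume.restrict (collar δ)) := by
    refine (hG'p.norm.const_mul C').mono' hGm ?_
    filter_upwards [ae_restrict_mem hAm] with x hx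
    exact hGle x hx _
  have hH1 : IsH1 (collar δ) (fun x => u' (Φ x)) G :=
    ⟨D₀.hasWeakGradient_comp h2.1, hum, hGp⟩
  have hCfin : ENNReal.ofReal C ^ (1 / 2 : ℝ) ≠ ⊤ :=
    ENNReal.rpow_ne_top_of_nonneg (by norm_num) ENNReal.ofReal_ne_top
  refine ⟨h1.ae_eq ?_, G, v, hH1.congr_ae hu (ae_of_all _ fun _ => rfl), hvs, ?_, ?_, ?_⟩
  · filter_upwards [ae_mem_outerBdry] with x hx
    exact hh x hx
  · refine tendsto_zero_of_le_mul hCfin h4 fun n => ?_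
    have e : eLpNorm (fun x => v n x - u x) 2 (volume.restrict (collar δ)) =
        eLpNorm (fun x => v' n (Φ x) - u' (Φ x)) 2 (volume.restrict (collar δ)) := by
      refine eLpNorm_congr_ae ?_
      filter_upwards [hu, ae_restrict_mem hAm] with x hx hxA
      rw [hv, ← hx]
      simp [hKχ x (hAK hxA)]
    rw [e]
    have := D.eLpNorm_comp_le hAm hAΩ hCA (g := fun y => v' n y - u' y) (by
      rw [himg]; exact (h3 n).continuous.aestronglyMeasurable.sub h2.2.1.1)
    rwa [himg] at this
  · refine tendsto_zero_of_le_mul (ENNReal.mul_ne_top (ENNReal.ofReal_ne_top (r := C')) hCfin) h5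
      fun n => ?_
    have := D.eLpNorm_comp_le hAm hAΩ hCA (g := fun y => gradient (v' n) y - G' y) (by
      rw [himg]; exact (contDiff_gradient (h3 n)).continuous.aestronglyMeasurable.sub h2.2.2.1)
    rw [himg] at this
    rw [mul_assoc]
    refine le_trans ?_ (mul_le_mul_right this _)
    refine eLpNorm_le_mul_eLpNorm_of_ae_le_mul ?_ 2
    filter_upwards [ae_restrict_mem hAm] with x hx
    have e : gradient (v n) x = (fderiv ℝ Φ x).adjoint (gradient (v' n) (Φ x)) := by
      rw [← D.gradient_comp (hAΩ hx) ((h3 n).differentiable (by simp) _)]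
      refine gradient_congr_of_isOpen (isOpen_collar δ) (fun z hz => ?_) hx
      rw [hv]; simp [hKχ z (hAK hz)]
    rw [e, hG, ← map_sub]
    exact hGle x hx _
  · refine h6.congr fun n => eLpNorm_congr_ae ?_
    filter_upwards [ae_mem_outerBdry] with x hx
    rw [hv, ← hh x hx]
    simp [hKχ x (hbK x hx), hid x hx]

theorem tsupport_radialStep_subset (α β : ℝ) :
    tsupport (radialStep α β) ⊆ {x | 0 ≤ α * ‖x‖ ^ 2 + β} := by
  refine closure_minimal (fun x hx => ?_) (isClosed_le continuous_const (by fun_prop))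
  by_contra h
  exact hx (Real.smoothTransition.zero_of_nonpos (not_le.1 h).le)

theorem diffeo_collar {δ : ℝ} (hδ : δ < 1) : Diffeo F₁ Finv (collar δ) (collar (δ / 2)) := by
  have h := diffeo_shell (r := 1 - δ / 2) (by linarith)
  have e1 : {x : E | 2 * (1 - δ / 2) < ‖x‖ ∧ ‖x‖ < 2} = collar δ := by
    rw [show 2 * (1 - δ / 2) = 2 - δ by ring]; rfl
  have e2 : {y : E | 1 - δ / 2 + 1 < ‖y‖ ∧ ‖y‖ < 2} = collar (δ / 2) := by
    rw [show 1 - δ / 2 + 1 = 2 - δ / 2 by ring]; rfl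
  rwa [e1, e2] at h

/-- Traces on `∂N` pull back to traces on `∂M₁`. The collar of width `δ` in `M₁` is the preimage of the
collar of width `δ / 2` in `N`, and `F₁` is smooth across the boundary. -/
theorem HasTrace.comp_F₁ {u u' h h' : E → ℝ} (H : HasTrace u' h')
    (hu : ∀ᵐ x ∂volume.restrict M₁, u' (F₁ x) = u x) (hh : ∀ x ∈ outerBdry, h' x = h x) :
    HasTrace u h := by
  rw [hasTrace_iff] at H ⊢
  obtain ⟨δ, h0, h1, H⟩ := H
  refine ⟨δ, h0, h1, (H.mono (half_le_self h0.le)).comp diffeo_F₁ (diffeo_collar h1)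
    (contDiff_radialStep 2 (-1)) ((tsupport_radialStep_subset _ _).trans fun x hx => ?_)
    (fun x hx _ => Real.smoothTransition.one_of_one_le ?_) h0.le
    (fun x hx => F₁_of_mem_outerBdry hx) ?_ hh⟩
  · change 0 < ‖x‖
    have hx' : 0 ≤ 2 * ‖x‖ ^ 2 + -1 := hx
    by_contra! hle
    have : ‖x‖ = 0 := le_antisymm hle (norm_nonneg x)
    rw [this] at hx'; norm_num at hx'
  · nlinarith
  · exact ae_restrict_of_ae_restrict_of_subset (fun x hx => by simpa [M₁] using hx.2) hu

/-- Traces on `∂M₁` push forward to traces on `∂N`. -/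
theorem HasTrace.comp_Finv {u u' h h' : E → ℝ} (H : HasTrace u' h')
    (hu : ∀ᵐ y ∂volume.restrict N₁, u' (Finv y) = u y) (hh : ∀ x ∈ outerBdry, h' x = h x) :
    HasTrace u h := by
  rw [hasTrace_iff] at H ⊢
  obtain ⟨δ, h0, h1, H⟩ := H
  refine ⟨δ / 2, half_pos h0, by linarith, H.comp diffeo_F₁.symm (diffeo_collar h1).symm
    (contDiff_radialStep 1 (-(5 / 4))) ((tsupport_radialStep_subset _ _).trans fun x hx => ?_)
    (fun x hx _ => Real.smoothTransition.one_of_one_le ?_) (half_pos h0).le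
    (fun x hx => Finv_of_mem_outerBdry hx) ?_ hh⟩
  · change 1 < ‖x‖
    have hx' : 0 ≤ 1 * ‖x‖ ^ 2 + -(5 / 4) := hx
    nlinarith [norm_nonneg x]
  · nlinarith
  · have hsub : collar (δ / 2) ⊆ N₁ := fun x hx => ⟨by linarith [hx.1], hx.2⟩
    exact ae_restrict_of_ae_restrict_of_subset hsub hu

/-! ### Elliptic regularity -/

section Regularity
open TemperedDistribution FourierTransform
open scoped SchwartzMap Laplacian

/-- A square integrable function with square integrable distributional Laplacian is continuous up
to a null set: it lies in the Sobolev space `H²`, and `2 > 3/2`, so that its Fourier transform is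
integrable. -/
theorem exists_continuous_ae_eq_of_laplacian_memLp {w g : E → ℂ}
    (hw : MemLp w 2) (hg : MemLp g 2)
    (h : ∀ ψ : 𝓢(E, ℂ), ∫ x, (Δ ψ) x * w x = ∫ x, ψ x * g x) :
    ∃ U : E → ℂ, Continuous U ∧ w =ᵐ[volume] U := by
  set T : 𝓢'(E, ℂ) := Lp.toTemperedDistribution (hw.toLp w) with hT
  have hTa : ∀ ψ : 𝓢(E, ℂ), T ψ = ∫ x, ψ x * w x := by
    intro ψ
    rw [hT, Lp.toTemperedDistribution_apply]
    apply integral_congr_ae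
    filter_upwards [hw.coeFn_toLp] with x hx
    rw [hx, smul_eq_mul]
  have hΔ : Δ T = (Lp.toTemperedDistribution (hg.toLp g) : 𝓢'(E, ℂ)) := by
    ext ψ
    rw [laplacian_apply_apply, hTa, h, Lp.toTemperedDistribution_apply]
    apply integral_congr_ae
    filter_upwards [hg.coeFn_toLp] with x hx
    rw [hx, smul_eq_mul]
  have hS : MemSobolev 2 2 T := by
    refine ⟨hw.toLp w - (((2 * Real.pi) ^ 2)⁻¹ : ℂ) • hg.toLp g, ?_⟩
    rw [← Lp.toTemperedDistributionCLM_apply, map_sub, map_smul]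
    simp only [Lp.toTemperedDistributionCLM_apply]
    rw [← hΔ, ← hT, laplacian_eq_fourierMultiplierCLM]
    -- the Fourier multiplier `1 + |ξ|²` is `1 - (2π)⁻² Δ`
    have h1 : besselPotential E ℂ 2 T = T +
        fourierMultiplierCLM ℂ (fun x : E ↦ Complex.ofReal (‖x‖ ^ 2)) T := by
      have := fourierMultiplierCLM_sum (F := ℂ) (s := (Finset.univ : Finset (Fin 2)))
        (g := ![fun _ : E => (1 : ℂ), fun x : E ↦ Complex.ofReal (‖x‖ ^ 2)]) (by
          intro i _
          fin_cases i
          · exact (Function.HasTemperateGrowth.const 1)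
          · simp only [Fin.mk_one, Matrix.cons_val_one, Matrix.cons_val_zero]
            fun_prop)
      rw [besselPotential]
      simp only [Fin.sum_univ_two, Matrix.cons_val_zero, Matrix.cons_val_one] at this
      have h2 := congrArg (fun L => L T) this
      simp only [add_apply, fourierMultiplierCLM_const] at h2
      rw [one_smul, ContinuousLinearMap.id_apply] at h2
      rw [← h2]
      congr 2
      ext x
      norm_num
    ext ψ
    rw [h1]
    simp
  obtain ⟨v, hv⟩ := hS.fourier_memL1 (by simp; norm_num)
  have hvi : Integrable v := L1.integrable_coeFn v
  have hUc : Continuous (𝓕⁻ (v : E → ℂ)) := by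
    have : 𝓕⁻ (v : E → ℂ) = fun x => 𝓕 (v : E → ℂ) (-x) := by
      ext x; exact Real.fourierInv_eq_fourier_neg _ _
    rw [this]
    exact (VectorFourier.fourierIntegral_continuous Real.continuous_fourierChar
      (by exact continuous_inner) hvi).comp continuous_neg
  refine ⟨𝓕⁻ (v : E → ℂ), hUc, ?_⟩
  refine ae_eq_of_integral_contDiff_smul_eq (hw.locallyIntegrable one_le_two)
    hUc.locallyIntegrable fun φ hφ hφc => ?_
  have hφ₁ : HasCompactSupport (Complex.ofRealCLM ∘ φ) := hφc.comp_left rfl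
  have hφ₂ : ContDiff ℝ ∞ (Complex.ofRealCLM ∘ φ) := by fun_prop
  set ψ : 𝓢(E, ℂ) := hφ₁.toSchwartzMap hφ₂
  have hψ : ∀ x, ψ x = (φ x : ℂ) := fun x => rfl
  -- move the inverse Fourier transform from the test function to the integrable function `v`
  have h1 : T ψ = ∫ x, (𝓕⁻ ψ) x * (v : E → ℂ) x := by
    rw [← fourierInv_fourier_eq (F := 𝓢'(E, ℂ)) T, hv, fourierInv_apply,
      Lp.toTemperedDistribution_apply]
    simp only [smul_eq_mul]
  have h2 : ∫ x, (𝓕⁻ ψ) x * (v : E → ℂ) x = ∫ x, ψ x * 𝓕⁻ (v : E → ℂ) x := by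
    have := VectorFourier.integral_fourierIntegral_smul_eq_flip (L := -innerₗ E) (μ := volume)
      (ν := volume) (f := ψ) (g := (v : E → ℂ)) Real.continuous_fourierChar
      (by exact continuous_inner.neg) ψ.integrable hvi
    have hflip : (-innerₗ E).flip = -innerₗ E := by
      ext x y; simp [real_inner_comm]
    rw [hflip] at this
    simp only [smul_eq_mul] at this
    rw [SchwartzMap.fourierInv_coe]
    exact this
  rw [hTa] at h1
  simpa only [hψ, Complex.real_smul] using h1.trans h2

end Regularity

theorem dvg_smul {ρ : E → ℝ} {X : E → E} {x : E} (hρ : DifferentiableAt ℝ ρ x)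
    (hX : DifferentiableAt ℝ X x) :
    dvg (fun y => ρ y • X y) x = inner ℝ (gradient ρ x) (X x) + ρ x * dvg X x := by
  have h : fderiv ℝ (fun y => ρ y • X y) x = ρ x • fderiv ℝ X x + (fderiv ℝ ρ x).smulRight (X x) :=
    (hρ.hasFDerivAt.smul hX.hasFDerivAt).fderiv
  have hv : X x = ∑ i, X x i • EuclideanSpace.single i (1 : ℝ) := by
    ext j; simp [Finset.sum_apply, Pi.single_apply]
  rw [real_inner_comm, inner_gradient]
  conv_rhs => rw [hv, map_sum]
  simp only [dvg, h, Finset.mul_sum, ← Finset.sum_add_distrib]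
  refine Finset.sum_congr rfl fun i _ => ?_
  simp
  ring

theorem dvg_eq_zero_of_notMem_tsupport {V : E → E} {x : E} (hx : x ∉ tsupport V) :
    dvg V x = 0 := by
  have : fderiv ℝ V x = 0 :=
    image_eq_zero_of_notMem_tsupport fun h => hx (tsupport_fderiv_subset ℝ h)
  simp [dvg, this]

/-- Localization of `Δu = a`: the product of `u` with a test function `φ` satisfies
`Δ(φu) = φa + 2∇u·∇φ + uΔφ` on the whole space. -/
theorem integral_localized_laplacian {Ω : Set E} {u a : E → ℝ} {G : E → E}
    (hu : HasWeakGradient Ω u G) (ha : LocallyIntegrableOn a Ω) (h : WeakDiv Ω G a) {φ : E → ℝ}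
    (hφ : IsTest Ω φ) {ψ : E → ℝ} (hψ : ContDiff ℝ ∞ ψ) :
    ∫ x in Ω, dvg (gradient ψ) x * (φ x * u x) =
      ∫ x in Ω, ψ x * (φ x * a x + 2 * inner ℝ (G x) (gradient φ x) +
        dvg (gradient φ) x * u x) := by
  have hgψ := contDiff_gradient hψ
  have hgφ := contDiff_gradient hφ.smooth
  have s1 : tsupport (fun y => φ y • gradient ψ y) ⊆ tsupport φ := tsupport_smul_subset_left _ _
  have s2 : tsupport (fun y => ψ y • gradient φ y) ⊆ tsupport φ := by
    refine closure_minimal (fun x hx => by_contra fun h0 => hx ?_) (isClosed_tsupport φ)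
    simp [gradient_eq_zero_of_notMem_tsupport h0]
  have s3 : tsupport (fun y => φ y * ψ y) ⊆ tsupport φ := tsupport_mul_subset_left
  have c1 : ContDiff ℝ ∞ (fun y => φ y • gradient ψ y) := hφ.smooth.smul hgψ
  have c2 : ContDiff ℝ ∞ (fun y => ψ y • gradient φ y) := hψ.smul hgφ
  have k1 : HasCompactSupport (fun y => φ y • gradient ψ y) :=
    hφ.compact.of_isClosed_subset (isClosed_tsupport _) s1
  have k2 : HasCompactSupport (fun y => ψ y • gradient φ y) :=
    hφ.compact.of_isClosed_subset (isClosed_tsupport _) s2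
  have hφψ : IsTest Ω (fun y => φ y * ψ y) := ⟨hφ.smooth.mul hψ,
    hφ.compact.of_isClosed_subset (isClosed_tsupport _) s3, s3.trans hφ.subset⟩
  have dφ := hφ.differentiable
  have dψ : Differentiable ℝ ψ := hψ.differentiable (by simp)
  have dgφ : Differentiable ℝ (gradient φ) := hgφ.differentiable (by simp)
  have dgψ : Differentiable ℝ (gradient ψ) := hgψ.differentiable (by simp)
  have e1 := hu.integral_mul_dvg c1 k1 (s1.trans hφ.subset)
  have e2 := hu.integral_mul_dvg c2 k2 (s2.trans hφ.subset)
  have e3 := h _ hφψ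
  have hgr : ∀ x, gradient (fun y => φ y * ψ y) x = φ x • gradient ψ x + ψ x • gradient φ x := by
    intro x
    have hf : fderiv ℝ (fun y => φ y * ψ y) x = φ x • fderiv ℝ ψ x + ψ x • fderiv ℝ φ x :=
      ((dφ x).hasFDerivAt.mul (dψ x).hasFDerivAt).fderiv
    simp [gradient_eq_toDual_symm, hf]
  simp only [hgr, inner_add_right] at e3
  simp only [dvg_smul (dφ _) (dgψ _)] at e1
  simp only [dvg_smul (dψ _) (dgφ _), real_inner_comm (gradient φ _) (gradient ψ _)] at e2
  have i1 : IntegrableOn (fun x => inner ℝ (G x) (φ x • gradient ψ x)) Ω :=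
    (integrable_inner_of_tsupport_subset hu.2.1 c1.continuous k1 (s1.trans hφ.subset)).integrableOn
  have i2 : IntegrableOn (fun x => inner ℝ (G x) (ψ x • gradient φ x)) Ω :=
    (integrable_inner_of_tsupport_subset hu.2.1 c2.continuous k2 (s2.trans hφ.subset)).integrableOn
  have i3 : IntegrableOn (fun x => a x * (φ x * ψ x)) Ω := (hφψ.integrable_mul ha).integrableOn
  have iu : ∀ {b : E → ℝ}, Continuous b → (∀ x ∉ tsupport φ, b x = 0) →
      IntegrableOn (fun x => u x * b x) Ω := by
    intro b hb h0
    have s : tsupport b ⊆ tsupport φ :=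
      closure_minimal (fun x hx => by_contra fun hn => hx (h0 x hn)) (isClosed_tsupport φ)
    exact (integrable_mul_of_tsupport_subset hu.1 hb
      (hφ.compact.of_isClosed_subset (isClosed_tsupport _) s) (s.trans hφ.subset)).integrableOn
  have i4 : IntegrableOn (fun x => u x * inner ℝ (gradient φ x) (gradient ψ x)) Ω :=
    iu (hgφ.continuous.inner hgψ.continuous) fun x hx => by
      rw [gradient_eq_zero_of_notMem_tsupport hx, inner_zero_left]
  have i5 : IntegrableOn (fun x => u x * (φ x * dvg (gradient ψ) x)) Ω :=
    iu (hφ.smooth.continuous.mul (continuous_dvg hgψ)) fun x hx => by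
      rw [image_eq_zero_of_notMem_tsupport hx, zero_mul]
  have i6 : IntegrableOn (fun x => u x * (ψ x * dvg (gradient φ) x)) Ω :=
    iu (hψ.continuous.mul (continuous_dvg hgφ)) fun x hx => by
      rw [dvg_eq_zero_of_notMem_tsupport fun h' => hx (tsupport_gradient_subset h'), mul_zero]
  simp only [mul_add] at e1 e2
  rw [integral_add i4 i5] at e1
  rw [integral_add i4 i6] at e2
  have i12 : IntegrableOn (fun x => inner ℝ (G x) (φ x • gradient ψ x) +
      inner ℝ (G x) (ψ x • gradient φ x)) Ω := i1.add i2
  have i32 : IntegrableOn (fun x => a x * (φ x * ψ x) +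
      2 * inner ℝ (G x) (ψ x • gradient φ x)) Ω := i3.add (i2.const_mul 2)
  rw [integral_add i12 i3, integral_add i1 i2] at e3
  have r1 : ∫ x in Ω, dvg (gradient ψ) x * (φ x * u x) =
      ∫ x in Ω, u x * (φ x * dvg (gradient ψ) x) := by
    congr 1; ext x; ring
  have r2 : ∫ x in Ω, ψ x * (φ x * a x + 2 * inner ℝ (G x) (gradient φ x) +
        dvg (gradient φ) x * u x) = ∫ x in Ω, (a x * (φ x * ψ x) +
          2 * inner ℝ (G x) (ψ x • gradient φ x) + u x * (ψ x * dvg (gradient φ) x)) := by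
    congr 1; ext x; rw [real_inner_smul_right]; ring
  rw [r1, r2, integral_add i32 i6, integral_add i3 (i2.const_mul 2),
    integral_const_mul]
  linarith

section Regularity
open scoped SchwartzMap Laplacian LineDeriv

theorem contDiff_clm_schwartz (L : ℂ →L[ℝ] ℝ) (ψ : 𝓢(E, ℂ)) : ContDiff ℝ ∞ (fun x => L (ψ x)) :=
  L.contDiff.comp (ψ.smooth ⊤)

/-- The Laplacian of the real or imaginary part of a Schwartz function, as divergence of the gradient. -/
theorem clm_laplacian_schwartz (L : ℂ →L[ℝ] ℝ) (ψ : 𝓢(E, ℂ)) (x : E) :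
    L ((Δ ψ) x) = dvg (gradient (fun y => L (ψ y))) x := by
  have h1 : ∀ (χ : 𝓢(E, ℂ)) (y v : E), fderiv ℝ (fun y => L (χ y)) y v = L (fderiv ℝ χ y v) := by
    intro χ y v
    have := (L.hasFDerivAt.comp y χ.differentiableAt.hasFDerivAt).fderiv
    change fderiv ℝ (L ∘ χ) y v = _
    rw [this]; rfl
  have hg : ContDiff ℝ ∞ (gradient (fun y => L (ψ y))) :=
    contDiff_gradient (contDiff_clm_schwartz L ψ)
  rw [SchwartzMap.laplacian_eq_sum (EuclideanSpace.basisFun (Fin 3) ℝ), sum_apply,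
    map_sum, dvg]
  refine Finset.sum_congr rfl fun i _ => ?_
  set e : E := EuclideanSpace.single i 1
  have he : EuclideanSpace.basisFun (Fin 3) ℝ i = e := by simp [e]
  rw [he, SchwartzMap.lineDerivOp_apply_eq_fderiv, ← h1]
  have h2 : (fun y => L ((∂_{e} ψ) y)) = fun y => gradient (fun y => L (ψ y)) y i := by
    ext y
    rw [SchwartzMap.lineDerivOp_apply_eq_fderiv, ← h1, ← inner_gradient]
    simp only [e, EuclideanSpace.inner_single_left, map_one, one_mul]
  rw [h2]
  have h3 := ((EuclideanSpace.proj (𝕜 := ℝ) i).hasFDerivAt.comp x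
    (hg.differentiable (by simp) x).hasFDerivAt).fderiv
  change fderiv ℝ (EuclideanSpace.proj (𝕜 := ℝ) i ∘ gradient (fun y => L (ψ y))) x e = _
  rw [h3]; rfl

end Regularity

theorem memLp_of_eq_zero_of_notMem {F : Type*} [NormedAddCommGroup F] {Ω : Set E}
    (hΩ : MeasurableSet Ω) {f : E → F} {p : ℝ≥0∞} (h : MemLp f p (volume.restrict Ω))
    (h0 : ∀ x ∉ Ω, f x = 0) : MemLp f p := by
  have : Ω.indicator f = f := Set.indicator_eq_self.2 fun x hx => by_contra fun h' => hx (h0 x h')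
  rw [← this]
  exact (memLp_indicator_iff_restrict hΩ).2 h

theorem memLp_mul_of_bounded {Ω : Set E} {b f : E → ℝ} (hb : Continuous b)
    (hc : HasCompactSupport b) (hf : MemLp f 2 (volume.restrict Ω)) :
    MemLp (fun x => b x * f x) 2 (volume.restrict Ω) := by
  obtain ⟨C, hC⟩ := hb.bounded_above_of_compact_support hc
  refine (hf.norm.const_mul C).mono' (hb.aestronglyMeasurable.mul hf.1) (ae_of_all _ fun x => ?_)
  rw [norm_mul]
  gcongr
  exact hC x

/-- Local elliptic regularity: if `Δu = a` with `a` square integrable, then `φu` is continuous up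
to a null set for every test function `φ`. -/
theorem exists_continuous_localized {Ω : Set E} (hΩ : IsOpen Ω) {u a : E → ℝ} {G : E → E}
    (hu : IsH1 Ω u G) (ha : MemLp a 2 (volume.restrict Ω)) (h : WeakDiv Ω G a) {φ : E → ℝ}
    (hφ : IsTest Ω φ) : ∃ w : E → ℝ, Continuous w ∧ (fun x => φ x * u x) =ᵐ[volume] w := by
  have hgφ := contDiff_gradient hφ.smooth
  have hsΔ : tsupport (dvg (gradient φ)) ⊆ tsupport φ :=
    closure_minimal (fun x hx => by_contra fun h0 => hx (dvg_eq_zero_of_notMem_tsupport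
      fun h' => h0 (tsupport_gradient_subset h'))) (isClosed_tsupport φ)
  set g : E → ℝ := fun x => φ x * a x + 2 * inner ℝ (G x) (gradient φ x) +
    dvg (gradient φ) x * u x with hg
  have hw2 : MemLp (fun x => φ x * u x) 2 := by
    refine memLp_of_eq_zero_of_notMem hΩ.measurableSet
      (memLp_mul_of_bounded hφ.smooth.continuous hφ.compact hu.2.1) fun x hx => ?_
    rw [hφ.eq_zero hx, zero_mul]
  have hg2 : MemLp g 2 := by
    refine memLp_of_eq_zero_of_notMem hΩ.measurableSet ?_ fun x hx => ?_
    · refine ((memLp_mul_of_bounded hφ.smooth.continuous hφ.compact ha).add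
        (MemLp.const_mul ?_ 2)).add (memLp_mul_of_bounded (continuous_dvg hgφ)
          (hφ.compact.of_isClosed_subset (isClosed_tsupport _) hsΔ) hu.2.1)
      obtain ⟨C, hC⟩ := hgφ.continuous.bounded_above_of_compact_support hφ.compact_gradient
      refine (hu.2.2.norm.mul_const C).mono' (hu.2.2.1.inner hgφ.continuous.aestronglyMeasurable)
        (ae_of_all _ fun x => ?_)
      exact (norm_inner_le_norm _ _).trans (by gcongr; exact hC x)
    · rw [hg]
      simp [hφ.eq_zero hx, hφ.gradient_eq_zero hx,
        dvg_eq_zero_of_notMem_tsupport fun h' => hx (hφ.subset (tsupport_gradient_subset h'))]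
  have key : ∀ {ψ : E → ℝ}, ContDiff ℝ ∞ ψ →
      ∫ x, dvg (gradient ψ) x * (φ x * u x) = ∫ x, ψ x * g x := by
    intro ψ hψ
    have := integral_localized_laplacian hu.1 (locallyIntegrableOn_of_memLp_two ha) h hφ hψ
    rw [setIntegral_eq_integral_of_forall_compl_eq_zero,
      setIntegral_eq_integral_of_forall_compl_eq_zero] at this
    · exact this
    · intro x hx
      simp [hφ.eq_zero hx, hφ.gradient_eq_zero hx,
        dvg_eq_zero_of_notMem_tsupport fun h' => hx (hφ.subset (tsupport_gradient_subset h'))]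
    · intro x hx
      simp [hφ.eq_zero hx]
  obtain ⟨U, hU, hwU⟩ := exists_continuous_ae_eq_of_laplacian_memLp hw2.ofReal hg2.ofReal (by
    intro ψ
    have hint : ∀ (χ : SchwartzMap E ℂ) {f : E → ℝ}, MemLp f 2 →
        Integrable (fun x => χ x * (f x : ℂ)) := fun χ f hf =>
      MemLp.integrable_mul (χ.memLp 2) hf.ofReal
    -- the identity is known for real test functions only: apply it to real and imaginary parts
    have hL : ∀ (L : ℂ →L[ℝ] ℝ), (∀ (z : ℂ) (r : ℝ), L (z * r) = L z * r) →
        L (∫ x, (Laplacian.laplacian ψ) x * ((φ x * u x : ℝ) : ℂ)) =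
          L (∫ x, ψ x * (g x : ℂ)) := by
      intro L hLr
      rw [← L.integral_comp_comm (hint _ hw2), ← L.integral_comp_comm (hint _ hg2)]
      simp only [hLr, clm_laplacian_schwartz]
      exact key (contDiff_clm_schwartz L ψ)
    exact Complex.ext (hL Complex.reCLM fun z r => by simp) (hL Complex.imCLM fun z r => by simp))
  refine ⟨fun x => (U x).re, Complex.continuous_re.comp hU, ?_⟩
  filter_upwards [hwU] with x hx
  rw [← hx]; simp

/-- These cut-offs, supported in `M₁`, equal `1` on balls that exhaust `M₁`. -/
theorem isTest_radialStep {m : ℕ} (hm : 1 ≤ m) : IsTest M₁ (radialStep (-(m : ℝ)) (4 * m - 1)) := by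
  have hm' : (1 : ℝ) ≤ m := by exact_mod_cast hm
  have hts : tsupport (radialStep (-(m : ℝ)) (4 * m - 1)) ⊆ M₁ := by
    refine (tsupport_radialStep_subset _ _).trans fun x hx => ?_
    have hx' : 0 ≤ -(m : ℝ) * ‖x‖ ^ 2 + (4 * m - 1) := hx
    simp only [M₁, mem_ball_zero_iff]
    by_contra! hle
    have h4 : 0 ≤ ‖x‖ ^ 2 - 4 := by nlinarith
    nlinarith
  refine ⟨contDiff_radialStep _ _, ?_, hts⟩
  exact Metric.isCompact_of_isClosed_isBounded (isClosed_tsupport _)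
    (Metric.isBounded_ball.subset hts)

/-- Elliptic regularity on `M₁`: an `H¹` function with square integrable Laplacian is continuous up
to a null set. -/
theorem exists_continuousOn_of_weakDiv {u a : E → ℝ} {G : E → E} (hu : IsH1 M₁ u G)
    (ha : MemLp a 2 (volume.restrict M₁)) (h : WeakDiv M₁ G a) :
    ∃ U : E → ℝ, ContinuousOn U M₁ ∧ ∀ᵐ x ∂volume.restrict M₁, U x = u x := by
  -- patch the continuous representatives of `χ m * u`, which agree where both cut-offs are `1`
  set χ : ℕ → E → ℝ := fun m => radialStep (-((m + 1 : ℕ) : ℝ)) (4 * (m + 1 : ℕ) - 1) with hχ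
  have hloc : ∀ m : ℕ, ∃ w : E → ℝ, Continuous w ∧ (fun x => χ m x * u x) =ᵐ[volume] w := fun m =>
    exists_continuous_localized Metric.isOpen_ball hu ha h (isTest_radialStep (by omega))
  choose w hwc hw using hloc
  set B : ℕ → Set E := fun m => {x | 2 < ((m + 1 : ℕ) : ℝ) * (4 - ‖x‖ ^ 2)} with hB
  have hBo : ∀ m, IsOpen (B m) := fun m => isOpen_lt continuous_const (by fun_prop)
  have hχ1 : ∀ m, ∀ x ∈ B m, χ m x = 1 := by
    intro m x hx
    have hx' : 2 < ((m + 1 : ℕ) : ℝ) * (4 - ‖x‖ ^ 2) := hx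
    exact Real.smoothTransition.one_of_one_le (by linarith)
  have hex : ∀ x ∈ M₁, ∃ m, x ∈ B m := by
    intro x hx
    have hx2 : ‖x‖ < 2 := by simpa [M₁] using hx
    have hpos : 0 < 4 - ‖x‖ ^ 2 := by nlinarith [norm_nonneg x]
    obtain ⟨m, hm⟩ := exists_nat_gt (2 / (4 - ‖x‖ ^ 2))
    refine ⟨m, ?_⟩
    change 2 < ((m + 1 : ℕ) : ℝ) * (4 - ‖x‖ ^ 2)
    rw [div_lt_iff₀ hpos] at hm
    push_cast
    linarith
  have hagree : ∀ m n, ∀ x ∈ B m ∩ B n, w m x = w n x := by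
    intro m n
    refine Measure.eqOn_open_of_ae_eq (μ := volume) ?_ ((hBo m).inter (hBo n))
      (hwc m).continuousOn (hwc n).continuousOn
    filter_upwards [ae_restrict_of_ae (hw m), ae_restrict_of_ae (hw n),
      ae_restrict_mem ((hBo m).inter (hBo n)).measurableSet] with x h1 h2 h3
    rw [← h1, ← h2, hχ1 m x h3.1, hχ1 n x h3.2]
  classical
  set U : E → ℝ := fun x => if hx : ∃ m, x ∈ B m then w hx.choose x else 0 with hU
  have hUw : ∀ m, ∀ x ∈ B m, U x = w m x := by
    intro m x hx
    have hx' : ∃ m, x ∈ B m := ⟨m, hx⟩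
    rw [hU]
    simp only [dif_pos hx']
    exact hagree _ _ x ⟨hx'.choose_spec, hx⟩
  refine ⟨U, fun x hx => ?_, ?_⟩
  · obtain ⟨m, hm⟩ := hex x hx
    refine ((hwc m).continuousAt.congr ?_).continuousWithinAt
    filter_upwards [(hBo m).mem_nhds hm] with z hz
    exact (hUw m z hz).symm
  · filter_upwards [ae_restrict_of_ae (ae_all_iff.2 hw), ae_restrict_mem
      (Metric.isOpen_ball (x := (0 : E)) (ε := 2)).measurableSet] with x h1 hx
    obtain ⟨m, hm⟩ := hex x hx
    rw [hUw m x hm, ← h1 m, hχ1 m x hm, one_mul]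

/-! ### The Helmholtz equation as a divergence equation -/

/-- `(Δ + k²)u = f` with `∇u = G` means `div G = f - k²u`. -/
theorem isHelmholtzSolution_iff {Ω : Set E} {k : ℝ} {f u : E → ℝ} {G : E → E}
    (hf : MemLp f 2 (volume.restrict Ω)) :
    IsHelmholtzSolution Ω k f u G ↔ IsH1 Ω u G ∧ WeakDiv Ω G (fun x => f x - k ^ 2 * u x) := by
  refine and_congr_right fun hu => ?_
  have key : ∀ φ, IsTest Ω φ → ∫ x in Ω, (inner ℝ (G x) (gradient φ x) +
      (f x - k ^ 2 * u x) * φ x) = (∫ x in Ω, f x * φ x) -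
        ∫ x in Ω, (-inner ℝ (G x) (gradient φ x) + k ^ 2 * u x * φ x) := by
    intro φ hφ
    have i1 := hφ.integrable_inner_gradient hu.1.2.1
    have i2 : Integrable (fun x => k ^ 2 * u x * φ x) :=
      hφ.integrable_mul (locallyIntegrableOn_of_memLp_two (hu.2.1.const_mul (k ^ 2)))
    have i3 := hφ.integrable_mul (locallyIntegrableOn_of_memLp_two hf)
    have i4 : Integrable (fun x => -inner ℝ (G x) (gradient φ x) + k ^ 2 * u x * φ x) :=
      i1.neg.add i2
    rw [← integral_sub i3.integrableOn i4.integrableOn]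
    congr 1; ext x
    ring
  constructor
  · intro h φ hφ
    rw [key φ hφ, h φ hφ.smooth hφ.compact hφ.subset, sub_self]
  · intro h φ h1 h2 h3
    have := h φ ⟨h1, h2, h3⟩
    rw [key φ ⟨h1, h2, h3⟩] at this
    linarith

/-! ### Gluing along disjoint open sets -/

theorem locallyIntegrableOn_union {F : Type*} [NormedAddCommGroup F] {Ω₁ Ω₂ : Set E}
    (h1 : IsOpen Ω₁) (h2 : IsOpen Ω₂) {a : E → F} (ha : LocallyIntegrableOn a Ω₁)
    (ha' : LocallyIntegrableOn a Ω₂) : LocallyIntegrableOn a (Ω₁ ∪ Ω₂) := by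
  rintro x (hx | hx)
  · have := ha x hx
    rw [h1.nhdsWithin_eq hx] at this
    exact this.filter_mono nhdsWithin_le_nhds
  · have := ha' x hx
    rw [h2.nhdsWithin_eq hx] at this
    exact this.filter_mono nhdsWithin_le_nhds

/-- A test function on a disjoint union of open sets splits into test functions on the pieces. -/
theorem IsTest.indicator {Ω₁ Ω₂ : Set E} (h1 : IsOpen Ω₁) (h2 : IsOpen Ω₂)
    (hd : Disjoint Ω₁ Ω₂) {φ : E → ℝ} (hφ : IsTest (Ω₁ ∪ Ω₂) φ) :
    IsTest Ω₁ (Ω₁.indicator φ) := by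
  set K := tsupport φ \ Ω₂
  have hK : IsClosed K := (isClosed_tsupport φ).sdiff h2
  have hKs : K ⊆ Ω₁ := fun x hx => (hφ.subset hx.1).resolve_right hx.2
  have h0 : ∀ x ∉ K, Ω₁.indicator φ x = 0 := by
    intro x hx
    by_cases hxΩ : x ∈ Ω₁
    · rw [Set.indicator_of_mem hxΩ]
      exact image_eq_zero_of_notMem_tsupport fun h => hx ⟨h, Set.disjoint_left.1 hd hxΩ⟩
    · exact Set.indicator_of_notMem hxΩ _
  have hts : tsupport (Ω₁.indicator φ) ⊆ K :=
    closure_minimal (fun x hx => by_contra fun h => hx (h0 x h)) hK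
  refine ⟨contDiff_of_contDiffOn_of_eq_zero h1 hK hKs
    (hφ.smooth.contDiffOn.congr fun x hx => Set.indicator_of_mem hx _) h0, ?_, hts.trans hKs⟩
  exact hφ.compact.of_isClosed_subset (isClosed_tsupport _) (hts.trans Set.sdiff_subset)

theorem WeakDiv.union {Ω₁ Ω₂ : Set E} (h1 : IsOpen Ω₁) (h2 : IsOpen Ω₂) (hd : Disjoint Ω₁ Ω₂)
    {B : E → E} {a : E → ℝ} (hB : LocallyIntegrableOn B (Ω₁ ∪ Ω₂))
    (ha : LocallyIntegrableOn a (Ω₁ ∪ Ω₂)) (H₁ : WeakDiv Ω₁ B a) (H₂ : WeakDiv Ω₂ B a) :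
    WeakDiv (Ω₁ ∪ Ω₂) B a := by
  have piece : ∀ {Ω Ω' : Set E} {φ : E → ℝ}, IsOpen Ω → IsOpen Ω' → Disjoint Ω Ω' →
      WeakDiv Ω B a → IsTest (Ω ∪ Ω') φ →
      ∫ x in Ω, (inner ℝ (B x) (gradient φ x) + a x * φ x) = 0 := by
    intro Ω Ω' φ h h' hd H hφ
    rw [← H _ (hφ.indicator h h' hd)]
    refine setIntegral_congr_fun h.measurableSet fun x hx => ?_
    simp only [gradient_congr_of_isOpen h (fun z hz => Set.indicator_of_mem hz φ) hx,
      Set.indicator_of_mem hx]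
  intro φ hφ
  have hi : IntegrableOn (fun x => inner ℝ (B x) (gradient φ x) + a x * φ x) (Ω₁ ∪ Ω₂) :=
    ((hφ.integrable_inner_gradient hB).add (hφ.integrable_mul ha)).integrableOn
  rw [setIntegral_union hd h2.measurableSet (hi.mono_set Set.subset_union_left)
    (hi.mono_set Set.subset_union_right), piece h1 h2 hd H₁ hφ,
    piece h2 h1 hd.symm H₂ (Set.union_comm _ _ ▸ hφ), add_zero]

theorem HasWeakGradient.union {Ω₁ Ω₂ : Set E} (h1 : IsOpen Ω₁) (h2 : IsOpen Ω₂)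
    (hd : Disjoint Ω₁ Ω₂) {u : E → ℝ} {G : E → E} (H₁ : HasWeakGradient Ω₁ u G)
    (H₂ : HasWeakGradient Ω₂ u G) : HasWeakGradient (Ω₁ ∪ Ω₂) u G := by
  have hu := locallyIntegrableOn_union h1 h2 H₁.1 H₂.1
  have hG := locallyIntegrableOn_union h1 h2 H₁.2.1 H₂.2.1
  exact (hasWeakGradient_iff hu hG).2 fun e => WeakDiv.union h1 h2 hd
    (locallyIntegrableOn_smul_const hu e) (locallyIntegrableOn_inner_const hG e)
    (H₁.weakDiv e) (H₂.weakDiv e)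

theorem isOpen_M₂ : IsOpen M₂ := Metric.isOpen_ball

theorem memLp_two_union {F : Type*} [NormedAddCommGroup F] {s t : Set E} {a : E → F}
    (hs : MemLp a 2 (volume.restrict s)) (ht : MemLp a 2 (volume.restrict t)) :
    MemLp a 2 (volume.restrict (s ∪ t)) := by
  have hm : AEStronglyMeasurable a (volume.restrict (s ∪ t)) :=
    aestronglyMeasurable_union_iff.2 ⟨hs.1, ht.1⟩
  rw [memLp_two_iff_integrable_sq_norm hm]
  exact IntegrableOn.union ((memLp_two_iff_integrable_sq_norm hs.1).1 hs)
    ((memLp_two_iff_integrable_sq_norm ht.1).1 ht)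

/-- A compact subset of `N \ Σ` splits into compact subsets of `N₁` and `M₂`. -/
theorem isH1Loc_of_pieces {u : E → ℝ} {G : E → E} (H₁ : IsH1Loc N₁ u G) (H₂ : IsH1Loc M₂ u G) :
    IsH1Loc (N \ surf) u G := by
  rw [N_diff_surf]
  refine ⟨H₁.1.union isOpen_N₁ isOpen_M₂ disjoint_N₁_M₂ H₂.1, fun K hc hK => ?_⟩
  have c1 : IsCompact (K \ M₂) := hc.diff isOpen_M₂
  have c2 : IsCompact (K \ N₁) := hc.diff isOpen_N₁
  have s1 : K \ M₂ ⊆ N₁ := fun x hx => (hK hx.1).resolve_right hx.2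
  have s2 : K \ N₁ ⊆ M₂ := fun x hx => (hK hx.1).resolve_left hx.2
  have hKu : K ⊆ K \ M₂ ∪ K \ N₁ := fun x hx => by
    by_cases h : x ∈ M₂
    · exact Or.inr ⟨hx, fun h' => Set.disjoint_left.1 disjoint_N₁_M₂ h' h⟩
    · exact Or.inl ⟨hx, h⟩
  have hle := Measure.restrict_mono hKu (le_refl (volume : Measure E))
  obtain ⟨a1, b1⟩ := H₁.2 _ c1 s1
  obtain ⟨a2, b2⟩ := H₂.2 _ c2 s2
  exact ⟨(memLp_two_union a1 a2).mono_measure hle, (memLp_two_union b1 b2).mono_measure hle⟩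

/-! ### Solutions on the device and on its two pieces -/

theorem integrableOn_punctured_iff {F : Type*} [NormedAddCommGroup F] {a : E → F} :
    IntegrableOn a (M₁ \ {0}) ↔ IntegrableOn a M₁ := by
  rw [IntegrableOn, IntegrableOn, volume_restrict_punctured]

/-- The pair `(u, G)` on the punctured ball `M₁ \ {0}` is the pull-back under `F₁` of the function
`v` and the covector field `V` on `N₁`. -/
structure IsPullback (u : E → ℝ) (G : E → E) (v : E → ℝ) (V : E → E) : Prop where
  fn : ∀ x ∈ M₁ \ {0}, u x = v (F₁ x)
  field : ∀ y ∈ N₁, (fderiv ℝ F₁ (Finv y)).adjoint (V y) = G (Finv y)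

namespace IsPullback

variable {u v : E → ℝ} {G V : E → E}

theorem fn_Finv (h : IsPullback u G v V) {y : E} (hy : y ∈ N₁) : u (Finv y) = v y := by
  rw [h.fn _ (diffeo_N₁.mapsTo_symm hy), diffeo_N₁.right_inv hy]

/-- The flux is the Piola transform of the pulled back gradient. -/
theorem flux_eq (h : IsPullback u G v V) {y : E} (hy : y ∈ N₁) :
    flux V y = |(fderiv ℝ Finv y).det| • fderiv ℝ F₁ (Finv y) (G (Finv y)) := by
  rw [flux_of_mem_N₁ hy, h.field y hy]

theorem inner_flux (h : IsPullback u G v V) {ψ : E → ℝ} (hψ : ContDiff ℝ ∞ ψ) {y : E}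
    (hy : y ∈ N₁) : inner ℝ (flux V y) (gradient ψ y) = |(fderiv ℝ Finv y).det| •
      inner ℝ (G (Finv y)) (gradient (fun x => ψ (F₁ x)) (Finv y)) := by
  rw [h.flux_eq hy, real_inner_smul_left, smul_eq_mul, inner_gradient, inner_gradient,
    diffeo_N₁.fderiv_comp_apply (diffeo_N₁.mapsTo_symm hy) (hψ.differentiable (by simp) _),
    diffeo_N₁.right_inv hy]

/-- The energy on `N₁` is the Dirichlet energy of the pull-back. -/
theorem integrableOn_energyDensity_iff (h : IsPullback u G v V) :
    IntegrableOn (energyDensity V) N₁ ↔ IntegrableOn (fun x => ‖G x‖ ^ 2) M₁ := by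
  rw [← integrableOn_punctured_iff, diffeo_N₁.symm.integrableOn_target_iff]
  refine integrableOn_congr_fun (fun y hy => ?_) isOpen_N₁.measurableSet
  rw [energyDensity_of_mem_N₁ hy, h.field y hy, smul_eq_mul]

theorem integrableOn_sq_iff (h : IsPullback u G v V) :
    IntegrableOn (fun y => sqrtDet y * v y ^ 2) N₁ ↔ IntegrableOn (fun x => u x ^ 2) M₁ := by
  rw [← integrableOn_punctured_iff, diffeo_N₁.symm.integrableOn_target_iff]
  refine integrableOn_congr_fun (fun y hy => ?_) isOpen_N₁.measurableSet
  rw [sqrtDet_eq, smul_eq_mul, h.fn_Finv hy]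

/-- The flux is integrable up to the cloaking surface because `‖DF₁(x)‖` is of order `1/‖x‖`, which
is square integrable in dimension three. -/
theorem integrableOn_flux (h : IsPullback u G v V) (hG : MemLp G 2 (volume.restrict M₁)) :
    IntegrableOn (flux V) N₁ := by
  have key : IntegrableOn (fun x => fderiv ℝ F₁ x (G x)) (M₁ \ {0}) := by
    rw [IntegrableOn, volume_restrict_punctured]
    have hm : AEStronglyMeasurable (fderiv ℝ F₁) (volume.restrict M₁) := by
      rw [← volume_restrict_punctured]
      exact diffeo_N₁.continuousOn_fderiv.aestronglyMeasurable isOpen_punctured.measurableSet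
    refine ((integrable_mul_norm_inv hG).const_mul 3).mono'
      (aestronglyMeasurable_clm_apply hm hG.1) ?_
    filter_upwards [ae_mem_punctured] with x hx
    calc ‖fderiv ℝ F₁ x (G x)‖ ≤ ‖fderiv ℝ F₁ x‖ * ‖G x‖ := ContinuousLinearMap.le_opNorm _ _
      _ ≤ 3 * ‖x‖⁻¹ * ‖G x‖ := by gcongr; exact norm_fderiv_F₁_le hx
      _ = 3 * (‖G x‖ * ‖x‖⁻¹) := by ring
  refine ((diffeo_N₁.symm.integrableOn_target_iff _).1 key).congr_fun (fun y hy => ?_)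
    isOpen_N₁.measurableSet
  exact (h.flux_eq hy).symm

end IsPullback

theorem measurable_sqrtDet : Measurable sqrtDet := by
  have : sqrtDet = fun y => |(fderiv ℝ Finv y).det| := funext sqrtDet_eq
  rw [this]
  exact ContinuousLinearMap.continuous_det.abs.measurable.comp (measurable_fderiv ℝ Finv)

/-- Square integrability on `N` with the weight `|g̃|^{1/2}` splits over `M₁` and `M₂`. -/
theorem memLp_N_iff {u v : E → ℝ} {G V : E → E} (h : IsPullback u G v V) (hu : Measurable u)
    (hv : Measurable v) :
    MemLp v 2 ((volume.restrict N).withDensity fun x => ENNReal.ofReal (sqrtDet x)) ↔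
      MemLp u 2 (volume.restrict M₁) ∧ MemLp v 2 (volume.restrict M₂) := by
  rw [memLp_two_iff_integrable_sq hv.aestronglyMeasurable,
    memLp_two_iff_integrable_sq hv.aestronglyMeasurable,
    memLp_two_iff_integrable_sq hu.aestronglyMeasurable,
    integrable_withDensity_iff_integrable_smul' measurable_sqrtDet.ennreal_ofReal
      (ae_of_all _ fun _ => ENNReal.ofReal_lt_top), volume_restrict_N]
  have e : ∀ y, (ENNReal.ofReal (sqrtDet y)).toReal • v y ^ 2 = sqrtDet y * v y ^ 2 := fun y => by
    rw [ENNReal.toReal_ofReal (by rw [sqrtDet]; positivity), smul_eq_mul]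
  simp only [e]
  change IntegrableOn (fun y => sqrtDet y * v y ^ 2) (N₁ ∪ M₂) ↔ _ ∧ _
  rw [integrableOn_union, h.integrableOn_sq_iff]
  refine and_congr_right fun _ => integrableOn_congr_fun (fun y hy => ?_) isOpen_M₂.measurableSet
  rw [sqrtDet_of_mem_M₂ hy, one_mul]

/-- Finiteness of the energy on `N` splits over `M₁` and `M₂`. -/
theorem integrableOn_energyDensity_iff {u v : E → ℝ} {G V : E → E} (h : IsPullback u G v V)
    (hG : AEStronglyMeasurable G (volume.restrict M₁))
    (hV : AEStronglyMeasurable V (volume.restrict M₂)) :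
    IntegrableOn (energyDensity V) (N \ surf) ↔
      MemLp G 2 (volume.restrict M₁) ∧ MemLp V 2 (volume.restrict M₂) := by
  rw [N_diff_surf, integrableOn_union, h.integrableOn_energyDensity_iff,
    memLp_two_iff_integrable_sq_norm hG, memLp_two_iff_integrable_sq_norm hV]
  exact and_congr_right fun _ => integrableOn_congr_fun
    (fun y hy => energyDensity_of_mem_M₂ hy V) isOpen_M₂.measurableSet

theorem integrable_of_memLp_M₂ {F : Type*} [NormedAddCommGroup F] {a : E → F}
    (ha : MemLp a 2 (volume.restrict M₂)) : Integrable a (volume.restrict M₂) := by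
  have : IsFiniteMeasure (volume.restrict M₂) := ⟨by
    rw [Measure.restrict_apply_univ]; exact measure_ball_lt_top⟩
  exact ha.integrable one_le_two

theorem integrable_inner_smooth_M₂ {F : Type*} [NormedAddCommGroup F] [InnerProductSpace ℝ F]
    {V : E → F} {W : E → F} (hV : MemLp V 2 (volume.restrict M₂)) (hW : Continuous W) :
    Integrable (fun x => inner ℝ (V x) (W x)) (volume.restrict M₂) := by
  obtain ⟨C, hC⟩ := (isCompact_closedBall (0 : E) 1).exists_bound_of_continuousOn hW.continuousOn
  refine ((integrable_of_memLp_M₂ hV).norm.mul_const C).mono' (hV.1.inner hW.aestronglyMeasurable) ?_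
  filter_upwards [ae_restrict_mem isOpen_M₂.measurableSet] with x hx
  refine (norm_inner_le_norm _ _).trans ?_
  gcongr
  exact hC x (Metric.ball_subset_closedBall hx)

theorem integrable_mul_smooth_M₂ {a ψ : E → ℝ} (ha : MemLp a 2 (volume.restrict M₂))
    (hψ : Continuous ψ) : Integrable (fun x => a x * ψ x) (volume.restrict M₂) := by
  simpa [mul_comm] using integrable_inner_smooth_M₂ ha hψ

/-! ### The weak equation on the device -/

/-- Continuation of `φ` from `M₂` to a smooth function that vanishes on the outer boundary. -/
theorem exists_contDiff_eqOn_M₂ {φ : E → ℝ} (hφ : ContDiff ℝ ∞ φ) :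
    ∃ ψ : E → ℝ, ContDiff ℝ ∞ ψ ∧ (∀ x ∈ outerBdry, ψ x = 0) ∧ ∀ x ∈ M₂, ψ x = φ x := by
  -- the cut-off is a smooth step in `3 - |x|²`, so it is `1` for `|x| ≤ 1` and `0` for `|x| = 2`
  refine ⟨fun x => radialStep (-1) 3 x * φ x, (contDiff_radialStep _ _).mul hφ, fun x hx => ?_,
    fun x hx => ?_⟩
  · have h2 : ‖x‖ = 2 := by simpa [outerBdry] using hx
    change Real.smoothTransition _ * φ x = 0
    rw [Real.smoothTransition.zero_of_nonpos (by rw [h2]; norm_num), zero_mul]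
  · have h1 : ‖x‖ < 1 := by simpa [M₂] using hx
    change Real.smoothTransition _ * φ x = φ x
    rw [Real.smoothTransition.one_of_one_le (by nlinarith [norm_nonneg x]), one_mul]

section WeakEquation

variable {k : ℝ} {u v f g : E → ℝ} {G V : E → E}

/-- The weak equation on `N`, tested with `ψ`, is the sum of an equation on `M₁` tested with
`ψ ∘ F₁` and an equation on `M₂` tested with `ψ`. -/
theorem weakEquation_iff (h : IsPullback u G v V) (hfg : ∀ x ∈ M₁ \ {0}, f x = g (F₁ x))
    (hu : MemLp u 2 (volume.restrict M₁)) (hG : MemLp G 2 (volume.restrict M₁))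
    (hf : MemLp f 2 (volume.restrict M₁)) (hv : MemLp v 2 (volume.restrict M₂))
    (hV : MemLp V 2 (volume.restrict M₂)) (hg : MemLp g 2 (volume.restrict M₂))
    {ψ : E → ℝ} (hψ : ContDiff ℝ ∞ ψ) (h0 : ∀ x ∈ outerBdry, ψ x = 0) :
    (∫ x in N, (-inner ℝ (flux V x) (gradient ψ x) + k ^ 2 * v x * ψ x * sqrtDet x) =
        ∫ x in N, g x * ψ x * sqrtDet x) ↔
      (∫ x in M₁, (inner ℝ (G x) (gradient (fun z => ψ (F₁ z)) x) +
        (f x - k ^ 2 * u x) * ψ (F₁ x))) +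
      ∫ x in M₂, (inner ℝ (V x) (gradient ψ x) + (g x - k ^ 2 * v x) * ψ x) = 0 := by
  obtain ⟨C, hC⟩ := exists_isSingularTest_comp_F₁ hψ h0
  have hgF : ∀ y ∈ N₁, f (Finv y) = g y := fun y hy => by
    rw [hfg _ (diffeo_N₁.mapsTo_symm hy), diffeo_N₁.right_inv hy]
  have pull : ∀ {a : E → ℝ} {b : E → ℝ}, Integrable a (volume.restrict M₁) →
      (∀ y ∈ N₁, |(fderiv ℝ Finv y).det| • a (Finv y) = b y) → IntegrableOn b N₁ := by
    intro a b ha hab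
    rw [← volume_restrict_punctured] at ha
    exact ((diffeo_N₁.symm.integrableOn_target_iff a).1 ha).congr_fun hab isOpen_N₁.measurableSet
  have i1 : IntegrableOn (fun x => inner ℝ (flux V x) (gradient ψ x)) (N₁ ∪ M₂) := by
    refine (pull (hC.integrable_inner hG) fun y hy => (h.inner_flux hψ hy).symm).union ?_
    refine IntegrableOn.congr_fun (integrable_inner_smooth_M₂ hV (contDiff_gradient hψ).continuous)
      (fun x hx => ?_) isOpen_M₂.measurableSet
    rw [flux_of_mem_M₂ hx]
  have i2 : IntegrableOn (fun x => k ^ 2 * v x * ψ x * sqrtDet x) (N₁ ∪ M₂) := by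
    refine (pull (hC.integrable_mul (hu.const_mul (k ^ 2))) fun y hy => ?_).union ?_
    · rw [h.fn_Finv hy, diffeo_N₁.right_inv hy, sqrtDet_eq, smul_eq_mul]; ring
    · refine IntegrableOn.congr_fun (integrable_mul_smooth_M₂ (hv.const_mul (k ^ 2)) hψ.continuous)
        (fun x hx => ?_) isOpen_M₂.measurableSet
      rw [sqrtDet_of_mem_M₂ hx, mul_one]
  have i3 : IntegrableOn (fun x => g x * ψ x * sqrtDet x) (N₁ ∪ M₂) := by
    refine (pull (hC.integrable_mul hf) fun y hy => ?_).union ?_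
    · rw [hgF y hy, diffeo_N₁.right_inv hy, sqrtDet_eq, smul_eq_mul]; ring
    · refine IntegrableOn.congr_fun (integrable_mul_smooth_M₂ hg hψ.continuous)
        (fun x hx => ?_) isOpen_M₂.measurableSet
      rw [sqrtDet_of_mem_M₂ hx, mul_one]
  have i4 : IntegrableOn (fun x => -inner ℝ (flux V x) (gradient ψ x) +
      k ^ 2 * v x * ψ x * sqrtDet x) (N₁ ∪ M₂) := i1.neg.add i2
  have i5 : IntegrableOn (fun x => g x * ψ x * sqrtDet x - (-inner ℝ (flux V x) (gradient ψ x) +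
      k ^ 2 * v x * ψ x * sqrtDet x)) (N₁ ∪ M₂) := i3.sub i4
  rw [eq_comm, ← sub_eq_zero, volume_restrict_N, ← integral_sub i3 i4,
    setIntegral_union disjoint_N₁_M₂ isOpen_M₂.measurableSet
      (i5.mono_set Set.subset_union_left) (i5.mono_set Set.subset_union_right)]
  have e1 : ∫ x in N₁, (g x * ψ x * sqrtDet x - (-inner ℝ (flux V x) (gradient ψ x) +
      k ^ 2 * v x * ψ x * sqrtDet x)) = ∫ x in M₁, (inner ℝ (G x)
        (gradient (fun z => ψ (F₁ z)) x) + (f x - k ^ 2 * u x) * ψ (F₁ x)) := by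
    rw [← volume_restrict_punctured, diffeo_N₁.symm.integral_target]
    refine setIntegral_congr_fun isOpen_N₁.measurableSet fun y hy => ?_
    simp only [h.inner_flux hψ hy, h.fn_Finv hy, hgF y hy, diffeo_N₁.right_inv hy, sqrtDet_eq,
      smul_eq_mul]
    ring
  have e2 : ∫ x in M₂, (g x * ψ x * sqrtDet x - (-inner ℝ (flux V x) (gradient ψ x) +
      k ^ 2 * v x * ψ x * sqrtDet x)) =
        ∫ x in M₂, (inner ℝ (V x) (gradient ψ x) + (g x - k ^ 2 * v x) * ψ x) := by
    refine setIntegral_congr_fun isOpen_M₂.measurableSet fun x hx => ?_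
    simp only [flux_of_mem_M₂ hx, sqrtDet_of_mem_M₂ hx]
    ring
  rw [e1, e2]

/-- The weak equation on `N` decouples: it holds for all test functions on `N` if and only if the
pull-back solves the equation on the punctured ball `M₁ \ {0}` and the Neumann problem with zero
datum is solved on `M₂`. No condition couples the two sides of the cloaking surface, because the
values of a test function on the surface are invisible from `M₁`, a point having zero capacity. -/
theorem forall_weakEquation_iff (h : IsPullback u G v V)
    (hfg : ∀ x ∈ M₁ \ {0}, f x = g (F₁ x))
    (hu : MemLp u 2 (volume.restrict M₁)) (hG : MemLp G 2 (volume.restrict M₁))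
    (hf : MemLp f 2 (volume.restrict M₁)) (hv : MemLp v 2 (volume.restrict M₂))
    (hV : MemLp V 2 (volume.restrict M₂)) (hg : MemLp g 2 (volume.restrict M₂)) :
    (∀ ψ : E → ℝ, ContDiff ℝ ∞ ψ → (∀ x ∈ outerBdry, ψ x = 0) →
      ∫ x in N, (-inner ℝ (flux V x) (gradient ψ x) + k ^ 2 * v x * ψ x * sqrtDet x) =
        ∫ x in N, g x * ψ x * sqrtDet x) ↔
      WeakDiv (M₁ \ {0}) G (fun x => f x - k ^ 2 * u x) ∧
      ∀ φ : E → ℝ, ContDiff ℝ ∞ φ →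
        ∫ x in M₂, (inner ℝ (V x) (gradient φ x) + (g x - k ^ 2 * v x) * φ x) = 0 := by
  have ha : MemLp (fun x => f x - k ^ 2 * u x) 2 (volume.restrict M₁) :=
    hf.sub (hu.const_mul (k ^ 2))
  have outer : WeakDiv (M₁ \ {0}) G (fun x => f x - k ^ 2 * u x) → ∀ ψ : E → ℝ, ContDiff ℝ ∞ ψ →
      (∀ x ∈ outerBdry, ψ x = 0) → ∫ x in M₁, (inner ℝ (G x) (gradient (fun z => ψ (F₁ z)) x) +
        (f x - k ^ 2 * u x) * ψ (F₁ x)) = 0 := by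
    intro hw ψ hψ h0
    obtain ⟨C, hC⟩ := exists_isSingularTest_comp_F₁ hψ h0
    exact hw.integral_singularTest hG ha hC
  constructor
  · intro H
    -- a test function on `M₁ \ {0}` pushes forward to one on `N` that vanishes on `M₂`
    have hw : WeakDiv (M₁ \ {0}) G (fun x => f x - k ^ 2 * u x) := by
      intro φ hφ
      have hψ := diffeo_N₁.symm.isTest_indicator_comp hφ
      set ψ := N₁.indicator fun y => φ (Finv y) with hψdef
      have key := (weakEquation_iff h hfg hu hG hf hv hV hg hψ.smooth fun x hx =>
        hψ.eq_zero fun hN => by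
          have : ‖x‖ = 2 := by simpa [outerBdry] using hx
          exact absurd hN.2 this.not_lt).1 (H ψ hψ.smooth fun x hx => hψ.eq_zero fun hN => by
          have : ‖x‖ = 2 := by simpa [outerBdry] using hx
          exact absurd hN.2 this.not_lt)
      have e2 : ∫ x in M₂, (inner ℝ (V x) (gradient ψ x) + (g x - k ^ 2 * v x) * ψ x) = 0 := by
        refine setIntegral_eq_zero_of_forall_eq_zero fun x hx => ?_
        have hx' : x ∉ N₁ := fun h' => Set.disjoint_left.1 disjoint_N₁_M₂ h' hx
        rw [hψ.gradient_eq_zero hx', hψ.eq_zero hx', inner_zero_right, mul_zero, add_zero]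
      have hφψ : ∀ x ∈ M₁ \ {0}, ψ (F₁ x) = φ x := fun x hx => by
        rw [hψdef, Set.indicator_of_mem (diffeo_N₁.mapsTo hx), diffeo_N₁.left_inv hx]
      rw [e2, add_zero, ← volume_restrict_punctured] at key
      rw [← key]
      refine setIntegral_congr_fun isOpen_punctured.measurableSet fun x hx => ?_
      simp only [gradient_congr_of_isOpen (ψ := fun z => ψ (F₁ z)) isOpen_punctured hφψ hx, hφψ x hx]
    refine ⟨hw, fun φ hφ => ?_⟩
    -- given `φ` on `M₂`, continue it to `N`; the part of the equation on `M₁` contributes nothing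
    obtain ⟨ψ, hψ, h0, hψφ⟩ := exists_contDiff_eqOn_M₂ hφ
    have key := (weakEquation_iff h hfg hu hG hf hv hV hg hψ h0).1 (H ψ hψ h0)
    rw [outer hw ψ hψ h0, zero_add] at key
    rw [← key]
    refine setIntegral_congr_fun isOpen_M₂.measurableSet fun x hx => ?_
    simp only [gradient_congr_of_isOpen isOpen_M₂ hψφ hx, hψφ x hx]
  · rintro ⟨hw, hn⟩ ψ hψ h0
    rw [weakEquation_iff h hfg hu hG hf hv hV hg hψ h0, outer hw ψ hψ h0, hn ψ hψ, add_zero]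

end WeakEquation

/-! ### Equivalence of the two problems -/

/-- The data of the two problems: `v`, `g` on the device correspond to `(u₁, u₂)`, `(f₁, f₂)` under
the transformation, and the sources are square integrable. -/
structure IsTransformed (u₁ u₂ v f₁ f₂ g : E → ℝ) : Prop where
  measurable₁ : Measurable u₁
  measurable : Measurable v
  fn₁ : ∀ x ∈ M₁ \ {0}, u₁ x = v (F₁ x)
  fn₂ : ∀ x ∈ M₂, u₂ x = v x
  memLp₁ : MemLp f₁ 2 (volume.restrict M₁)
  memLp₂ : MemLp f₂ 2 (volume.restrict M₂)
  source₁ : ∀ x ∈ M₁ \ {0}, f₁ x = g (F₁ x)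
  source₂ : ∀ x ∈ M₂, f₂ x = g x

namespace IsTransformed

variable {k : ℝ} {u₁ u₂ v f₁ f₂ g h ht : E → ℝ}

theorem ae_fn₂ (D : IsTransformed u₁ u₂ v f₁ f₂ g) : ∀ᵐ x ∂volume.restrict M₂, v x = u₂ x := by
  filter_upwards [ae_restrict_mem isOpen_M₂.measurableSet] with x hx
  exact (D.fn₂ x hx).symm

theorem memLp_target (D : IsTransformed u₁ u₂ v f₁ f₂ g) : MemLp g 2 (volume.restrict M₂) := by
  refine D.memLp₂.ae_eq ?_
  filter_upwards [ae_restrict_mem isOpen_M₂.measurableSet] with x hx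
  exact D.source₂ x hx

/-- A finite energy solution on the device gives solutions on `M₁` and `M₂`. -/
theorem solves_of_isFiniteEnergySolution (D : IsTransformed u₁ u₂ v f₁ f₂ g)
    (hh : ∀ x ∈ outerBdry, ht x = h x) (H : IsFiniteEnergySolution k g ht v) :
    SolvesOnM₁ k f₁ h u₁ ∧ SolvesOnM₂ k f₂ 0 u₂ := by
  obtain ⟨hmem, htr, V, hloc, hen, -, hweak⟩ := H
  rw [N_diff_surf] at hloc
  set G : E → E := fun x => (fderiv ℝ F₁ x).adjoint (V (F₁ x)) with hGdef
  have P : IsPullback u₁ G v V := ⟨D.fn₁, fun y hy => by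
    simp only [hGdef, diffeo_N₁.right_inv hy]⟩
  obtain ⟨hu₁, hv⟩ := (memLp_N_iff P D.measurable₁ D.measurable).1 hmem
  have hw1 : HasWeakGradient N₁ v V := hloc.1.mono Set.subset_union_left
  have hw2 : HasWeakGradient M₂ v V := hloc.1.mono Set.subset_union_right
  have hGm : AEStronglyMeasurable G (volume.restrict M₁) := by
    rw [← volume_restrict_punctured]
    exact diffeo_N₁.aestronglyMeasurable_adjoint_comp hw1.2.1.aestronglyMeasurable
  obtain ⟨hG, hV⟩ := (integrableOn_energyDensity_iff P hGm hw2.2.1.aestronglyMeasurable).1 hen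
  obtain ⟨hd, hn⟩ := (forall_weakEquation_iff P D.source₁ hu₁ hG D.memLp₁ hv hV D.memLp_target).1
    hweak
  have ha : MemLp (fun x => f₁ x - k ^ 2 * u₁ x) 2 (volume.restrict M₁) :=
    D.memLp₁.sub (hu₁.const_mul (k ^ 2))
  have hwp : HasWeakGradient (M₁ \ {0}) u₁ G := by
    refine (diffeo_N₁.hasWeakGradient_comp hw1).congr_ae ?_ (ae_of_all _ fun _ => rfl)
    filter_upwards [ae_restrict_mem isOpen_punctured.measurableSet] with x hx
    exact (D.fn₁ x hx).symm
  have hH1 : IsH1 M₁ u₁ G := ⟨hwp.of_punctured hu₁ hG, hu₁, hG⟩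
  obtain ⟨U, hUc, hUu⟩ := exists_continuousOn_of_weakDiv hH1 ha (hd.of_punctured hG ha)
  have hUu' : ∀ᵐ x ∂volume.restrict M₁, u₁ x = U x := hUu.mono fun _ hx => hx.symm
  constructor
  · refine ⟨U, hUc, by rwa [volume_restrict_punctured], ⟨G, ?_⟩, ?_⟩
    · rw [isHelmholtzSolution_iff D.memLp₁]
      refine ⟨hH1.congr_ae hUu' (ae_of_all _ fun _ => rfl),
        (hd.of_punctured hG ha).congr_ae (ae_of_all _ fun _ => rfl) ?_⟩
      filter_upwards [hUu] with x hx
      rw [hx]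
    · refine htr.comp_F₁ ?_ hh
      filter_upwards [hUu, ae_mem_punctured] with x hx hx'
      rw [hx, D.fn₁ x hx']
  · have hneu : ∀ φ : E → ℝ, ContDiff ℝ ∞ φ →
        ∫ x in M₂, (inner ℝ (V x) (gradient φ x) + (f₂ x - k ^ 2 * u₂ x) * φ x) = 0 := by
      intro φ hφ
      rw [← hn φ hφ]
      refine setIntegral_congr_fun isOpen_M₂.measurableSet fun x hx => ?_
      simp only [D.source₂ x hx, D.fn₂ x hx]
    refine ⟨V, ?_, fun φ hφ => by rw [hneu φ hφ]; rfl⟩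
    rw [isHelmholtzSolution_iff D.memLp₂]
    exact ⟨IsH1.congr_ae ⟨hw2, hv, hV⟩ D.ae_fn₂ (ae_of_all _ fun _ => rfl),
      fun φ hφ => hneu φ hφ.smooth⟩

/-- Solutions on `M₁` and on `M₂`, the latter with zero Neumann datum, give a finite energy solution:
its weak gradient is the push-forward of the gradient on `N₁` and the gradient itself on `M₂`. -/
theorem isFiniteEnergySolution_of_solves (D : IsTransformed u₁ u₂ v f₁ f₂ g)
    (hh : ∀ x ∈ outerBdry, h x = ht x) (H₁ : SolvesOnM₁ k f₁ h u₁) (H₂ : SolvesOnM₂ k f₂ 0 u₂) :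
    IsFiniteEnergySolution k g ht v := by
  classical
  obtain ⟨U, -, hUu, ⟨G, hU⟩, htr⟩ := H₁
  obtain ⟨V₂, hu₂, hneu⟩ := H₂
  rw [isHelmholtzSolution_iff D.memLp₁] at hU
  have hUu' := hUu
  rw [volume_restrict_punctured] at hUu'
  have hH1 : IsH1 M₁ u₁ G := hU.1.congr_ae hUu' (ae_of_all _ fun _ => rfl)
  have hd : WeakDiv M₁ G (fun x => f₁ x - k ^ 2 * u₁ x) := by
    refine hU.2.congr_ae (ae_of_all _ fun _ => rfl) ?_
    filter_upwards [hUu'] with x hx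
    rw [hx]
  set W : E → E := fun y => (fderiv ℝ Finv y).adjoint (G (Finv y)) with hW
  set V : E → E := fun y => if y ∈ N₁ then W y else V₂ y with hVdef
  have hV1 : ∀ y ∈ N₁, V y = W y := fun y hy => if_pos hy
  have hV2 : ∀ y ∈ M₂, V y = V₂ y := fun y hy =>
    if_neg fun h' => Set.disjoint_left.1 disjoint_N₁_M₂ h' hy
  have aeV1 : ∀ᵐ y ∂volume.restrict N₁, W y = V y := by
    filter_upwards [ae_restrict_mem isOpen_N₁.measurableSet] with y hy
    exact (hV1 y hy).symm
  have aeV2 : ∀ᵐ y ∂volume.restrict M₂, V₂ y = V y := by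
    filter_upwards [ae_restrict_mem isOpen_M₂.measurableSet] with y hy
    exact (hV2 y hy).symm
  have P : IsPullback u₁ G v V := by
    refine ⟨D.fn₁, fun y hy => ?_⟩
    have hx := diffeo_N₁.mapsTo_symm hy
    have hc := diffeo_N₁.fderiv_comp hx
    rw [diffeo_N₁.right_inv hy] at hc
    refine ext_inner_right ℝ fun w => ?_
    rw [hV1 y hy, ContinuousLinearMap.adjoint_inner_left, ContinuousLinearMap.adjoint_inner_left]
    exact congrArg (inner ℝ (G (Finv y))) (DFunLike.congr_fun hc w)
  have aefn : ∀ᵐ y ∂volume.restrict N₁, u₁ (Finv y) = v y := by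
    filter_upwards [ae_restrict_mem isOpen_N₁.measurableSet] with y hy
    exact P.fn_Finv hy
  have hpunct : IsH1 (M₁ \ {0}) u₁ G := hH1.mono Set.sdiff_subset
  have hv2 : IsH1 M₂ v V := by
    refine hu₂.1.congr_ae ?_ aeV2
    filter_upwards [D.ae_fn₂] with x hx
    exact hx.symm
  have hw1 : HasWeakGradient N₁ v V :=
    (diffeo_N₁.symm.hasWeakGradient_comp hpunct.1).congr_ae aefn aeV1
  have hloc1 : IsH1Loc N₁ v V := by
    refine ⟨hw1, fun K hc hK => ⟨?_, ?_⟩⟩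
    · exact (diffeo_N₁.symm.memLp_two_comp_of_isCompact hK hc hpunct.2.1).ae_eq
        (ae_restrict_of_ae_restrict_of_subset hK aefn)
    · obtain ⟨C, hC⟩ := hc.exists_bound_of_continuousOn
        (diffeo_N₁.symm.continuousOn_fderiv.mono hK)
      have hGK := diffeo_N₁.symm.memLp_two_comp_of_isCompact hK hc hpunct.2.2
      refine (hGK.norm.const_mul C).of_le (hw1.2.1.aestronglyMeasurable.mono_measure
        (Measure.restrict_mono hK le_rfl)) ?_
      filter_upwards [ae_restrict_mem hc.isClosed.measurableSet] with y hy
      rw [hV1 y (hK hy)]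
      refine (norm_adjoint_apply_le _ _).trans ((mul_le_mul_of_nonneg_right (hC y hy)
        (norm_nonneg _)).trans (le_abs_self _))
  have hloc2 : IsH1Loc M₂ v V := ⟨hv2.1, fun K _ hK =>
    ⟨hv2.2.1.mono_measure (Measure.restrict_mono hK le_rfl),
      hv2.2.2.mono_measure (Measure.restrict_mono hK le_rfl)⟩⟩
  refine ⟨(memLp_N_iff P D.measurable₁ D.measurable).2 ⟨hH1.2.1, hv2.2.1⟩, ?_, V,
    isH1Loc_of_pieces hloc1 hloc2,
    (integrableOn_energyDensity_iff P hH1.2.2.1 hv2.2.2.1).2 ⟨hH1.2.2, hv2.2.2⟩, ?_, ?_⟩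
  · refine htr.comp_Finv ?_ hh
    filter_upwards [diffeo_N₁.symm.ae_comp hUu, aefn] with y h1 h2
    rw [h1, h2]
  · rw [IntegrableOn, volume_restrict_N]
    refine (P.integrableOn_flux hH1.2.2).union ?_
    exact IntegrableOn.congr_fun (integrable_of_memLp_M₂ hv2.2.2)
      (fun y hy => (flux_of_mem_M₂ hy V).symm) isOpen_M₂.measurableSet
  · refine (forall_weakEquation_iff P D.source₁ hH1.2.1 hH1.2.2 D.memLp₁ hv2.2.1 hv2.2.2
      D.memLp_target).2 ⟨hd.mono Set.sdiff_subset, fun φ hφ => ?_⟩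
    have h0 := hneu φ hφ
    rw [LinearMap.zero_apply] at h0
    rw [← h0]
    refine setIntegral_congr_fun isOpen_M₂.measurableSet fun x hx => ?_
    simp only [D.source₂ x hx, D.fn₂ x hx, hV2 x hx]

end IsTransformed

/-- The Neumann datum is determined by the function. -/
theorem SolvesOnM₂.unique {k : ℝ} {f u : E → ℝ} {b b' : smoothBdry →ₗ[ℝ] ℝ}
    (H : SolvesOnM₂ k f b u) (H' : SolvesOnM₂ k f b' u) : b = b' := by
  obtain ⟨G, hG, h⟩ := H
  obtain ⟨G', hG', h'⟩ := H'
  refine LinearMap.ext fun ψ => ?_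
  obtain ⟨ψ, φ, hφ, hψ⟩ := ψ
  have e : (⟨ψ, φ, hφ, hψ⟩ : smoothBdry) = bdryRestrict φ hφ := Subtype.ext (funext hψ)
  rw [e, ← h φ hφ, ← h' φ hφ]
  refine integral_congr_ae ?_
  filter_upwards [hG.1.1.ae_eq isOpen_M₂ hG'.1.1] with x hx
  rw [hx]

end Cloak

theorem mainTheorem2 (k : ℝ) (u₁ u₂ ut f₁ f₂ ft h ht : Cloak.E → ℝ)
    (hu₁ : Measurable u₁) (hu₂ : Measurable u₂) (hut : Measurable ut)
    (hu₁F : ∀ x ∈ Cloak.M₁ \ {0}, u₁ x = ut (Cloak.F₁ x))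
    (hu₂F : ∀ x ∈ Cloak.M₂, u₂ x = ut (Cloak.F₂ x))
    (hf₁ : MemLp f₁ 2 (volume.restrict (Cloak.M₁ \ {0})))
    (hf₂ : MemLp f₂ 2 (volume.restrict Cloak.M₂))
    (hft : MemLp ft 2 (volume.restrict (Cloak.N \ Cloak.surf)))
    (hf₁s : Cloak.SupportedAwayFrom (Cloak.M₁ \ {0}) {0} f₁)
    (hfts : Cloak.SupportedAwayFrom (Cloak.N \ Cloak.surf) Cloak.surf ft)
    (hf₁F : ∀ x ∈ Cloak.M₁ \ {0}, f₁ x = ft (Cloak.F₁ x))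
    (hf₂F : ∀ x ∈ Cloak.M₂, f₂ x = ft (Cloak.F₂ x))
    (hhF : ∀ x ∈ Cloak.outerBdry, h x = ht (Cloak.F₁ x)) :
    (Cloak.IsFiniteEnergySolution k ft ht ut ↔
      Cloak.SolvesOnM₁ k f₁ h u₁ ∧ Cloak.SolvesOnM₂ k f₂ 0 u₂) ∧
    ∀ b : Cloak.smoothBdry →ₗ[ℝ] ℝ, b ≠ 0 →
      Cloak.SolvesOnM₁ k f₁ h u₁ → Cloak.SolvesOnM₂ k f₂ b u₂ →
        ¬ Cloak.IsFiniteEnergySolution k ft ht ut := by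
  rw [Cloak.volume_restrict_punctured] at hf₁
  have D : Cloak.IsTransformed u₁ u₂ ut f₁ f₂ ft :=
    ⟨hu₁, hut, hu₁F, hu₂F, hf₁, hf₂, hf₁F, hf₂F⟩
  have hh : ∀ x ∈ Cloak.outerBdry, h x = ht x := fun x hx => by
    rw [hhF x hx, Cloak.F₁_of_mem_outerBdry hx]
  have forward : Cloak.IsFiniteEnergySolution k ft ht ut →
      Cloak.SolvesOnM₁ k f₁ h u₁ ∧ Cloak.SolvesOnM₂ k f₂ 0 u₂ :=
    D.solves_of_isFiniteEnergySolution fun x hx => (hh x hx).symm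
  refine ⟨⟨forward, fun H => D.isFiniteEnergySolution_of_solves hh H.1 H.2⟩, ?_⟩
  intro b hb _ hb₂ H
  exact hb (hb₂.unique (forward H).2)
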